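/- Let $K$ be a field of characteristic $0$ and let $q\in K^*$ not be a root of unity (for instance $K=\Bbbk(q)$, the field of rational functions over a field $\Bbbk$ of characteristic $0$). Let $A=C_q(B_+)=U_q(\mathfrak b_+)$ be the Hopf algebra generated by $X,g,g^{-1}$ with relations $gg^{-1}=g^{-1}g=1$, $Xg=qgX$, and $\Delta X=X\otimes 1+g\otimes X$, $\Delta g=g\otimes g$, $\epsilon(X)=0$, $\epsilon(g)=1$, $SX=-g^{-1}X$, $Sg=g^{-1}$. It is paired with itself by $$\langle X^ng^m,X^rg^s\rangle=\delta_{n,r}\,[n]_q!\,q^{-n(n-1)/2}q^{-ms}\qquad(n,r\ge 0,\ m,s\in\mathbb Z),$$ where $[n]_q=\sum_{i=0}^{n-1}q^i$ and $[n]_q!=[1]_q\cdots[n]_q$; the first argument is regarded as lying in $U_q(\mathfrak b_+)$, the second in $C_q(B_+)$. A *calculus* is a bicovariant first order differential calculus $(\Gamma,\mathrm d)$ on $A$ in the sense of Woronowicz: an $A$-bimodule $\Gamma$ with a linear map $\mathrm d:A\to\Gamma$ satisfying the Leibniz rule, with $\Gamma=A\,\mathrm dA$, such that $a\,\mathrm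 db\mapsto\Delta(a)(\mathrm{id}\otimes \mathrm d)\Delta(b)$ and $a\,\mathrm db\mapsto\Delta(a)(\mathrm d\otimes\mathrm{id})\Delta(b)$ give well-defined coactions $\Gamma\to A\otimes\Gamma$ and $\Gamma\to\Gamma\otimes A$. Its dimension is the dimension over $K$ of the space of right invariant forms. It is *coirreducible* if it is nonzero and has no proper nonzero quotient calculus. A *quantum tangent space* is a subspace $L\subset\ker\epsilon\subset U_q(\mathfrak b_+)$ invariant under the actions $h\triangleright x=h_{(1)}xS(h_{(2)})$ and $a\triangleright x=\langle x_{(1)},a\rangle x_{(2)}$ followed by the projection $x\mapsto x-\epsilon(x)1$ to $\ker\epsilon$; it is *irreducible* if it is nonzero and contains no proper nonzero quantum tangent space. The quantum tangent space corresponding to $\Gamma$ is the annihilator in $\ker\epsilon$ of $M=\{v\in\ker\epsilon : \mathrm d(v_{(1)})S(v_{(2)})=0\}$. For $x\in U_q(\mathfrak b_+)$ put $\partial_x(a)=\langle x,a_{(1)}\rangle a_{(2)}$. Write $\mathbb N=\{1,2,\dots\}$ and $[a,b]_p=ab-p\,ba$. **(a)** Isomorphism classes of finite-dimensional calculi $\Gamma$,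 and finite-dimensional quantum tangent spaces $L$, are each in one-to-one correspondence with finite subsets $I\subset\mathbb N\setminus\{1\}$, $I\mapsto\Gamma_I$ and $I\mapsto L_I$, in such a way that $L_I$ is the quantum tangent space corresponding to $\Gamma_I$, and $\dim\Gamma_I=\dim L_I=\sum_{n\in I}n$. Moreover there is an isomorphism of right $A$-modules $\Gamma_I\cong\mathrm{Lin}(L_I,A)$ sending $\mathrm da$ to $x\mapsto\partial_x(a)$. **(b)** $\Gamma_I$ is coirreducible if and only if $I=\{n\}$ for some $n\ge2$, and $L_I$ is irreducible if and only if $I=\{n\}$ for some $n\ge 2$. For $n\ge2$, $\Gamma^n:=\Gamma_{\{n\}}$ has a basis $\eta_0,\dots,\eta_{n-1}$ as a right $A$-module consisting of right invariant forms such that $$\mathrm dX=\eta_1+(q^{n-1}-1)\eta_0X,\qquad \mathrm dg=(q^{n-1}-1)\eta_0g,\qquad [a,\eta_0]_1=\mathrm da\quad\forall a\in A,$$ $$[g,\eta_i]_{q^{n-1-i}}=0\quad\forall i,\qquad [X,\eta_i]_{q^{n-1-i}}=\begin{cases}\eta_{i+1}& i<n-1\\0&i=n-1,\end{cases}$$ and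 such that, for the dual basis $\phi_0,\dots,\phi_{n-1}$ of $L^n:=L_{\{n\}}$ (dual under $\Gamma^n\cong\mathrm{Lin}(L^n,A)$), the operators $\partial_i=\partial_{\phi_i}$ are $$\partial_i{:}f{:}={:}Q_{n-1-i,g}\,Q_{n-1-i,X}\,\tfrac1{[i]_q!}(\partial_{q,X})^if{:}\quad(1\le i\le n-1),\qquad \partial_0{:}f{:}={:}Q_{n-1,g}\,Q_{n-1,X}f-f{:}$$ for all $f$ in the commutative algebra $K[X,g,g^{-1}]$. Here ${:}\ {:}$ is the linear map $K[X,g,g^{-1}]\to A$ with $g^aX^b\mapsto g^aX^b$, and $(Q_{m,x}f)(x)=f(q^mx)$, $(\partial_{q,x}f)(x)=\frac{f(x)-f(qx)}{x(1-q)}$. **(c)** For every finite $I\subset\mathbb N\setminus\{1\}$ one has $\Gamma_I\cong\bigoplus_{n\in I}\Gamma^n$ as bimodules, with the differential $\mathrm d$ of $\Gamma_I$ going to the sum of the differentials of the $\Gamma^n$, and $L_I=\bigoplus_{n\in I}L^n$. -/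

import Mathlib

open scoped TensorProduct
open MulOpposite

universe u v w w'

/-! ## The quantum group `U_q(b₊) ≅ C_q(B₊)` -/

/-- Names of the generators `X`, `g`, `g⁻¹`. -/
inductive QGen : Type
  | X : QGen
  | g : QGen
  | gInv : QGen

/-- The defining relations `g g⁻¹ = g⁻¹ g = 1` and `X g = q g X`. -/
inductive QRel (K : Type*) [Field K] (q : Kˣ) :
    FreeAlgebra K QGen → FreeAlgebra K QGen → Prop
  | mul_inv : QRel K q (FreeAlgebra.ι K QGen.g * FreeAlgebra.ι K QGen.gInv) 1
  | inv_mul : QRel K q (FreeAlgebra.ι K QGen.gInv * FreeAlgebra.ι K QGen.g) 1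
  | comm : QRel K q (FreeAlgebra.ι K QGen.X * FreeAlgebra.ι K QGen.g)
      ((q : K) • (FreeAlgebra.ι K QGen.g * FreeAlgebra.ι K QGen.X))

/-- The algebra `K⟨X, g, g⁻¹⟩` with relations `g g⁻¹ = g⁻¹ g = 1`, `X g = q g X`. It is at the same
time the quantum enveloping algebra `U_q(b₊)` and the quantum function algebra `C_q(B₊)`. -/
def QB (K : Type*) [Field K] (q : Kˣ) : Type _ := RingQuot (QRel K q)

namespace QB

variable {K : Type*} [Field K] (q : Kˣ)

instance : Ring (QB K q) := inferInstanceAs (Ring (RingQuot (QRel K q)))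

instance : Algebra K (QB K q) := inferInstanceAs (Algebra K (RingQuot (QRel K q)))

/-- The quotient map from the free algebra. -/
noncomputable def mk : FreeAlgebra K QGen →ₐ[K] QB K q := RingQuot.mkAlgHom K (QRel K q)

/-- The image of a generator. -/
noncomputable def gen (s : QGen) : QB K q := mk q (FreeAlgebra.ι K s)

/-- The generator `X`. -/
noncomputable def X : QB K q := gen q QGen.X

theorem gen_g_mul_gInv : gen q QGen.g * gen q QGen.gInv = 1 := by
  have h := RingQuot.mkAlgHom_rel K (QRel.mul_inv (K := K) (q := q))
  rw [map_mul, map_one] at h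
  exact h

theorem gen_gInv_mul_g : gen q QGen.gInv * gen q QGen.g = 1 := by
  have h := RingQuot.mkAlgHom_rel K (QRel.inv_mul (K := K) (q := q))
  rw [map_mul, map_one] at h
  exact h

/-- The invertible generator `g`. -/
noncomputable def g : (QB K q)ˣ :=
  ⟨gen q QGen.g, gen q QGen.gInv, gen_g_mul_gInv q, gen_gInv_mul_g q⟩

theorem X_mul_g : X q * (g q : QB K q) = (q : K) • ((g q : QB K q) * X q) := by
  have h := RingQuot.mkAlgHom_rel K (QRel.comm (K := K) (q := q))
  rw [map_mul, map_smul, map_mul] at h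
  exact h

/-- The universal property of the presentation. -/
noncomputable def lift {B : Type*} [Ring B] [Algebra K B] (x : B) (u : Bˣ)
    (h : x * (u : B) = (q : K) • ((u : B) * x)) : QB K q →ₐ[K] B :=
  RingQuot.liftAlgHom K ⟨FreeAlgebra.lift K (fun s => match s with
    | QGen.X => x
    | QGen.g => (u : B)
    | QGen.gInv => ((u⁻¹ : Bˣ) : B)), by
      intro a b hab
      cases hab <;> simp [h]⟩

section lift
variable {B : Type*} [Ring B] [Algebra K B] (x : B) (u : Bˣ)
    (h : x * (u : B) = (q : K) • ((u : B) * x))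

@[simp] theorem lift_X : lift q x u h (X q) = x := by
  unfold lift X gen mk
  erw [RingQuot.liftAlgHom_mkAlgHom_apply]
  simp

@[simp] theorem lift_g : lift q x u h (g q : QB K q) = u := by
  change lift q x u h (gen q QGen.g) = u
  unfold lift gen mk
  erw [RingQuot.liftAlgHom_mkAlgHom_apply]
  simp

@[simp] theorem lift_gInv : lift q x u h (((g q)⁻¹ : (QB K q)ˣ) : QB K q) = (u⁻¹ : Bˣ) := by
  change lift q x u h (gen q QGen.gInv) = (u⁻¹ : Bˣ)
  unfold lift gen mk
  erw [RingQuot.liftAlgHom_mkAlgHom_apply]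
  simp

end lift

/-- The subalgebra generated by `X, g, g⁻¹` is everything. -/
theorem induction {P : QB K q → Prop} (hX : P (X q)) (hg : P (g q : QB K q))
    (hg' : P (((g q)⁻¹ : (QB K q)ˣ) : QB K q)) (hs : ∀ k : K, P (algebraMap K _ k))
    (hadd : ∀ a b, P a → P b → P (a + b)) (hmul : ∀ a b, P a → P b → P (a * b)) (a : QB K q) :
    P a := by
  obtain ⟨b, rfl⟩ : ∃ b, mk q b = a := RingQuot.mkAlgHom_surjective K (QRel K q) a
  induction b using FreeAlgebra.induction with
  | grade0 r =>
    rw [AlgHom.commutes]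
    exact hs r
  | grade1 s => cases s <;> assumption
  | mul a b ha hb =>
    rw [map_mul]
    exact hmul _ _ ha hb
  | add a b ha hb =>
    rw [map_add]
    exact hadd _ _ ha hb

theorem algHom_ext {B : Type*} [Ring B] [Algebra K B] {f f' : QB K q →ₐ[K] B}
    (hX : f (X q) = f' (X q)) (hg : f (g q : QB K q) = f' (g q : QB K q)) : f = f' := by
  ext a
  refine induction q (P := fun a => f a = f' a) hX hg ?_ ?_ ?_ ?_ a
  · have h1 : Units.map (f : QB K q →* B) (g q) = Units.map (f' : QB K q →* B) (g q) :=
      Units.ext hg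
    have h2 := congrArg (fun u : Bˣ => ((u⁻¹ : Bˣ) : B)) h1
    simpa [← map_inv] using h2
  · intro k; simp
  · intro a b ha hb; simp [ha, hb]
  · intro a b ha hb; simp [ha, hb]

/-! ### Hopf algebra structure -/

/-- `Δ X = X ⊗ 1 + g ⊗ X`, `Δ g = g ⊗ g`. -/
noncomputable def comulHom : QB K q →ₐ[K] QB K q ⊗[K] QB K q :=
  lift q (X q ⊗ₜ[K] 1 + (g q : QB K q) ⊗ₜ[K] X q)
    ⟨(g q : QB K q) ⊗ₜ[K] (g q : QB K q),
      (((g q)⁻¹ : (QB K q)ˣ) : QB K q) ⊗ₜ[K] (((g q)⁻¹ : (QB K q)ˣ) : QB K q),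
      by simp [Algebra.TensorProduct.one_def], by simp [Algebra.TensorProduct.one_def]⟩ (by
      simp [add_mul, mul_add, X_mul_g, TensorProduct.smul_tmul'])

/-- `ε X = 0`, `ε g = 1`. -/
noncomputable def counitHom : QB K q →ₐ[K] K := lift q 0 1 (by simp)

/-- `S X = - g⁻¹ X`, `S g = g⁻¹`, extended as an anti-homomorphism. -/
noncomputable def antipodeHom : QB K q →ₐ[K] (QB K q)ᵐᵒᵖ :=
  lift q (op (-((((g q)⁻¹ : (QB K q)ˣ) : QB K q) * X q)))
    ⟨op (((g q)⁻¹ : (QB K q)ˣ) : QB K q), op (g q : QB K q), by simp [← op_mul], by simp [← op_mul]⟩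
    (by
      have h : (((g q)⁻¹ : (QB K q)ˣ) : QB K q) * X q
          = (q : K) • (X q * (((g q)⁻¹ : (QB K q)ˣ) : QB K q)) := by
        have := congrArg (fun y => (((g q)⁻¹ : (QB K q)ˣ) : QB K q) * y
          * (((g q)⁻¹ : (QB K q)ˣ) : QB K q)) (X_mul_g q)
        simpa [mul_assoc] using this
      simp only [← op_mul, ← op_smul, op_inj]
      rw [mul_neg, neg_mul, smul_neg, mul_assoc, ← mul_smul_comm, ← h])

noncomputable instance : Bialgebra K (QB K q) :=
  Bialgebra.ofAlgHom (comulHom q) (counitHom q)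
    (algHom_ext q
      (by simp [comulHom, TensorProduct.add_tmul, TensorProduct.tmul_add,
            Algebra.TensorProduct.one_def, add_assoc])
      (by simp [comulHom]))
    (algHom_ext q
      (by simp [comulHom, counitHom])
      (by simp [comulHom, counitHom]))
    (algHom_ext q
      (by simp [comulHom, counitHom])
      (by simp [comulHom, counitHom]))

theorem comul_eq (a : QB K q) : Coalgebra.comul (R := K) a = comulHom q a := rfl

theorem counit_eq (a : QB K q) : Coalgebra.counit (R := K) a = counitHom q a := rfl

/-- The antipode as a linear map. -/
noncomputable def antipodeLin : QB K q →ₗ[K] QB K q :=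
  (opLinearEquiv K).symm.toLinearMap ∘ₗ (antipodeHom q).toLinearMap

theorem antipodeLin_mul (a b : QB K q) :
    antipodeLin q (a * b) = antipodeLin q b * antipodeLin q a := by
  simp [antipodeLin]

@[simp] theorem antipodeLin_X :
    antipodeLin q (X q) = -((((g q)⁻¹ : (QB K q)ˣ) : QB K q) * X q) := by
  simp [antipodeLin, antipodeHom]

@[simp] theorem antipodeLin_g :
    antipodeLin q (g q : QB K q) = (((g q)⁻¹ : (QB K q)ˣ) : QB K q) := by
  simp [antipodeLin, antipodeHom]

@[simp] theorem antipodeLin_gInv :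
    antipodeLin q (((g q)⁻¹ : (QB K q)ˣ) : QB K q) = (g q : QB K q) := by
  simp [antipodeLin, antipodeHom]

@[simp] theorem antipodeLin_one : antipodeLin q (1 : QB K q) = 1 := by
  simp [antipodeLin]

theorem antipode_left (a : QB K q) :
    LinearMap.mul' K (QB K q) ((antipodeLin q).rTensor (QB K q) (comulHom q a)) =
      algebraMap K _ (counitHom q a) := by
  have key : ∀ x : QB K q ⊗[K] QB K q, ∀ y₁ y₂ : QB K q,
      LinearMap.mul' K _ ((antipodeLin q).rTensor _ (x * y₁ ⊗ₜ[K] y₂)) =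
        antipodeLin q y₁ * LinearMap.mul' K _ ((antipodeLin q).rTensor _ x) * y₂ := by
    intro x y₁ y₂
    induction x with
    | zero => simp
    | tmul a b => simp [antipodeLin_mul, mul_assoc]
    | add a b ha hb => simp only [add_mul, map_add, ha, hb, mul_add]
  have key2 : ∀ (x y : QB K q ⊗[K] QB K q) (c : K),
      LinearMap.mul' K _ ((antipodeLin q).rTensor _ x) = algebraMap K _ c →
      LinearMap.mul' K _ ((antipodeLin q).rTensor _ (x * y)) =
        algebraMap K _ c * LinearMap.mul' K _ ((antipodeLin q).rTensor _ y) := by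
    intro x y c hx
    induction y with
    | zero => simp
    | tmul a b =>
      rw [key, hx, ← Algebra.commutes]
      simp [mul_assoc]
    | add a b ha hb => simp only [mul_add, map_add, ha, hb]
  refine induction q (P := fun a =>
    LinearMap.mul' K (QB K q) ((antipodeLin q).rTensor (QB K q) (comulHom q a)) =
      algebraMap K _ (counitHom q a)) ?_ ?_ ?_ ?_ ?_ ?_ a
  · simp [comulHom, counitHom]
  · simp [comulHom, counitHom]
  · simp [comulHom, counitHom]
  · intro k
    simp [Algebra.TensorProduct.one_def, Algebra.algebraMap_eq_smul_one]
  · intro a b ha hb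
    simp only [map_add, ha, hb]
  · intro a b ha hb
    rw [map_mul, key2 _ _ _ ha, hb, map_mul, map_mul]

theorem antipode_right (a : QB K q) :
    LinearMap.mul' K (QB K q) ((antipodeLin q).lTensor (QB K q) (comulHom q a)) =
      algebraMap K _ (counitHom q a) := by
  have key : ∀ y : QB K q ⊗[K] QB K q, ∀ x₁ x₂ : QB K q,
      LinearMap.mul' K _ ((antipodeLin q).lTensor _ (x₁ ⊗ₜ[K] x₂ * y)) =
        x₁ * LinearMap.mul' K _ ((antipodeLin q).lTensor _ y) * antipodeLin q x₂ := by
    intro y x₁ x₂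
    induction y with
    | zero => simp
    | tmul a b => simp [antipodeLin_mul, mul_assoc]
    | add a b ha hb => simp only [add_mul, map_add, ha, hb, mul_add]
  have key2 : ∀ (x y : QB K q ⊗[K] QB K q) (c : K),
      LinearMap.mul' K _ ((antipodeLin q).lTensor _ y) = algebraMap K _ c →
      LinearMap.mul' K _ ((antipodeLin q).lTensor _ (x * y)) =
        LinearMap.mul' K _ ((antipodeLin q).lTensor _ x) * algebraMap K _ c := by
    intro x y c hy
    induction x with
    | zero => simp
    | tmul a b =>
      rw [key, hy, mul_assoc, Algebra.commutes, ← mul_assoc]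
      simp
    | add a b ha hb => simp only [add_mul, map_add, ha, hb]
  refine induction q (P := fun a =>
    LinearMap.mul' K (QB K q) ((antipodeLin q).lTensor (QB K q) (comulHom q a)) =
      algebraMap K _ (counitHom q a)) ?_ ?_ ?_ ?_ ?_ ?_ a
  · simp [comulHom, counitHom]
  · simp [comulHom, counitHom]
  · simp [comulHom, counitHom]
  · intro k
    simp [Algebra.TensorProduct.one_def, Algebra.algebraMap_eq_smul_one]
  · intro a b ha hb
    simp only [map_add, ha, hb]
  · intro a b ha hb
    rw [map_mul, key2 _ _ _ hb, ha, map_mul, map_mul]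

noncomputable instance : HopfAlgebra K (QB K q) where
  antipode := antipodeLin q
  mul_antipode_rTensor_comul := LinearMap.ext (antipode_left q)
  mul_antipode_lTensor_comul := LinearMap.ext (antipode_right q)

/-! ### The monomial basis and the self-pairing -/

/-- The monomial `X ^ n g ^ m`, `n ∈ ℕ`, `m ∈ ℤ`. -/
noncomputable def mono (p : ℕ × ℤ) : QB K q := X q ^ p.1 * ((g q ^ p.2 : (QB K q)ˣ) : QB K q)

theorem g_mul_X : (g q : QB K q) * X q = ((q⁻¹ : Kˣ) : K) • (X q * (g q : QB K q)) := by
  rw [X_mul_g, smul_smul]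
  simp

theorem g_mul_X_pow (n : ℕ) :
    (g q : QB K q) * X q ^ n = ((q⁻¹ : Kˣ) : K) ^ n • (X q ^ n * (g q : QB K q)) := by
  induction n with
  | zero => simp
  | succ n ih =>
    rw [pow_succ, ← mul_assoc, ih, smul_mul_assoc, mul_assoc, g_mul_X, mul_smul_comm, smul_smul,
      pow_succ, mul_assoc]

theorem gInv_mul_X_pow (n : ℕ) : (((g q)⁻¹ : (QB K q)ˣ) : QB K q) * X q ^ n =
    (q : K) ^ n • (X q ^ n * (((g q)⁻¹ : (QB K q)ˣ) : QB K q)) := by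
  have h := congrArg (fun y => (q : K) ^ n • ((((g q)⁻¹ : (QB K q)ˣ) : QB K q) * y *
    (((g q)⁻¹ : (QB K q)ˣ) : QB K q))) (g_mul_X_pow q n)
  simp only [mul_smul_comm, smul_mul_assoc, smul_smul, ← mul_pow, Units.mul_inv, one_pow, one_smul,
    Units.inv_mul_cancel_left] at h
  rw [h, mul_assoc, Units.mul_inv_cancel_right]

theorem span_mono : ⊤ ≤ Submodule.span K (Set.range (mono q)) := by
  have key : ∀ a : QB K q, ∀ s ∈ Submodule.span K (Set.range (mono q)),
      a * s ∈ Submodule.span K (Set.range (mono q)) := by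
    have red : ∀ a : QB K q, (∀ p, a * mono q p ∈ Submodule.span K (Set.range (mono q))) →
        ∀ s ∈ Submodule.span K (Set.range (mono q)),
          a * s ∈ Submodule.span K (Set.range (mono q)) := by
      intro a h s hs
      induction hs using Submodule.span_induction with
      | mem x hx => obtain ⟨p, rfl⟩ := hx; exact h p
      | zero => simp
      | add x y _ _ hx hy => rw [mul_add]; exact add_mem hx hy
      | smul k x _ hx => rw [mul_smul_comm]; exact Submodule.smul_mem _ _ hx
    intro a
    refine induction q (P := fun a => ∀ s ∈ Submodule.span K (Set.range (mono q)),
      a * s ∈ Submodule.span K (Set.range (mono q))) (red _ ?_) (red _ ?_) (red _ ?_) ?_ ?_ ?_ a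
    · rintro ⟨n, m⟩
      refine Submodule.subset_span ⟨(n + 1, m), ?_⟩
      simp [mono, pow_succ', mul_assoc]
    · rintro ⟨n, m⟩
      have : (g q : QB K q) * mono q (n, m) = ((q⁻¹ : Kˣ) : K) ^ n • mono q (n, m + 1) := by
        simp only [mono]
        rw [← mul_assoc, g_mul_X_pow, smul_mul_assoc, mul_assoc, ← Units.val_mul, ← zpow_one_add,
          add_comm]
      rw [this]
      exact Submodule.smul_mem _ _ (Submodule.subset_span ⟨_, rfl⟩)
    · rintro ⟨n, m⟩
      have : (((g q)⁻¹ : (QB K q)ˣ) : QB K q) * mono q (n, m) =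
          (q : K) ^ n • mono q (n, m - 1) := by
        simp only [mono]
        rw [← mul_assoc, gInv_mul_X_pow, smul_mul_assoc, mul_assoc, ← Units.val_mul,
          ← zpow_neg_one, ← zpow_add, neg_add_eq_sub]
      rw [this]
      exact Submodule.smul_mem _ _ (Submodule.subset_span ⟨_, rfl⟩)
    · intro k s hs
      rw [← Algebra.smul_def]
      exact Submodule.smul_mem _ _ hs
    · intro a b ha hb s hs
      rw [add_mul]
      exact add_mem (ha s hs) (hb s hs)
    · intro a b ha hb s hs
      rw [mul_assoc]
      exact ha _ (hb s hs)
  intro a _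
  have := key a 1 (Submodule.subset_span ⟨(0, 0), by simp [mono]⟩)
  rwa [mul_one] at this

/-- `X` acting on the vector space with basis `ℕ × ℤ`. -/
noncomputable def repX : Module.End K (ℕ × ℤ →₀ K) :=
  Finsupp.linearCombination K (fun p => Finsupp.single (p.1 + 1, p.2) 1)

/-- `g` acting on the vector space with basis `ℕ × ℤ`. -/
noncomputable def repG : (Module.End K (ℕ × ℤ →₀ K))ˣ where
  val := Finsupp.linearCombination K
    (fun p => Finsupp.single (p.1, p.2 + 1) (((q⁻¹ : Kˣ) : K) ^ p.1))
  inv := Finsupp.linearCombination K (fun p => Finsupp.single (p.1, p.2 - 1) ((q : K) ^ p.1))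
  val_inv := by
    refine Finsupp.lhom_ext' fun p => LinearMap.ext_ring ?_
    simp
  inv_val := by
    refine Finsupp.lhom_ext' fun p => LinearMap.ext_ring ?_
    simp

/-- The representation by left multiplication on monomials. -/
noncomputable def rep : QB K q →ₐ[K] Module.End K (ℕ × ℤ →₀ K) :=
  lift q (repX (K := K)) (repG q) (by
    refine Finsupp.lhom_ext' fun p => LinearMap.ext_ring ?_
    simp [repX, repG, pow_succ, -Finsupp.single_mul, Finsupp.smul_single])

theorem rep_mono (p : ℕ × ℤ) :
    rep q (mono q p) (Finsupp.single (0, 0) 1) = Finsupp.single p 1 := by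
  have hg : ∀ u : (QB K q)ˣ, ∀ m : ℤ, rep q ((u ^ m : (QB K q)ˣ) : QB K q) =
      ((Units.map (rep q : QB K q →* Module.End K (ℕ × ℤ →₀ K)) u) ^ m : (Module.End K _)ˣ) := by
    intro u m
    rw [← map_zpow]
    rfl
  have hg' : Units.map (rep q : QB K q →* Module.End K (ℕ × ℤ →₀ K)) (g q) = repG q :=
    Units.ext (by simp [rep])
  have h1 : ∀ m : ℤ, ((repG q ^ m : (Module.End K (ℕ × ℤ →₀ K))ˣ) :
      Module.End K (ℕ × ℤ →₀ K)) (Finsupp.single (0, 0) 1) = Finsupp.single (0, m) 1 := by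
    intro m
    induction m with
    | zero => simp
    | succ i ih =>
      rw [add_comm, zpow_add, Units.val_mul, Module.End.mul_apply, ih, zpow_one, add_comm]
      simp [repG]
    | pred i ih =>
      rw [sub_eq_add_neg, add_comm, zpow_add, Units.val_mul, Module.End.mul_apply, ih,
        zpow_neg_one, add_comm]
      simp [repG, sub_eq_add_neg]
  have h2 : ∀ n : ℕ, ∀ m : ℤ, ((repX : Module.End K (ℕ × ℤ →₀ K)) ^ n)
      (Finsupp.single (0, m) 1) = Finsupp.single (n, m) 1 := by
    intro n m
    induction n with
    | zero => simp
    | succ n ih =>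
      rw [pow_succ', Module.End.mul_apply, ih]
      simp [repX]
  obtain ⟨n, m⟩ := p
  simp only [mono, map_mul, map_pow, hg, hg', Module.End.mul_apply]
  rw [h1]
  simp only [rep, lift_X]
  exact h2 n m

theorem linearIndependent_mono : LinearIndependent K (mono q) := by
  refine LinearIndependent.of_comp
    ((LinearMap.applyₗ (Finsupp.single ((0, 0) : ℕ × ℤ) (1 : K))) ∘ₗ (rep q).toLinearMap) ?_
  convert (Finsupp.basisSingleOne (R := K) (ι := ℕ × ℤ)).linearIndependent using 1
  ext1 p
  simp [rep_mono]

/-- The vector space basis `X ^ n g ^ m`. -/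
noncomputable def basis : Module.Basis (ℕ × ℤ) K (QB K q) :=
  Module.Basis.mk (linearIndependent_mono q) (span_mono q)

theorem basis_apply (p : ℕ × ℤ) : basis q p = mono q p := by
  simp [basis]

/-- The `q`-integer `[n]_q = 1 + q + ⋯ + q ^ (n - 1)`. -/
def qInt (t : K) (n : ℕ) : K := ∑ i ∈ Finset.range n, t ^ i

/-- The `q`-factorial `[n]_q! = [1]_q [2]_q ⋯ [n]_q`. -/
def qFactorial (t : K) (n : ℕ) : K := ∏ i ∈ Finset.range n, qInt t (i + 1)

/-- The pairing of `U_q(b₊)` (first argument) with `C_q(B₊)` (second argument),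
`⟨X ^ n g ^ m, X ^ r g ^ s⟩ = δ_{n,r} [n]_q! q ^ (- n (n - 1) / 2) q ^ (- m s)`. -/
noncomputable def pairing : QB K q →ₗ[K] QB K q →ₗ[K] K :=
  (basis q).constr K fun p => (basis q).constr K fun p' =>
    if p.1 = p'.1 then
      qFactorial (q : K) p.1 * ((q ^ (-((p.1 * (p.1 - 1) / 2 : ℕ) : ℤ)) : Kˣ) : K) *
        ((q ^ (-(p.2 * p'.2)) : Kˣ) : K)
    else 0

theorem pairing_apply (n r : ℕ) (m s : ℤ) :
    pairing q (X q ^ n * ((g q ^ m : (QB K q)ˣ) : QB K q))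
      (X q ^ r * ((g q ^ s : (QB K q)ˣ) : QB K q)) =
    if n = r then
      qFactorial (q : K) n * ((q ^ (-((n * (n - 1) / 2 : ℕ) : ℤ)) : Kˣ) : K) *
        ((q ^ (-(m * s)) : Kˣ) : K)
    else 0 := by
  have h1 := basis_apply q (n, m)
  have h2 := basis_apply q (r, s)
  simp only [mono] at h1 h2
  rw [← h1, ← h2]
  simp [pairing, Module.Basis.constr_basis]

/-! ### Commutative Laurent polynomials, `q`-difference operators, normal ordering -/

/-- The commutative algebra `K[X, g, g⁻¹]`; the exponent `(b, a)` stands for `g ^ a X ^ b`. -/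
abbrev CommPoly (K : Type*) [Field K] : Type _ := AddMonoidAlgebra K (ℕ × ℤ)

/-- The linear map with prescribed values on the monomials `g ^ a X ^ b`. -/
noncomputable def onMonomials {V : Type*} [AddCommGroup V] [Module K V] (v : ℕ × ℤ → V) :
    CommPoly K →ₗ[K] V :=
  Finsupp.linearCombination K v ∘ₗ (AddMonoidAlgebra.coeffLinearEquiv K).toLinearMap

@[simp] theorem onMonomials_single {V : Type*} [AddCommGroup V] [Module K V] (v : ℕ × ℤ → V)
    (p : ℕ × ℤ) (k : K) : onMonomials v (AddMonoidAlgebra.single p k) = k • v p := by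
  simp [onMonomials]

/-- `(Q_{m,X} f)(g, X) = f(g, q ^ m X)`. -/
noncomputable def QX (m : ℤ) : CommPoly K →ₗ[K] CommPoly K :=
  onMonomials fun p => AddMonoidAlgebra.single p ((q ^ (m * p.1) : Kˣ) : K)

/-- `(Q_{m,g} f)(g, X) = f(q ^ m g, X)`. -/
noncomputable def Qg (m : ℤ) : CommPoly K →ₗ[K] CommPoly K :=
  onMonomials fun p => AddMonoidAlgebra.single p ((q ^ (m * p.2) : Kˣ) : K)

/-- The `q`-derivative `(∂_{q,X} f)(g, X) = (f(g, X) - f(g, q X)) / (X (1 - q))`, that is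
`g ^ a X ^ b ↦ [b]_q g ^ a X ^ (b - 1)`. -/
noncomputable def dqX : CommPoly K →ₗ[K] CommPoly K :=
  onMonomials fun p => AddMonoidAlgebra.single (p.1 - 1, p.2) (qInt (q : K) p.1)

theorem X_mul_dqX (f : CommPoly K) :
    AddMonoidAlgebra.single ((1, 0) : ℕ × ℤ) (1 - (q : K)) * dqX q f = f - QX q 1 f := by
  induction f using AddMonoidAlgebra.induction_linear with
  | zero => simp
  | add f g hf hg => rw [map_add, map_add, mul_add, hf, hg]; abel
  | single p k =>
    obtain ⟨b, a⟩ := p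
    have h : (1 - (q : K)) * qInt (q : K) b = 1 - (q : K) ^ b := by
      rw [qInt, mul_comm, geom_sum_mul_neg]
    rcases b with _ | b
    · simp [dqX, QX, qInt]
    · simp only [dqX, QX, onMonomials_single, mul_smul_comm, AddMonoidAlgebra.single_mul_single, h]
      rw [AddMonoidAlgebra.smul_single, AddMonoidAlgebra.smul_single, smul_eq_mul, smul_eq_mul,
        ← AddMonoidAlgebra.single_sub]
      congr 1
      · simp [add_comm]
      · rw [one_mul, zpow_natCast, Units.val_pow_eq_pow_val, mul_sub, mul_one]

/-- Normal ordering `K[X, g, g⁻¹] → C_q(B₊)`, `g ^ a X ^ b ↦ g ^ a X ^ b`. -/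
noncomputable def normalOrder : CommPoly K →ₗ[K] QB K q :=
  onMonomials fun p => ((g q ^ p.2 : (QB K q)ˣ) : QB K q) * X q ^ p.1

end QB

/-! ## Bicovariant first order differential calculi -/

/-- A bicovariant first order differential calculus on a bialgebra `A` in the sense of Woronowicz:
an `A`-bimodule `Γ` with a linear map `d : A → Γ` satisfying the Leibniz rule, such that `Γ` is
spanned by the elements `a (d b)` and such that
`a (d b) ↦ Δ(a) (id ⊗ d) Δ(b) ∈ A ⊗ Γ` and `a (d b) ↦ Δ(a) (d ⊗ id) Δ(b) ∈ Γ ⊗ A`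
extend to well-defined linear maps on `Γ` (the left and the right coaction, which are determined
by these formulas). -/
structure BicovariantCalculus (K : Type u) (A : Type v) [Field K] [Ring A] [Bialgebra K A] where
  /-- The space of one-forms. -/
  Γ : Type w
  [addCommGroup : AddCommGroup Γ]
  [module : Module K Γ]
  [leftModule : Module A Γ]
  [rightModule : Module Aᵐᵒᵖ Γ]
  [bimodule : SMulCommClass A Aᵐᵒᵖ Γ]
  [leftTower : IsScalarTower K A Γ]
  [rightTower : IsScalarTower K Aᵐᵒᵖ Γ]
  /-- The exterior differential. -/
  d : A →ₗ[K] Γ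
  leibniz : ∀ a b : A, d (a * b) = op b • d a + a • d b
  span_d : Submodule.span A (Set.range d) = ⊤
  /-- The left coaction. -/
  coactL : Γ →ₗ[K] A ⊗[K] Γ
  coactL_smul_d : ∀ a b : A, coactL (a • d b) =
    TensorProduct.map₂ (LinearMap.mul K A) (Algebra.lsmul K K Γ : A →ₐ[K] _).toLinearMap
      (Coalgebra.comul a) (d.lTensor A (Coalgebra.comul b))
  /-- The right coaction. -/
  coactR : Γ →ₗ[K] Γ ⊗[K] A
  coactR_smul_d : ∀ a b : A, coactR (a • d b) =
    TensorProduct.map₂ (Algebra.lsmul K K Γ : A →ₐ[K] _).toLinearMap (LinearMap.mul K A)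
      (Coalgebra.comul a) (d.rTensor A (Coalgebra.comul b))

namespace BicovariantCalculus

attribute [instance] addCommGroup module leftModule rightModule bimodule leftTower rightTower

section Bialgebra
variable {K : Type u} {A : Type v} [Field K] [Ring A] [Bialgebra K A]

/-- The right invariant forms `{η | Δ_R(η) = η ⊗ 1}`. The dimension of a calculus is the dimension
of this vector space. -/
def rightInvariants (C : BicovariantCalculus.{u, v, w} K A) : Submodule K C.Γ :=
  LinearMap.ker (C.coactR - (TensorProduct.mk K C.Γ A).flip 1)

/-- A morphism of calculi: a bimodule map commuting with the differentials. As the forms `a (d b)`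
span, it is unique, automatically surjective, and it intertwines the coactions. -/
def IsMorphism (C : BicovariantCalculus.{u, v, w} K A) (D : BicovariantCalculus.{u, v, w'} K A)
    (f : C.Γ →ₗ[A] D.Γ) : Prop :=
  (∀ (a : A) (x : C.Γ), f (op a • x) = op a • f x) ∧ ∀ a : A, f (C.d a) = D.d a

/-- Isomorphism of calculi. -/
def Isomorphic (C : BicovariantCalculus.{u, v, w} K A) (D : BicovariantCalculus.{u, v, w'} K A) :
    Prop :=
  ∃ e : C.Γ ≃ₗ[A] D.Γ, IsMorphism C D e.toLinearMap

/-- `C` is coirreducible: it is nonzero and has no proper quotient calculus, i.e. every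
quotient calculus `C → D` is either an isomorphism or zero. -/
def IsCoirreducible (C : BicovariantCalculus.{u, v, w} K A) : Prop :=
  Nontrivial C.Γ ∧ ∀ (D : BicovariantCalculus.{u, v, w} K A) (f : C.Γ →ₗ[A] D.Γ),
    IsMorphism C D f → Function.Bijective f ∨ Subsingleton D.Γ

/-- The deformed commutator `[a, η]_p = a η - p η a`. -/
def qComm {C : BicovariantCalculus.{u, v, w} K A} (p : K) (a : A) (η : C.Γ) : C.Γ :=
  a • η - p • (op a • η)

end Bialgebra

section Hopf
variable {K : Type u} {A : Type v} [Field K] [Ring A] [HopfAlgebra K A]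

/-- The right invariant form `d(v₍₁₎) S(v₍₂₎)` attached to `v`. -/
noncomputable def rightForm (C : BicovariantCalculus.{u, v, w} K A) : A →ₗ[K] C.Γ :=
  TensorProduct.lift (((Algebra.lsmul K K C.Γ : Aᵐᵒᵖ →ₐ[K] _).toLinearMap ∘ₗ
    (opLinearEquiv K).toLinearMap ∘ₗ HopfAlgebra.antipode K).flip ∘ₗ C.d) ∘ₗ Coalgebra.comul

/-- The crossed submodule `M = {v ∈ ker ε | d(v₍₁₎) S(v₍₂₎) = 0}` of `ker ε` belonging to a
calculus, for which `Γ ≅ (ker ε / M) ⊗ A`. -/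
noncomputable def crossedSubmodule (C : BicovariantCalculus.{u, v, w} K A) : Submodule K A :=
  LinearMap.ker (Coalgebra.counit (R := K) (A := A)) ⊓ LinearMap.ker C.rightForm

/-- The subspace of `ker ε ⊆ H` annihilating the crossed submodule `M ⊆ A` of the calculus, where
`P` is a pairing of `H` with `A`. -/
noncomputable def tangentSpace {H : Type w'} [Ring H] [HopfAlgebra K H] (P : H →ₗ[K] A →ₗ[K] K)
    (C : BicovariantCalculus.{u, v, w} K A) : Submodule K H :=
  LinearMap.ker (Coalgebra.counit (R := K) (A := H)) ⊓
    ⨅ v ∈ C.crossedSubmodule, LinearMap.ker (P.flip v)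

end Hopf

end BicovariantCalculus

/-! ## Quantum tangent spaces -/

section Tangent
variable {K : Type u} {H : Type v} {A : Type w} [Field K] [Ring H] [HopfAlgebra K H]
  [Ring A] [HopfAlgebra K A]

/-- The adjoint action `h ▷ x = h₍₁₎ x S(h₍₂₎)`. -/
noncomputable def adjAction (h x : H) : H :=
  LinearMap.mul' K H (TensorProduct.map (LinearMap.mulRight K x) (HopfAlgebra.antipode K)
    (Coalgebra.comul (R := K) h))

/-- The coregular action `a ▷ x = ⟨x₍₁₎, a⟩ x₍₂₎`. -/
noncomputable def coregAction (P : H →ₗ[K] A →ₗ[K] K) (a : A) (x : H) : H :=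
  TensorProduct.lid K H ((P.flip a).rTensor H (Coalgebra.comul (R := K) x))

/-- The projection `x ↦ x - ε(x) 1` to `ker ε`. -/
noncomputable def toKerCounit (K : Type u) {H : Type v} [Field K] [Ring H] [HopfAlgebra K H]
    (x : H) : H :=
  x - algebraMap K H (Coalgebra.counit x)

/-- Quantum tangent spaces: subspaces of `ker ε ⊆ H` invariant under the adjoint and the coregular
action projected to `ker ε`. -/
structure IsQuantumTangentSpace (P : H →ₗ[K] A →ₗ[K] K) (L : Submodule K H) : Prop where
  counit_eq_zero : ∀ x ∈ L, Coalgebra.counit (R := K) x = 0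
  adj_mem : ∀ (h : H), ∀ x ∈ L, toKerCounit K (adjAction (K := K) h x) ∈ L
  coreg_mem : ∀ (a : A), ∀ x ∈ L, toKerCounit K (coregAction P a x) ∈ L

/-- Irreducible quantum tangent spaces: nonzero without proper nonzero subobjects. -/
def IsIrreducibleTangentSpace (P : H →ₗ[K] A →ₗ[K] K) (L : Submodule K H) : Prop :=
  IsQuantumTangentSpace P L ∧ L ≠ ⊥ ∧
    ∀ L' : Submodule K H, IsQuantumTangentSpace P L' → L' ≤ L → L' = ⊥ ∨ L' = L

/-- The braided derivation `∂ₓ(a) = ⟨x, a₍₁₎⟩ a₍₂₎`. -/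
noncomputable def braidedDerivation (P : H →ₗ[K] A →ₗ[K] K) (x : H) : A →ₗ[K] A :=
  (TensorProduct.lid K A).toLinearMap ∘ₗ (P x).rTensor A ∘ₗ Coalgebra.comul

end Tangent

/-! ## The index set of the classification -/

/-- Finite subsets of `{2, 3, 4, …}`. -/
def CalcIndex : Type := {I : Finset ℕ // ∀ n ∈ I, 2 ≤ n}

/-- The one-element set `{n}`. -/
def CalcIndex.single (n : ℕ) (hn : 2 ≤ n) : CalcIndex :=
  ⟨{n}, fun _ hm => (Finset.mem_singleton.mp hm).symm ▸ hn⟩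

/-! A calculus is recovered from its right invariant forms. With ω(v) = d(v₁)S(v₂) one has da =
ω(a₁)a₂ and Γ ≅ Γ_inv ⊗ A, so Γ is determined up to isomorphism by M = ker ε ∩ ker ω
(`formMul_comul`, `split_formMul`, `isomorphic_of_crossedSubmodule_eq`). The Leibniz rule makes M a
left ideal, and the left coaction makes M stable under the transposes of the adjoint actions of g
and X (`mul_mem`, `degScale_mem`, `coadX_mem`). Dually, the annihilator of M in ker ε is stable
under ad g, ad X and the projected coregular actions ∂_g, ∂_X (`isStable_tangentSpace`).

Such subspaces are classified by weights. The projection of X^i g^m to ker ε is a joint eigenvector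
of ad g and ∂_g with eigenvalues q^{-i} and q^{-(i+m)}; since q is not a root of unity, these
determine (i, m), and a stable subspace is spanned by projected monomials. Up to nonzero scalars ∂_X
lowers i, while ad X raises i with coefficient 1 - q^{-(i+m)}, which vanishes only on i + m = 0. A
finite-dimensional stable subspace is therefore a sum of strings i = 0, …, n-1 with m = 1 - n; n = 1
contributes g^0 - 1 = 0 and is excluded. This is `IsStable.eq_tangent`.

Passing back from tangent spaces to calculi needs a double annihilator argument in the
infinite-dimensional A. Finite dimension of Γ_inv forces X^N ∈ M for some N. Applying the transpose
of ad X repeatedly gives (g-1)(g-q)⋯(g-q^{r-1})X^{N-r} ∈ M. Hence modulo M each g^s X^i is a finite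
combination of vectors with coefficients q^{js}, and A → A/M is a combination of finitely many
functionals ⟨x, ·⟩. So M is the annihilator in ker ε of a finite-dimensional tangent space
(`exists_annihilator_le`, `exists_crossedSubmodule_eq_perp`).

For existence, Γ_I is built as a free right module on η_{n,i} with n ∈ I and i < n, where X shifts
η_{n,i} to η_{n,i+1}, and d is the commutator with the biinvariant form Σ_n η_{n,0}. The coordinates
of da are the braided derivations along a basis of L_I (`Forms.innerD_eta0_apply`), so ω(v) has
coordinates ⟨x, v⟩ and M is the annihilator of L_I. Coirreducibility, irreducibility and the
decompositions then follow from L_I ≤ L_J ⇔ I ⊆ J. -/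

namespace QB

/-! ### Commutation rules, the pairing and braided derivations on monomials. -/

section Basics

/-- If a subspace stable under some operators contains a sum of joint eigenvectors with distinct
eigenvalues, then it contains all the summands. -/
theorem mem_of_sum_mem {K V ι κ : Type*} [Field K] [AddCommGroup V] [Module K V]
    (p : Submodule K V) (T : κ → Module.End K V) (hT : ∀ j, ∀ x ∈ p, T j x ∈ p) (μ : κ → ι → K)
    (s : Finset ι) (v : ι → V) (hv : ∀ j, ∀ i ∈ s, T j (v i) = μ j i • v i)
    (hμ : ∀ i ∈ s, ∀ i' ∈ s, i ≠ i' → ∃ j, μ j i ≠ μ j i') (hs : ∑ i ∈ s, v i ∈ p) :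
    ∀ i ∈ s, v i ∈ p := by
  classical
  induction s using Finset.induction_on generalizing v with
  | empty => simp
  | insert a s ha ih =>
    have key : ∀ i ∈ s, v i ∈ p := by
      intro i hi
      obtain ⟨j, hj⟩ := hμ i (Finset.mem_insert_of_mem hi) a (Finset.mem_insert_self _ _)
        (fun h => ha (h ▸ hi))
      -- The operator `T j - μ j a` kills the summand at `a` and rescales the others, which leaves a
      -- sum over `s` for the induction hypothesis.
      have h1 : (μ j i - μ j a) • v i ∈ p := by
        refine ih (fun l => (μ j l - μ j a) • v l) (fun j' l hl => ?_)
          (fun l hl l' hl' => hμ l (Finset.mem_insert_of_mem hl) l' (Finset.mem_insert_of_mem hl'))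
          ?_ i hi
        · rw [map_smul, hv j' l (Finset.mem_insert_of_mem hl), smul_comm]
        · have h2 := p.sub_mem (hT j _ hs) (p.smul_mem (μ j a) hs)
          rw [Finset.sum_insert ha, map_add, map_sum, hv j a (Finset.mem_insert_self _ _), smul_add,
            add_sub_add_left_eq_sub, Finset.smul_sum, ← Finset.sum_sub_distrib] at h2
          convert h2 using 1
          refine Finset.sum_congr rfl fun l hl => ?_
          rw [hv j l (Finset.mem_insert_of_mem hl), sub_smul]
      have h2 := p.smul_mem (μ j i - μ j a)⁻¹ h1
      rwa [smul_smul, inv_mul_cancel₀ (sub_ne_zero.2 hj), one_smul] at h2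
    intro i hi
    rcases Finset.mem_insert.1 hi with rfl | hi
    · rw [Finset.sum_insert ha] at hs
      exact (p.add_mem_iff_left (p.sum_mem key)).1 hs
    · exact key i hi

variable {K : Type*} [Field K] (q : Kˣ)

/-- The scalar `q ^ k`, for an integer `k`. -/
def qz (k : ℤ) : K := ((q ^ k : Kˣ) : K)

@[simp] theorem qz_zero : qz q 0 = 1 := by simp [qz]

@[simp] theorem qz_one : qz q 1 = (q : K) := by simp [qz]

theorem qz_add (a b : ℤ) : qz q (a + b) = qz q a * qz q b := by simp [qz, zpow_add]

theorem qz_ne_zero (a : ℤ) : qz q a ≠ 0 := Units.ne_zero _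

theorem qz_mul_neg (a : ℤ) : qz q a * qz q (-a) = 1 := by rw [← qz_add]; simp

theorem qz_neg_mul (a : ℤ) : qz q (-a) * qz q a = 1 := by rw [← qz_add]; simp

theorem qz_natCast (n : ℕ) : qz q (n : ℤ) = (q : K) ^ n := by simp [qz]

theorem qz_neg_natCast (n : ℕ) : qz q (-(n : ℤ)) = ((q⁻¹ : Kˣ) : K) ^ n := by simp [qz]

theorem inv_eq_qz : ((q⁻¹ : Kˣ) : K) = qz q (-1) := by simp [qz]

variable {q} in
theorem qz_injective (hq : ∀ n : ℕ, 0 < n → q ^ n ≠ 1) : Function.Injective (qz q) := by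
  intro a b h
  have h1 : q ^ a = q ^ b := Units.ext h
  have h2 : ¬ IsOfFinOrder q := by
    rw [isOfFinOrder_iff_pow_eq_one]
    rintro ⟨n, hn, h⟩
    exact hq n hn h
  exact injective_zpow_iff_not_isOfFinOrder.2 h2 h1

variable {q} in
theorem qz_eq_one_iff (hq : ∀ n : ℕ, 0 < n → q ^ n ≠ 1) {a : ℤ} : qz q a = 1 ↔ a = 0 :=
  ⟨fun h => qz_injective hq (by simpa using h), fun h => by simp [h]⟩

/-- The power `g ^ m` as an element of the algebra. -/
noncomputable def gz (m : ℤ) : QB K q := ((g q ^ m : (QB K q)ˣ) : QB K q)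

@[simp] theorem gz_zero : gz q 0 = 1 := by simp [gz]

theorem gz_add (a b : ℤ) : gz q (a + b) = gz q a * gz q b := by simp [gz, zpow_add]

theorem gz_one : gz q 1 = (g q : QB K q) := by simp [gz]

theorem gz_neg_one : gz q (-1) = (((g q)⁻¹ : (QB K q)ˣ) : QB K q) := by simp [gz]

theorem gz_mul_X (m : ℤ) : gz q m * X q = qz q (-m) • (X q * gz q m) := by
  induction m with
  | zero => simp
  | succ i ih =>
    rw [gz_add, mul_assoc, gz_one, g_mul_X, mul_smul_comm, ← mul_assoc, ih, smul_mul_assoc,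
      smul_smul, mul_assoc, inv_eq_qz, ← qz_add]
    congr 2; ring
  | pred i ih =>
    have h := gInv_mul_X_pow q 1
    simp only [pow_one] at h
    rw [sub_eq_add_neg, gz_add, mul_assoc, gz_neg_one, h, mul_smul_comm, ← mul_assoc, ih,
      smul_mul_assoc, smul_smul, mul_assoc, ← qz_one, ← qz_add]
    congr 2; ring

theorem gz_mul_X_pow (m : ℤ) (n : ℕ) : gz q m * X q ^ n = qz q (-(m * n)) • (X q ^ n * gz q m) := by
  induction n with
  | zero => simp
  | succ n ih =>
    rw [pow_succ, ← mul_assoc, ih, smul_mul_assoc, mul_assoc, gz_mul_X, mul_smul_comm, smul_smul,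
      ← mul_assoc, ← qz_add]
    congr 2; push_cast; ring

theorem X_pow_mul_gz (m : ℤ) (n : ℕ) : X q ^ n * gz q m = qz q (m * n) • (gz q m * X q ^ n) := by
  rw [gz_mul_X_pow, smul_smul, qz_mul_neg, one_smul]

theorem X_mul_gz (m : ℤ) : X q * gz q m = qz q m • (gz q m * X q) := by
  simpa using X_pow_mul_gz q m 1

theorem mono_def (n : ℕ) (m : ℤ) : mono q (n, m) = X q ^ n * gz q m := rfl

theorem mono_zero_zero : mono q (0, 0) = 1 := by simp [mono]

theorem X_mul_mono (n : ℕ) (m : ℤ) : X q * mono q (n, m) = mono q (n + 1, m) := by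
  simp [mono, pow_succ', mul_assoc]

theorem gz_mul_mono (s : ℤ) (n : ℕ) (m : ℤ) :
    gz q s * mono q (n, m) = qz q (-(s * n)) • mono q (n, s + m) := by
  rw [mono_def, ← mul_assoc, gz_mul_X_pow, smul_mul_assoc, mul_assoc, ← gz_add, mono_def]

theorem mono_mul_gz (s : ℤ) (n : ℕ) (m : ℤ) : mono q (n, m) * gz q s = mono q (n, m + s) := by
  rw [mono_def, mul_assoc, ← gz_add, mono_def]

theorem mono_mul_X (n : ℕ) (m : ℤ) : mono q (n, m) * X q = qz q (-m) • mono q (n + 1, m) := by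
  rw [mono_def, mul_assoc, gz_mul_X, mul_smul_comm, ← mul_assoc, ← pow_succ, mono_def]

theorem linearMap_ext {V : Type*} [AddCommGroup V] [Module K V] {f f' : QB K q →ₗ[K] V}
    (h : ∀ n m, f (mono q (n, m)) = f' (mono q (n, m))) : f = f' := by
  refine (basis q).ext fun ⟨n, m⟩ => ?_
  rw [basis_apply, h]

/-- Induction along left multiplication by the generators. -/
theorem left_induction {P : QB K q → Prop} (h1 : P 1) (hadd : ∀ a b, P a → P b → P (a + b))
    (hsmul : ∀ (k : K) a, P a → P (k • a)) (hX : ∀ a, P a → P (X q * a))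
    (hg : ∀ a, P a → P (gz q 1 * a)) (hg' : ∀ a, P a → P (gz q (-1) * a)) (a : QB K q) : P a := by
  have key : ∀ a b, P b → P (a * b) := by
    intro a
    refine induction q (P := fun a => ∀ b, P b → P (a * b)) hX ?_ ?_ ?_ ?_ ?_ a
    · simpa [gz_one] using hg
    · simpa [gz_neg_one] using hg'
    · intro k b hb
      rw [← Algebra.smul_def]
      exact hsmul _ _ hb
    · intro a a' ha ha' b hb
      rw [add_mul]
      exact hadd _ _ (ha b hb) (ha' b hb)
    · intro a a' ha ha' b hb
      rw [mul_assoc]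
      exact ha _ (ha' b hb)
  simpa using key a 1 h1

theorem mul_induction {P : QB K q → Prop} (hs : ∀ k : K, P (algebraMap K _ k))
    (hadd : ∀ a b, P a → P b → P (a + b)) (hmul : ∀ a b, P a → P b → P (a * b)) (hX : P (X q))
    (hg : P (gz q 1)) (hg' : P (gz q (-1))) (a : QB K q) : P a :=
  induction q hX (by simpa [gz_one] using hg) (by simpa [gz_neg_one] using hg') hs hadd hmul a

/-! ### Structure maps on monomials -/

theorem comul_X : Coalgebra.comul (R := K) (X q) = X q ⊗ₜ[K] 1 + gz q 1 ⊗ₜ[K] X q := by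
  simp [comul_eq, comulHom, gz_one]

theorem comul_gz (m : ℤ) : Coalgebra.comul (R := K) (gz q m) = gz q m ⊗ₜ[K] gz q m := by
  induction m with
  | zero => simp [Algebra.TensorProduct.one_def]
  | succ i ih =>
    rw [gz_add, Bialgebra.comul_mul, ih, comul_eq, gz_one]
    simp [comulHom]
  | pred i ih =>
    rw [sub_eq_add_neg, gz_add, Bialgebra.comul_mul, ih, comul_eq (a := gz q (-1)), gz_neg_one]
    simp [comulHom]

theorem comul_X_mul (a : QB K q) : Coalgebra.comul (R := K) (X q * a) =
    (X q ⊗ₜ[K] 1 + gz q 1 ⊗ₜ[K] X q) * Coalgebra.comul (R := K) a := by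
  rw [Bialgebra.comul_mul, comul_X]

theorem comul_gz_mul (m : ℤ) (a : QB K q) : Coalgebra.comul (R := K) (gz q m * a) =
    (gz q m ⊗ₜ[K] gz q m) * Coalgebra.comul (R := K) a := by
  rw [Bialgebra.comul_mul, comul_gz]

@[simp] theorem counit_X : Coalgebra.counit (R := K) (X q) = 0 := by
  simp [counit_eq, counitHom]

@[simp] theorem counit_gz (m : ℤ) : Coalgebra.counit (R := K) (gz q m) = 1 := by
  induction m with
  | zero => simp
  | succ i ih =>
    rw [gz_add, Bialgebra.counit_mul, ih, counit_eq, gz_one]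
    simp [counitHom]
  | pred i ih =>
    rw [sub_eq_add_neg, gz_add, Bialgebra.counit_mul, ih, counit_eq, gz_neg_one]
    simp [counitHom]

theorem counit_mono (n : ℕ) (m : ℤ) :
    Coalgebra.counit (R := K) (mono q (n, m)) = if n = 0 then 1 else 0 := by
  rw [mono_def, Bialgebra.counit_mul, Bialgebra.counit_pow]
  rcases n with _ | n <;> simp

theorem antipode_mul (a b : QB K q) : HopfAlgebra.antipode K (a * b) =
    HopfAlgebra.antipode K b * HopfAlgebra.antipode K a := antipodeLin_mul q a b

theorem antipode_X : HopfAlgebra.antipode K (X q) = -(gz q (-1) * X q) := by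
  rw [gz_neg_one]; exact antipodeLin_X q

theorem antipode_gz (m : ℤ) : HopfAlgebra.antipode K (gz q m) = gz q (-m) := by
  induction m with
  | zero => simp
  | succ i ih =>
    rw [gz_add, antipode_mul, ih, neg_add, add_comm, gz_add]
    congr 1
    rw [gz_one, gz_neg_one]; exact antipodeLin_g q
  | pred i ih =>
    rw [sub_eq_add_neg, gz_add, antipode_mul, ih, neg_add, add_comm, gz_add]
    congr 1
    rw [gz_neg_one, neg_neg, gz_one]; exact antipodeLin_gInv q

/-! ### The pairing -/

theorem qInt_succ (t : K) (n : ℕ) : qInt t (n + 1) = qInt t n + t ^ n := by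
  simp [qInt, Finset.sum_range_succ]

theorem qInt_succ' (t : K) (n : ℕ) : qInt t (n + 1) = 1 + t * qInt t n := by
  simp only [qInt]
  rw [Finset.sum_range_succ', Finset.mul_sum, add_comm]
  simp [pow_succ']

/-- The `q⁻¹`-integer `1 + q⁻¹ + ⋯ + q ^ (1 - n)`. -/
def pInt (n : ℕ) : K := qInt (qz q (-1)) n

theorem qInt_mul_qz (n : ℕ) : qInt (q : K) (n + 1) * qz q (-n) = pInt q (n + 1) := by
  induction n with
  | zero => simp [qInt, pInt]
  | succ n ih =>
    rw [qInt_succ (q : K) (n + 1), pInt, qInt_succ' (qz q (-1)), ← pInt, ← ih, add_mul,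
      ← qz_natCast, qz_mul_neg]
    rw [show (-((n + 1 : ℕ) : ℤ)) = -1 + -(n : ℤ) by push_cast; ring, qz_add]
    ring

variable {q} in
theorem qInt_ne_zero (hq : ∀ n : ℕ, 0 < n → q ^ n ≠ 1) (n : ℕ) : qInt (q : K) (n + 1) ≠ 0 := by
  intro h
  have h1 := geom_sum_mul (q : K) (n + 1)
  rw [show ∑ i ∈ Finset.range (n + 1), (q : K) ^ i = qInt (q : K) (n + 1) from rfl, h, zero_mul,
    eq_comm, sub_eq_zero] at h1
  exact hq (n + 1) n.succ_pos (Units.ext (by simpa using h1))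

variable {q} in
theorem pInt_ne_zero (hq : ∀ n : ℕ, 0 < n → q ^ n ≠ 1) (n : ℕ) : pInt q (n + 1) ≠ 0 := by
  rw [← qInt_mul_qz]
  exact mul_ne_zero (qInt_ne_zero hq n) (qz_ne_zero _ _)

variable {q} in
theorem qFactorial_ne_zero (hq : ∀ n : ℕ, 0 < n → q ^ n ≠ 1) (n : ℕ) :
    qFactorial (q : K) n ≠ 0 := Finset.prod_ne_zero_iff.2 fun i _ => qInt_ne_zero hq i

/-- The value `⟨X ^ n, X ^ n⟩` of the pairing. -/
def normX (n : ℕ) : K := qFactorial (q : K) n * qz q (-((n * (n - 1) / 2 : ℕ) : ℤ))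

@[simp] theorem normX_zero : normX q 0 = 1 := by simp [normX, qFactorial]

/-- The triangular exponent grows by n from n to n + 1, and [n+1]_q q^{-n} is the q⁻¹-integer; so
the normalisation of the pairing produces exactly the coefficients in the recursions for ∂. -/
theorem normX_succ (n : ℕ) : normX q (n + 1) = pInt q (n + 1) * normX q n := by
  rw [normX, Nat.triangle_succ, Nat.cast_add, neg_add, qz_add, ← qInt_mul_qz, normX, qFactorial,
    Finset.prod_range_succ, ← qFactorial]
  ring

variable {q} in
theorem normX_ne_zero (hq : ∀ n : ℕ, 0 < n → q ^ n ≠ 1) (n : ℕ) : normX q n ≠ 0 :=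
  mul_ne_zero (qFactorial_ne_zero hq n) (qz_ne_zero _ _)

theorem pairing_mono (n r : ℕ) (m s : ℤ) : pairing q (mono q (n, m)) (mono q (r, s)) =
    if n = r then normX q n * qz q (-(m * s)) else 0 := pairing_apply q n r m s

theorem pairing_symm (x a : QB K q) : pairing q x a = pairing q a x := by
  have : pairing q = (pairing q).flip := by
    refine linearMap_ext q fun n m => linearMap_ext q fun r s => ?_
    rw [LinearMap.flip_apply, pairing_mono, pairing_mono]
    rcases eq_or_ne n r with rfl | h
    · simp [mul_comm]
    · simp [h, h.symm]
  exact congrArg (fun f => f x a) this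

theorem pairing_one (a : QB K q) : pairing q 1 a = Coalgebra.counit (R := K) a := by
  have : pairing q 1 = Coalgebra.counit (R := K) := by
    refine linearMap_ext q fun r s => ?_
    rw [← mono_zero_zero, pairing_mono, counit_mono]
    rcases r with _ | r <;> simp
  exact congrArg (fun f => f a) this

/-- Together with `pairing_X_mul_zero` and `pairing_X_mul_succ` this takes the place of the Hopf
pairing axioms: transposing left multiplication by generators suffices to compute ∂ on products. -/
theorem pairing_gz_mul (i : ℕ) (m s : ℤ) (a : QB K q) :
    pairing q (mono q (i, m)) (gz q s * a) =
      qz q (-((i + m) * s)) * pairing q (mono q (i, m)) a := by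
  have : pairing q (mono q (i, m)) ∘ₗ LinearMap.mulLeft K (gz q s) =
      qz q (-((i + m) * s)) • pairing q (mono q (i, m)) := by
    refine linearMap_ext q fun r t => ?_
    simp only [LinearMap.comp_apply, LinearMap.mulLeft_apply, LinearMap.smul_apply, gz_mul_mono,
      map_smul, pairing_mono, smul_eq_mul]
    split_ifs with h
    · subst h
      rw [mul_left_comm, ← qz_add, mul_left_comm, ← qz_add]
      congr 2; ring
    · simp
  exact congrArg (fun f => f a) this

theorem pairing_X_mul_zero (m : ℤ) (a : QB K q) :
    pairing q (mono q (0, m)) (X q * a) = 0 := by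
  have : pairing q (mono q (0, m)) ∘ₗ LinearMap.mulLeft K (X q) = 0 := by
    refine linearMap_ext q fun r t => ?_
    simp [X_mul_mono, pairing_mono]
  exact congrArg (fun f => f a) this

theorem pairing_X_mul_succ (i : ℕ) (m : ℤ) (a : QB K q) :
    pairing q (mono q (i + 1, m)) (X q * a) = pInt q (i + 1) * pairing q (mono q (i, m)) a := by
  have : pairing q (mono q (i + 1, m)) ∘ₗ LinearMap.mulLeft K (X q) =
      pInt q (i + 1) • pairing q (mono q (i, m)) := by
    refine linearMap_ext q fun r t => ?_
    simp only [LinearMap.comp_apply, LinearMap.mulLeft_apply, LinearMap.smul_apply, X_mul_mono,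
      pairing_mono, smul_eq_mul, add_left_inj, normX_succ]
    split_ifs <;> ring
  exact congrArg (fun f => f a) this

/-! ### Braided derivations -/

theorem braidedDerivation_apply (x a : QB K q) : braidedDerivation (pairing q) x a =
    TensorProduct.lid K (QB K q) ((pairing q x).rTensor (QB K q) (Coalgebra.comul (R := K) a)) :=
  rfl

theorem braidedDerivation_add (x y a : QB K q) : braidedDerivation (pairing q) (x + y) a =
    braidedDerivation (pairing q) x a + braidedDerivation (pairing q) y a := by
  simp [braidedDerivation_apply, LinearMap.rTensor_add]

theorem braidedDerivation_smul (k : K) (x a : QB K q) : braidedDerivation (pairing q) (k • x) a =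
    k • braidedDerivation (pairing q) x a := by
  simp [braidedDerivation_apply, LinearMap.rTensor_smul]

theorem braidedDerivation_sub (x y a : QB K q) : braidedDerivation (pairing q) (x - y) a =
    braidedDerivation (pairing q) x a - braidedDerivation (pairing q) y a := by
  rw [sub_eq_add_neg, ← neg_one_smul K y, braidedDerivation_add, braidedDerivation_smul]
  simp [sub_eq_add_neg]

theorem braidedDerivation_one (a : QB K q) : braidedDerivation (pairing q) 1 a = a := by
  rw [braidedDerivation_apply,
    show pairing q 1 = Coalgebra.counit (R := K) from LinearMap.ext (pairing_one q)]
  simp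

theorem braidedDerivation_gz (i : ℕ) (m s : ℤ) :
    braidedDerivation (pairing q) (mono q (i, m)) (gz q s) =
      if i = 0 then qz q (-(m * s)) • gz q s else 0 := by
  rw [braidedDerivation_apply, comul_gz, LinearMap.rTensor_tmul, TensorProduct.lid_tmul,
    show gz q s = mono q (0, s) by simp [mono_def], pairing_mono]
  rcases i with _ | i <;> simp

theorem braidedDerivation_gz_mul (i : ℕ) (m s : ℤ) (a : QB K q) :
    braidedDerivation (pairing q) (mono q (i, m)) (gz q s * a) =
      qz q (-((i + m) * s)) • (gz q s * braidedDerivation (pairing q) (mono q (i, m)) a) := by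
  rw [braidedDerivation_apply, braidedDerivation_apply, comul_gz_mul]
  induction Coalgebra.comul (R := K) a with
  | zero => simp
  | tmul a b => simp [pairing_gz_mul, mul_smul, -neg_add_rev]
  | add a b ha hb => simp only [mul_add, map_add, ha, hb, smul_add]

theorem braidedDerivation_X_mul_zero (m : ℤ) (a : QB K q) :
    braidedDerivation (pairing q) (mono q (0, m)) (X q * a) =
      qz q (-m) • (X q * braidedDerivation (pairing q) (mono q (0, m)) a) := by
  rw [braidedDerivation_apply, braidedDerivation_apply, comul_X_mul]
  induction Coalgebra.comul (R := K) a with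
  | zero => simp
  | tmul a b =>
    have h := pairing_gz_mul q 0 m 1 a
    simp only [Nat.cast_zero, zero_add, mul_one] at h
    simp only [add_mul, Algebra.TensorProduct.tmul_mul_tmul, map_add, LinearMap.rTensor_tmul,
      TensorProduct.lid_tmul, pairing_X_mul_zero, h, mul_smul, zero_smul, zero_add,
      mul_smul_comm]
  | add a b ha hb => simp only [mul_add, map_add, ha, hb, smul_add]

/-- In ΔX = X ⊗ 1 + g ⊗ X the first summand lowers the degree of the functional, the second gives
the twisted Leibniz term. -/
theorem braidedDerivation_X_mul_succ (i : ℕ) (m : ℤ) (a : QB K q) :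
    braidedDerivation (pairing q) (mono q (i + 1, m)) (X q * a) =
      pInt q (i + 1) • braidedDerivation (pairing q) (mono q (i, m)) a +
      qz q (-(i + 1 + m)) • (X q * braidedDerivation (pairing q) (mono q (i + 1, m)) a) := by
  rw [braidedDerivation_apply, braidedDerivation_apply, braidedDerivation_apply, comul_X_mul]
  induction Coalgebra.comul (R := K) a with
  | zero => simp
  | tmul a b =>
    have h := pairing_gz_mul q (i + 1) m 1 a
    simp only [Nat.cast_add, Nat.cast_one, mul_one] at h
    simp only [add_mul, Algebra.TensorProduct.tmul_mul_tmul, map_add, LinearMap.rTensor_tmul,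
      TensorProduct.lid_tmul, pairing_X_mul_succ, h, mul_smul, one_mul, mul_smul_comm]
  | add a b ha hb => simp only [mul_add, map_add, ha, hb, smul_add]; abel

theorem braidedDerivation_mono_zero_mono (m : ℤ) (r : ℕ) (s : ℤ) :
    braidedDerivation (pairing q) (mono q (0, m)) (mono q (r, s)) =
      qz q (-(m * (r + s))) • mono q (r, s) := by
  induction r with
  | zero =>
    have h := braidedDerivation_gz q 0 m s
    simpa [mono_def] using h
  | succ r ih =>
    rw [← X_mul_mono, braidedDerivation_X_mul_zero, ih, mul_smul_comm, smul_smul, ← qz_add]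
    congr 2; push_cast; ring

/-- The truncated exponent `r - 1` is harmless because `pInt q 0 = 0`. -/
theorem braidedDerivation_mono_one_mono (r : ℕ) (s : ℤ) :
    braidedDerivation (pairing q) (mono q (1, 0)) (mono q (r, s)) =
      pInt q r • mono q (r - 1, s) := by
  induction r with
  | zero =>
    have h := braidedDerivation_gz q 1 0 s
    simpa [mono_def, pInt, qInt] using h
  | succ r ih =>
    have h1 : pInt q (0 + 1) = 1 := by simp [pInt, qInt]
    have h2 := braidedDerivation_X_mul_succ q 0 0 (mono q (r, s))
    rw [h1, zero_add, X_mul_mono, ih, mono_zero_zero, braidedDerivation_one, mul_smul_comm,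
      smul_smul, one_smul] at h2
    rw [h2, pInt, pInt, qInt_succ']
    rcases r with _ | r
    · simp [qInt]
    · rw [X_mul_mono]
      simp [add_smul]

theorem coregAction_eq (a x : QB K q) :
    coregAction (pairing q) a x = braidedDerivation (pairing q) a x := by
  have : (pairing q).flip a = pairing q a := LinearMap.ext fun y => pairing_symm q y a
  rw [coregAction, this, braidedDerivation_apply]

/-- The coregular action is adjoint to left multiplication; with `pairing_braidedDerivation_X` this
makes the annihilator of a left ideal stable under the coregular action of g and X. -/
theorem pairing_braidedDerivation_gz (x v : QB K q) :
    pairing q (braidedDerivation (pairing q) (mono q (0, 1)) x) v = pairing q x (gz q 1 * v) := by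
  have : pairing q ∘ₗ braidedDerivation (pairing q) (mono q (0, 1)) =
      (LinearMap.lcomp K K (LinearMap.mulLeft K (gz q 1))) ∘ₗ pairing q := by
    refine linearMap_ext q fun n m => LinearMap.ext fun v => ?_
    simp [braidedDerivation_mono_zero_mono, pairing_gz_mul]
  exact congrArg (fun f => f x v) this

theorem pairing_braidedDerivation_X (x v : QB K q) :
    pairing q (braidedDerivation (pairing q) (mono q (1, 0)) x) v = pairing q x (X q * v) := by
  have : pairing q ∘ₗ braidedDerivation (pairing q) (mono q (1, 0)) =
      (LinearMap.lcomp K K (LinearMap.mulLeft K (X q))) ∘ₗ pairing q := by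
    refine linearMap_ext q fun n m => LinearMap.ext fun v => ?_
    rcases n with _ | n
    · simp [braidedDerivation_mono_one_mono, pairing_X_mul_zero, pInt, qInt]
    · simp [braidedDerivation_mono_one_mono, pairing_X_mul_succ]
  exact congrArg (fun f => f x v) this

/-- The operator `X ^ n g ^ m ↦ q ^ (- n) X ^ n g ^ m`. -/
noncomputable def degScale : QB K q →ₗ[K] QB K q :=
  (basis q).constr K fun p => qz q (-(p.1 : ℤ)) • mono q p

theorem degScale_mono (n : ℕ) (m : ℤ) :
    degScale q (mono q (n, m)) = qz q (-(n : ℤ)) • mono q (n, m) := by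
  rw [← basis_apply, degScale, Module.Basis.constr_basis, basis_apply]

/-- Monomials of different degree in X are orthogonal, so scaling by degree is self-adjoint. -/
theorem pairing_degScale (x v : QB K q) :
    pairing q (degScale q x) v = pairing q x (degScale q v) := by
  have : pairing q ∘ₗ degScale q = (LinearMap.lcomp K K (degScale q)) ∘ₗ pairing q := by
    refine linearMap_ext q fun n m => linearMap_ext q fun r s => ?_
    simp only [LinearMap.comp_apply, LinearMap.lcomp_apply, degScale_mono, map_smul,
      LinearMap.smul_apply, pairing_mono, smul_eq_mul]
    split_ifs with h
    · rw [h]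
    · simp
  exact congrArg (fun f => f x v) this

variable {q} in
/-- A subspace stable under `degScale` and `∂_g` contains the homogeneous components of its
elements. -/
theorem smul_mono_mem (hq : ∀ n : ℕ, 0 < n → q ^ n ≠ 1) {V : Type*} [AddCommGroup V] [Module K V]
    (p : Submodule K V) (T T' : Module.End K V) (hT : ∀ x ∈ p, T x ∈ p) (hT' : ∀ x ∈ p, T' x ∈ p)
    (s : Finset (ℕ × ℤ)) (v : ℕ × ℤ → V) (h : ∀ i ∈ s, T (v i) = qz q (-(i.1 : ℤ)) • v i)
    (h' : ∀ i ∈ s, T' (v i) = qz q (-(i.1 + i.2)) • v i) (hs : ∑ i ∈ s, v i ∈ p) :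
    ∀ i ∈ s, v i ∈ p := by
  refine mem_of_sum_mem p (fun b : Bool => if b then T else T') ?_
    (fun b i => if b then qz q (-(i.1 : ℤ)) else qz q (-(i.1 + i.2))) s v ?_ ?_ hs
  · rintro (_ | _)
    · simpa using hT'
    · simpa using hT
  · rintro (_ | _)
    · simpa using h'
    · simpa using h
  -- The exponents n and n + m can be read off the two eigenvalues because q is not a root of unity.
  · rintro ⟨n, m⟩ - ⟨n', m'⟩ - hne
    by_contra! hc
    have h1 := qz_injective hq (by simpa using hc true)
    have h2 := qz_injective hq (by simpa using hc false)
    apply hne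
    ext <;> simp at h1 h2 ⊢ <;> omega

variable {q} in
-- The kernel is stable under two operators that separate monomials, so it would contain a monomial.
theorem pairing_injective (hq : ∀ n : ℕ, 0 < n → q ^ n ≠ 1) :
    Function.Injective (pairing q) := by
  rw [← LinearMap.ker_eq_bot, LinearMap.ker_eq_bot']
  intro x hx
  have hx' : ∑ p ∈ ((basis q).repr x).support, (basis q).repr x p • mono q p = x := by
    conv_rhs => rw [← (basis q).linearCombination_repr x]
    simp [Finsupp.linearCombination_apply, basis_apply, Finsupp.sum]
  have key := smul_mono_mem hq (LinearMap.ker (pairing q)) (degScale q)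
    (braidedDerivation (pairing q) (mono q (0, 1)))
    (fun x hx => LinearMap.ext fun v => by
      rw [pairing_degScale, LinearMap.mem_ker.1 hx]; rfl)
    (fun x hx => LinearMap.ext fun v => by
      rw [pairing_braidedDerivation_gz, LinearMap.mem_ker.1 hx]; rfl)
    ((basis q).repr x).support (fun p => (basis q).repr x p • mono q p)
    (fun p _ => by rw [map_smul, degScale_mono, smul_comm])
    (fun p _ => by rw [map_smul, braidedDerivation_mono_zero_mono, one_mul, smul_comm])
    (by rw [hx']; exact hx)
  rw [← hx']
  refine Finset.sum_eq_zero fun p hp => ?_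
  -- Testing X^n g^m against X^n gives the nonzero number `normX q n`, whatever m is.
  have h1 := congrArg (fun f => f (mono q (p.1, 0))) (LinearMap.mem_ker.1 (key p hp))
  have h2 := pairing_mono q p.1 p.1 p.2 0
  simp only [map_smul, LinearMap.smul_apply, h2] at h1
  have h3 : (basis q).repr x p = 0 := by simpa [normX_ne_zero hq] using h1
  rw [h3, zero_smul]

end Basics
end QB

namespace QB

/-! ### Classification of finite-dimensional quantum tangent spaces. -/

section TangentSpaces
variable {K : Type*} [Field K] (q : Kˣ)

/-! ### Projection to the kernel of the counit -/

theorem toKerCounit_add {H : Type*} [Ring H] [HopfAlgebra K H] (x y : H) :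
    toKerCounit K (x + y) = toKerCounit K x + toKerCounit K y := by
  simp only [toKerCounit, map_add]; abel

theorem toKerCounit_smul {H : Type*} [Ring H] [HopfAlgebra K H] (k : K) (x : H) :
    toKerCounit K (k • x) = k • toKerCounit K x := by
  simp only [toKerCounit, map_smul, smul_sub, Algebra.algebraMap_eq_smul_one, smul_assoc]

theorem toKerCounit_sub {H : Type*} [Ring H] [HopfAlgebra K H] (x y : H) :
    toKerCounit K (x - y) = toKerCounit K x - toKerCounit K y := by
  simp only [toKerCounit, map_sub]; abel

theorem toKerCounit_zero {H : Type*} [Ring H] [HopfAlgebra K H] :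
    toKerCounit K (0 : H) = 0 := by
  simp [toKerCounit]

theorem toKerCounit_sum {H ι : Type*} [Ring H] [HopfAlgebra K H] (s : Finset ι) (f : ι → H) :
    toKerCounit K (∑ i ∈ s, f i) = ∑ i ∈ s, toKerCounit K (f i) := by
  simp only [toKerCounit, map_sum, Finset.sum_sub_distrib]

theorem toKerCounit_of_counit_eq_zero {H : Type*} [Ring H] [HopfAlgebra K H] {x : H}
    (h : Coalgebra.counit (R := K) x = 0) : toKerCounit K x = x := by
  simp [toKerCounit, h]

theorem counit_toKerCounit {H : Type*} [Ring H] [HopfAlgebra K H] (x : H) :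
    Coalgebra.counit (R := K) (toKerCounit K x) = 0 := by
  simp [toKerCounit]

/-- The projection of the monomial `X ^ n g ^ m` to the kernel of the counit. -/
noncomputable def kmono (p : ℕ × ℤ) : QB K q := toKerCounit K (mono q p)

theorem kmono_zero (m : ℤ) : kmono q (0, m) = mono q (0, m) - 1 := by
  simp [kmono, toKerCounit, counit_mono]

theorem kmono_succ (n : ℕ) (m : ℤ) : kmono q (n + 1, m) = mono q (n + 1, m) := by
  simp [kmono, toKerCounit, counit_mono]

theorem kmono_zero_zero : kmono q (0, 0) = 0 := by
  rw [kmono_zero, mono_zero_zero, sub_self]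

theorem counit_kmono (p : ℕ × ℤ) : Coalgebra.counit (R := K) (kmono q p) = 0 :=
  counit_toKerCounit _

theorem repr_mono (p : ℕ × ℤ) : (basis q).repr (mono q p) = Finsupp.single p 1 := by
  rw [← basis_apply, Module.Basis.repr_self]

/-- Projecting to ker ε only changes the coefficient of 1, so all other coordinates still detect
monomials. -/
theorem repr_kmono {p p' : ℕ × ℤ} (h : p ≠ (0, 0)) :
    (basis q).repr (kmono q p') p = if p' = p then 1 else 0 := by
  rw [kmono, toKerCounit, map_sub, repr_mono, Algebra.algebraMap_eq_smul_one, ← mono_zero_zero,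
    map_smul, repr_mono]
  simp [Finsupp.single_apply, h.symm]

theorem linearIndependent_kmono :
    LinearIndependent K fun p : {p : ℕ × ℤ // p ≠ (0, 0)} => kmono q p.1 := by
  refine LinearIndependent.of_comp
    (Finsupp.lsubtypeDomain {p : ℕ × ℤ | p ≠ (0, 0)} ∘ₗ (basis q).repr.toLinearMap) ?_
  have h : ((Finsupp.lsubtypeDomain {p : ℕ × ℤ | p ≠ (0, 0)} ∘ₗ (basis q).repr.toLinearMap) ∘
      fun p : {p : ℕ × ℤ // p ≠ (0, 0)} => kmono q p.1) =
      Finsupp.basisSingleOne (R := K) (ι := {p : ℕ × ℤ // p ≠ (0, 0)}) := by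
    funext p
    refine Finsupp.ext fun p' => ?_
    have h1 := repr_kmono q (p' := p.1) p'.2
    simp only [Finsupp.coe_basisSingleOne, Finsupp.single_apply, Subtype.ext_iff]
    exact h1
  rw [h]
  exact Module.Basis.linearIndependent _

theorem toKerCounit_eq_sum (x : QB K q) : toKerCounit K x =
    ∑ p ∈ ((basis q).repr x).support, (basis q).repr x p • kmono q p := by
  conv_lhs => rw [← (basis q).linearCombination_repr x, Finsupp.linearCombination_apply,
    Finsupp.sum, toKerCounit_sum]
  simp only [toKerCounit_smul, basis_apply, kmono]

/-! ### The adjoint action -/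

theorem adjAction_gz (m : ℤ) (x : QB K q) :
    adjAction (K := K) (gz q m) x = gz q m * x * gz q (-m) := by
  simp [adjAction, comul_gz, antipode_gz]

theorem adjAction_X (x : QB K q) : adjAction (K := K) (X q) x =
    X q * x - gz q 1 * x * gz q (-1) * X q := by
  simp [adjAction, comul_X, antipode_X, mul_assoc, sub_eq_add_neg]

theorem adjAction_add (h h' x : QB K q) :
    adjAction (K := K) (h + h') x = adjAction (K := K) h x + adjAction (K := K) h' x := by
  simp [adjAction]

theorem adjAction_algebraMap (k : K) (x : QB K q) :
    adjAction (K := K) (algebraMap K (QB K q) k) x = k • x := by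
  simp [adjAction, Algebra.TensorProduct.one_def, Algebra.algebraMap_eq_smul_one]

/-- Holds because the antipode reverses products; it reduces stability under the adjoint action to
the generators. -/
theorem adjAction_mul (h h' x : QB K q) :
    adjAction (K := K) (h * h') x = adjAction (K := K) h (adjAction (K := K) h' x) := by
  have key : ∀ s t : QB K q ⊗[K] QB K q, ∀ x : QB K q,
      LinearMap.mul' K (QB K q) (TensorProduct.map (LinearMap.mulRight K x)
        (HopfAlgebra.antipode K) (s * t)) =
      LinearMap.mul' K (QB K q) (TensorProduct.map (LinearMap.mulRight K
        (LinearMap.mul' K (QB K q) (TensorProduct.map (LinearMap.mulRight K x)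
        (HopfAlgebra.antipode K) t))) (HopfAlgebra.antipode K) s) := by
    intro s t x
    induction s with
    | zero => simp
    | add s s' hs hs' => simp only [add_mul, map_add, hs, hs']
    | tmul a b =>
      induction t with
      | zero => simp
      | add t t' ht ht' =>
        simp only [TensorProduct.map_tmul, LinearMap.mul'_apply, LinearMap.mulRight_apply]
          at ht ht' ⊢
        simp only [mul_add, map_add, ht, ht', add_mul]
      | tmul c d => simp [antipode_mul, mul_assoc]
  rw [adjAction, Bialgebra.comul_mul, key]
  rfl

theorem adjAction_gz_one (x : QB K q) : adjAction (K := K) (gz q 1) x = degScale q x := by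
  have : LinearMap.mulLeft K (gz q 1) ∘ₗ LinearMap.mulRight K (gz q (-1)) = degScale q := by
    refine linearMap_ext q fun n m => ?_
    simp [mono_mul_gz, gz_mul_mono, degScale_mono]
  rw [adjAction_gz, ← this]
  simp [mul_assoc]

/-- The adjoint action of `X`. -/
noncomputable def adX : QB K q →ₗ[K] QB K q :=
  LinearMap.mulLeft K (X q) - LinearMap.mulRight K (X q) ∘ₗ degScale q

theorem adjAction_X_eq_adX (x : QB K q) : adjAction (K := K) (X q) x = adX q x := by
  rw [adjAction_X, adX, LinearMap.sub_apply, LinearMap.comp_apply, ← adjAction_gz_one,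
    adjAction_gz]
  simp

/-- The source of the classification: the raising coefficient vanishes only on the line n + m = 0,
where strings of monomials end. -/
theorem adX_mono (n : ℕ) (m : ℤ) :
    adX q (mono q (n, m)) = (1 - qz q (-(n + m))) • mono q (n + 1, m) := by
  rw [adX, LinearMap.sub_apply, LinearMap.comp_apply, degScale_mono, map_smul,
    LinearMap.mulRight_apply, LinearMap.mulLeft_apply, X_mul_mono, mono_mul_X, smul_smul,
    ← qz_add, ← neg_add, sub_smul, one_smul]

theorem degScale_one : degScale q 1 = 1 := by
  rw [← mono_zero_zero, degScale_mono]; simp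

theorem adX_one : adX q 1 = 0 := by
  rw [← mono_zero_zero, adX_mono]; simp

theorem degScale_kmono (n : ℕ) (m : ℤ) :
    degScale q (kmono q (n, m)) = qz q (-(n : ℤ)) • kmono q (n, m) := by
  rcases n with _ | n
  · rw [kmono_zero, map_sub, degScale_mono, degScale_one]; simp
  · rw [kmono_succ, degScale_mono]

theorem adX_kmono (n : ℕ) (m : ℤ) :
    adX q (kmono q (n, m)) = (1 - qz q (-(n + m))) • kmono q (n + 1, m) := by
  rw [kmono_succ]
  rcases n with _ | n
  · rw [kmono_zero, map_sub, adX_mono, adX_one, sub_zero]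
  · rw [kmono_succ, adX_mono]

theorem toKerCounit_derivation_g_kmono (n : ℕ) (m : ℤ) :
    toKerCounit K (braidedDerivation (pairing q) (mono q (0, 1)) (kmono q (n, m))) =
      qz q (-(n + m)) • kmono q (n, m) := by
  have h : braidedDerivation (pairing q) (mono q (0, 1)) 1 = 1 := by
    rw [← mono_zero_zero, braidedDerivation_mono_zero_mono]; simp
  rcases n with _ | n
  · rw [kmono_zero, map_sub, h, braidedDerivation_mono_zero_mono, toKerCounit_sub,
      toKerCounit_smul, ← mono_zero_zero, ← kmono, ← kmono, kmono_zero_zero, kmono_zero, one_mul,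
      mono_zero_zero, sub_zero]
  · rw [kmono_succ, braidedDerivation_mono_zero_mono, one_mul, toKerCounit_smul, ← kmono,
      kmono_succ]

/-- The lowering coefficient is nonzero when q is not a root of unity, so every string descends to
degree 0. -/
theorem toKerCounit_derivation_X_kmono (n : ℕ) (m : ℤ) :
    toKerCounit K (braidedDerivation (pairing q) (mono q (1, 0)) (kmono q (n + 1, m))) =
      pInt q (n + 1) • kmono q (n, m) := by
  rw [kmono_succ, braidedDerivation_mono_one_mono, toKerCounit_smul, Nat.add_sub_cancel, kmono]

/-- Subspaces of the kernel of the counit stable under the adjoint and coregular actions of the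
generators `g` and `X`. -/
structure IsStable (T : Submodule K (QB K q)) : Prop where
  counit_eq_zero : ∀ x ∈ T, Coalgebra.counit (R := K) x = 0
  degScale_mem : ∀ x ∈ T, degScale q x ∈ T
  adX_mem : ∀ x ∈ T, adX q x ∈ T
  derivation_g_mem : ∀ x ∈ T,
    toKerCounit K (braidedDerivation (pairing q) (mono q (0, 1)) x) ∈ T
  derivation_X_mem : ∀ x ∈ T,
    toKerCounit K (braidedDerivation (pairing q) (mono q (1, 0)) x) ∈ T

theorem counit_degScale (x : QB K q) :
    Coalgebra.counit (R := K) (degScale q x) = Coalgebra.counit (R := K) x := by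
  have : Coalgebra.counit (R := K) ∘ₗ degScale q = Coalgebra.counit (R := K) (A := QB K q) := by
    refine linearMap_ext q fun n m => ?_
    simp only [LinearMap.comp_apply, degScale_mono, map_smul, counit_mono]
    split_ifs with h <;> simp [h]
  exact congrArg (fun f => f x) this

theorem counit_adX (x : QB K q) : Coalgebra.counit (R := K) (adX q x) = 0 := by
  simp [adX]

variable {q}

theorem _root_.IsQuantumTangentSpace.isStable {T : Submodule K (QB K q)}
    (hT : IsQuantumTangentSpace (pairing q) T) : IsStable q T where
  counit_eq_zero := hT.counit_eq_zero
  degScale_mem x hx := by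
    have h := hT.adj_mem (gz q 1) x hx
    rwa [adjAction_gz_one, toKerCounit_of_counit_eq_zero] at h
    rw [counit_degScale, hT.counit_eq_zero x hx]
  adX_mem x hx := by
    have h := hT.adj_mem (X q) x hx
    rwa [adjAction_X_eq_adX, toKerCounit_of_counit_eq_zero (counit_adX q x)] at h
  derivation_g_mem x hx := by
    have h := hT.coreg_mem (mono q (0, 1)) x hx
    rwa [coregAction_eq] at h
  derivation_X_mem x hx := by
    have h := hT.coreg_mem (mono q (1, 0)) x hx
    rwa [coregAction_eq] at h

/-! ### The tangent spaces `L_I` -/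

/-- The set of pairs `(n, i)` with `n ∈ I` and `i < n`. -/
abbrev Idx (I : CalcIndex) : Type := Σ n : I.1, Fin n.1

theorem card_idx (I : CalcIndex) : Fintype.card (Idx I) = ∑ n ∈ I.1, n := by
  rw [Fintype.card_sigma]
  simp only [Fintype.card_fin]
  exact Finset.sum_coe_sort I.1 (fun n => n)

/-- The exponents of the monomial attached to an index. -/
def Idx.exps {I : CalcIndex} (p : Idx I) : ℕ × ℤ := (p.2.1, 1 - (p.1.1 : ℤ))

theorem Idx.exps_injective (I : CalcIndex) : Function.Injective (Idx.exps (I := I)) := by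
  rintro ⟨⟨n, hn⟩, ⟨i, hi⟩⟩ ⟨⟨n', hn'⟩, ⟨i', hi'⟩⟩ h
  simp only [Idx.exps, Prod.mk.injEq] at h
  obtain ⟨h1, h2⟩ := h
  have h3 : n = n' := by omega
  subst h3
  subst h1
  rfl

theorem Idx.exps_ne_zero {I : CalcIndex} (p : Idx I) : p.exps ≠ (0, 0) := by
  intro h
  have h1 := I.2 _ p.1.2
  have h2 := congrArg Prod.snd h
  simp only [Idx.exps] at h2
  omega

variable (q) in
/-- The normalized tangent vectors `(X ^ i g ^ (1 - n) - δ_{i,0}) / ⟨X ^ i, X ^ i⟩`. -/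
noncomputable def tvec {I : CalcIndex} (p : Idx I) : QB K q :=
  (normX q p.2.1)⁻¹ • kmono q p.exps

theorem linearIndependent_tvec (hq : ∀ n : ℕ, 0 < n → q ^ n ≠ 1) (I : CalcIndex) :
    LinearIndependent K (tvec q (I := I)) := by
  have h := (linearIndependent_kmono q).comp (fun p : Idx I => ⟨p.exps, p.exps_ne_zero⟩)
    (fun p p' h => Idx.exps_injective I (congrArg Subtype.val h))
  exact h.units_smul fun p => Units.mk0 _ (inv_ne_zero (normX_ne_zero hq p.2.1))

variable (q) in
/-- The quantum tangent space `L_I`. -/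
noncomputable def tangent (I : CalcIndex) : Submodule K (QB K q) :=
  Submodule.span K (Set.range (tvec q (I := I)))

theorem kmono_mem_tangent (hq : ∀ n : ℕ, 0 < n → q ^ n ≠ 1) {I : CalcIndex} {n i : ℕ}
    (hn : n ∈ I.1) (hi : i < n) : kmono q (i, 1 - (n : ℤ)) ∈ tangent q I := by
  have h : tvec q (I := I) ⟨⟨n, hn⟩, ⟨i, hi⟩⟩ ∈ tangent q I := Submodule.subset_span ⟨_, rfl⟩
  have h2 := Submodule.smul_mem _ (normX q i) h
  rwa [tvec, smul_smul, mul_inv_cancel₀ (normX_ne_zero hq i), one_smul] at h2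

theorem tangent_induction {I : CalcIndex} {P : QB K q → Prop} (h0 : P 0)
    (hadd : ∀ x y, P x → P y → P (x + y)) (hsmul : ∀ (k : K) x, P x → P (k • x))
    (h : ∀ n ∈ I.1, ∀ i < n, P (kmono q (i, 1 - (n : ℤ)))) : ∀ x ∈ tangent q I, P x := by
  intro x hx
  induction hx using Submodule.span_induction with
  | mem x hx =>
    obtain ⟨⟨n, i⟩, rfl⟩ := hx
    exact hsmul _ _ (h _ n.2 _ i.2)
  | zero => exact h0
  | add x y _ _ hx hy => exact hadd _ _ hx hy
  | smul k x _ hx => exact hsmul _ _ hx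

/-- The coordinate at g^{1-n} detects whether n belongs to the index. -/
theorem tangent_le_iff (hq : ∀ n : ℕ, 0 < n → q ^ n ≠ 1) {I J : CalcIndex} :
    tangent q I ≤ tangent q J ↔ I.1 ⊆ J.1 := by
  constructor
  · intro h n hn
    have hn2 := I.2 n hn
    by_contra hJ
    have h1 : ∀ x ∈ tangent q J, (basis q).repr x (0, 1 - (n : ℤ)) = 0 := by
      refine tangent_induction (by simp) (fun x y hx hy => by simp [hx, hy])
        (fun k x hx => by simp [hx]) fun m hm i _ => ?_
      rw [repr_kmono q (by simp; omega), if_neg]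
      intro h
      simp only [Prod.mk.injEq] at h
      have : m = n := by omega
      exact hJ (this ▸ hm)
    have h2 := h1 _ (h (kmono_mem_tangent hq hn (i := 0) (by omega)))
    rw [repr_kmono q (by simp; omega), if_pos rfl] at h2
    exact one_ne_zero h2
  · intro h
    refine tangent_induction (zero_mem _) (fun x y hx hy => add_mem hx hy)
      (fun k x hx => Submodule.smul_mem _ _ hx) fun n hn i hi => ?_
    exact kmono_mem_tangent hq (h hn) hi

theorem tangent_injective (hq : ∀ n : ℕ, 0 < n → q ^ n ≠ 1) :
    Function.Injective (tangent (K := K) q) := fun _ _ h =>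
  Subtype.ext (Finset.Subset.antisymm ((tangent_le_iff hq).1 h.le) ((tangent_le_iff hq).1 h.ge))

instance (I : CalcIndex) : FiniteDimensional K (tangent q I) :=
  FiniteDimensional.span_of_finite K (Set.finite_range _)

theorem finrank_tangent (hq : ∀ n : ℕ, 0 < n → q ^ n ≠ 1) (I : CalcIndex) :
    Module.finrank K (tangent q I) = ∑ n ∈ I.1, n := by
  rw [tangent, finrank_span_eq_card (linearIndependent_tvec hq I), card_idx]

theorem counit_tangent {I : CalcIndex} :
    ∀ x ∈ tangent q I, Coalgebra.counit (R := K) x = 0 :=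
  tangent_induction (by simp) (fun x y hx hy => by simp [hx, hy]) (fun k x hx => by simp [hx])
    fun _ _ _ _ => counit_kmono q _

variable (q) in
-- Multiplying by X ⊗ 1 + g ⊗ X raises the degree of the second leg by at most one and leaves its
-- g-exponent alone. Hence every coregular action preserves each string.
theorem rTensor_comul_mono_mem (m : ℤ) (i : ℕ) (f : QB K q →ₗ[K] K) :
    TensorProduct.lid K (QB K q) (f.rTensor (QB K q) (Coalgebra.comul (R := K) (mono q (i, m)))) ∈
      Submodule.span K ((fun j => mono q (j, m)) '' Set.Iic i) := by
  induction i generalizing f with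
  | zero =>
    rw [show mono q (0, m) = gz q m by simp [mono_def], comul_gz]
    simp only [LinearMap.rTensor_tmul, TensorProduct.lid_tmul]
    exact Submodule.smul_mem _ _ (Submodule.subset_span ⟨0, by simp, by simp [mono_def]⟩)
  | succ i ih =>
    have key : ∀ t : QB K q ⊗[K] QB K q, TensorProduct.lid K (QB K q) (f.rTensor (QB K q)
        ((X q ⊗ₜ[K] 1 + gz q 1 ⊗ₜ[K] X q) * t)) =
        TensorProduct.lid K (QB K q) ((f ∘ₗ LinearMap.mulLeft K (X q)).rTensor (QB K q) t) +
        X q * TensorProduct.lid K (QB K q)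
          ((f ∘ₗ LinearMap.mulLeft K (gz q 1)).rTensor (QB K q) t) := by
      intro t
      induction t with
      | zero => simp
      | tmul a b => simp [add_mul]
      | add a b ha hb => simp only [mul_add, map_add, ha, hb]; abel
    rw [← X_mul_mono, comul_X_mul, key]
    refine add_mem (Submodule.span_mono ?_ (ih _)) ?_
    · exact Set.image_mono (Set.Iic_subset_Iic.2 i.le_succ)
    · have : ∀ y ∈ Submodule.span K ((fun j => mono q (j, m)) '' Set.Iic i), X q * y ∈
          Submodule.span K ((fun j => mono q (j, m)) '' Set.Iic (i + 1)) := by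
        intro y hy
        induction hy using Submodule.span_induction with
        | mem x hx =>
          obtain ⟨j, hj, rfl⟩ := hx
          simp only [X_mul_mono]
          exact Submodule.subset_span ⟨j + 1, by simpa using hj, rfl⟩
        | zero => simp
        | add x y _ _ hx hy => rw [mul_add]; exact add_mem hx hy
        | smul k x _ hx => rw [mul_smul_comm]; exact Submodule.smul_mem _ _ hx
      exact this _ (ih _)

theorem adjAction_mem_tangent (hq : ∀ n : ℕ, 0 < n → q ^ n ≠ 1) (I : CalcIndex) (h : QB K q) :
    ∀ x ∈ tangent q I, adjAction (K := K) h x ∈ tangent q I := by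
  have hgz : ∀ s : ℤ, ∀ x ∈ tangent q I, adjAction (K := K) (gz q s) x ∈ tangent q I := by
    intro s
    simp only [adjAction_gz]
    refine tangent_induction (by simp) (fun x y hx hy => ?_) (fun k x hx => ?_) ?_
    · rw [mul_add, add_mul]; exact add_mem hx hy
    · rw [mul_smul_comm, smul_mul_assoc]; exact Submodule.smul_mem _ _ hx
    · intro n hn i hi
      have h2 := kmono_mem_tangent hq hn hi
      rcases i with _ | i
      · rw [kmono_zero] at h2 ⊢
        rw [mul_sub, sub_mul, mul_one, ← gz_add, gz_mul_mono, smul_mul_assoc, mono_mul_gz]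
        simpa using h2
      · rw [kmono_succ] at h2 ⊢
        rw [gz_mul_mono, smul_mul_assoc, mono_mul_gz]
        refine Submodule.smul_mem _ _ ?_
        rwa [show s + (1 - (n : ℤ)) + -s = 1 - (n : ℤ) by ring]
  refine mul_induction q (P := fun h => ∀ x ∈ tangent q I,
    adjAction (K := K) h x ∈ tangent q I) ?_ ?_ ?_ ?_ (hgz 1) (hgz (-1)) h
  · intro k x hx
    rw [adjAction_algebraMap]
    exact Submodule.smul_mem _ _ hx
  · intro a b ha hb x hx
    rw [adjAction_add]
    exact add_mem (ha x hx) (hb x hx)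
  · intro a b ha hb x hx
    rw [adjAction_mul]
    exact ha _ (hb x hx)
  · simp only [adjAction_X_eq_adX]
    refine tangent_induction (by simp) (fun x y hx hy => ?_) (fun k x hx => ?_) ?_
    · rw [map_add]; exact add_mem hx hy
    · rw [map_smul]; exact Submodule.smul_mem _ _ hx
    · intro n hn i hi
      rw [adX_kmono]
      rcases Nat.lt_or_ge (i + 1) n with h | h
      · exact Submodule.smul_mem _ _ (kmono_mem_tangent hq hn h)
      -- At the top i = n - 1 of the string the raising coefficient is zero.
      · rw [show -((i : ℤ) + (1 - (n : ℤ))) = 0 by omega]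
        simp

theorem toKerCounit_derivation_mem_tangent (hq : ∀ n : ℕ, 0 < n → q ^ n ≠ 1) (I : CalcIndex)
    (a : QB K q) : ∀ x ∈ tangent q I,
      toKerCounit K (braidedDerivation (pairing q) a x) ∈ tangent q I := by
  -- The summand -1 of `kmono q (0, m)` is sent to a scalar, which the projection kills.
  have h3 : toKerCounit K (braidedDerivation (pairing q) a 1) = 0 := by
    have h4 := rTensor_comul_mono_mem q 0 0 (pairing q a)
    have h5 : (fun j => mono q (j, 0)) '' Set.Iic 0 = {(1 : QB K q)} := by
      rw [show Set.Iic 0 = ({0} : Set ℕ) by ext; simp, Set.image_singleton, mono_zero_zero]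
    rw [mono_zero_zero, ← braidedDerivation_apply, h5] at h4
    obtain ⟨k, hk⟩ := Submodule.mem_span_singleton.1 h4
    rw [← hk, toKerCounit_smul]
    simp [toKerCounit]
  refine tangent_induction ?_ (fun x y hx hy => ?_) (fun k x hx => ?_) fun n hn i hi => ?_
  · rw [map_zero, toKerCounit_zero]
    exact zero_mem _
  · rw [map_add, toKerCounit_add]; exact add_mem hx hy
  · rw [map_smul, toKerCounit_smul]; exact Submodule.smul_mem _ _ hx
  · have h1 : ∀ y ∈ Submodule.span K ((fun j => mono q (j, 1 - (n : ℤ))) '' Set.Iic i),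
        toKerCounit K y ∈ tangent q I := by
      intro y hy
      induction hy using Submodule.span_induction with
      | mem x hx =>
        obtain ⟨j, hj, rfl⟩ := hx
        exact kmono_mem_tangent hq hn (lt_of_le_of_lt hj hi)
      | zero => rw [toKerCounit_zero]; exact zero_mem _
      | add x y _ _ hx hy => rw [toKerCounit_add]; exact add_mem hx hy
      | smul k x _ hx => rw [toKerCounit_smul]; exact Submodule.smul_mem _ _ hx
    have h2 := h1 _ (rTensor_comul_mono_mem q (1 - (n : ℤ)) i (pairing q a))
    rw [← braidedDerivation_apply] at h2
    rcases i with _ | i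
    · rw [kmono_zero, map_sub, toKerCounit_sub, h3, sub_zero]
      exact h2
    · rw [kmono_succ]
      exact h2

theorem isQuantumTangentSpace_tangent (hq : ∀ n : ℕ, 0 < n → q ^ n ≠ 1) (I : CalcIndex) :
    IsQuantumTangentSpace (pairing q) (tangent q I) where
  counit_eq_zero := counit_tangent
  adj_mem h x hx := by
    have key := adjAction_mem_tangent hq I h x hx
    rwa [toKerCounit_of_counit_eq_zero (counit_tangent _ key)]
  coreg_mem a x hx := by
    rw [coregAction_eq]
    exact toKerCounit_derivation_mem_tangent hq I a x hx

/-! ### Classification of tangent spaces -/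

theorem finite_of_kmono_mem {T : Submodule K (QB K q)} [FiniteDimensional K T] {ι : Type*}
    (f : ι → ℕ × ℤ) (hf : Function.Injective f) (h0 : ∀ i, f i ≠ (0, 0))
    (hT : ∀ i, kmono q (f i) ∈ T) : Finite ι := by
  have h := (linearIndependent_kmono q).comp (fun i => ⟨f i, h0 i⟩)
    (fun i j h => hf (congrArg Subtype.val h))
  have h2 : LinearIndependent K (fun i => (⟨kmono q (f i), hT i⟩ : T)) :=
    LinearIndependent.of_comp T.subtype h
  exact h2.finite

/-- Weight decomposition for ad g and the projected ∂_g, whose joint eigenvectors are the projected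
monomials. -/
theorem IsStable.smul_kmono_mem (hq : ∀ n : ℕ, 0 < n → q ^ n ≠ 1) {T : Submodule K (QB K q)}
    (hT : IsStable q T) {x : QB K q} (hx : x ∈ T) :
    ∀ p ∈ ((basis q).repr x).support, (basis q).repr x p • kmono q p ∈ T := by
  let T' : Module.End K (QB K q) :=
    { toFun := fun x => toKerCounit K (braidedDerivation (pairing q) (mono q (0, 1)) x)
      map_add' := fun x y => by rw [map_add, toKerCounit_add]
      map_smul' := fun k x => by rw [map_smul, toKerCounit_smul]; rfl }
  refine smul_mono_mem hq T (degScale q) T' hT.degScale_mem hT.derivation_g_mem _ _ ?_ ?_ ?_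
  · intro p _
    rw [map_smul, degScale_kmono, smul_comm]
  · intro p _
    rw [map_smul, smul_comm]
    exact congrArg _ (toKerCounit_derivation_g_kmono q p.1 p.2)
  · rwa [← toKerCounit_eq_sum, toKerCounit_of_counit_eq_zero (hT.counit_eq_zero x hx)]

theorem IsStable.kmono_succ_mem (hq : ∀ n : ℕ, 0 < n → q ^ n ≠ 1) {T : Submodule K (QB K q)}
    (hT : IsStable q T) {n : ℕ} {m : ℤ} (h : kmono q (n, m) ∈ T) (hnm : (n : ℤ) + m ≠ 0) :
    kmono q (n + 1, m) ∈ T := by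
  have h1 := hT.adX_mem _ h
  rw [adX_kmono] at h1
  refine (Submodule.smul_mem_iff _ ?_).1 h1
  rw [sub_ne_zero, ne_comm, Ne, qz_eq_one_iff hq]
  omega

theorem IsStable.kmono_mem_of_succ (hq : ∀ n : ℕ, 0 < n → q ^ n ≠ 1) {T : Submodule K (QB K q)}
    (hT : IsStable q T) {n : ℕ} {m : ℤ} (h : kmono q (n + 1, m) ∈ T) : kmono q (n, m) ∈ T := by
  have h1 := hT.derivation_X_mem _ h
  rw [toKerCounit_derivation_X_kmono] at h1
  exact (Submodule.smul_mem_iff _ (pInt_ne_zero hq n)).1 h1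

/-- Above the line n + m = 0 the raising coefficient never vanishes again, so one such monomial
would generate an infinite string. -/
theorem IsStable.add_nonpos (hq : ∀ n : ℕ, 0 < n → q ^ n ≠ 1) {T : Submodule K (QB K q)}
    [FiniteDimensional K T] (hT : IsStable q T) {n : ℕ} {m : ℤ} (h : kmono q (n, m) ∈ T) :
    (n : ℤ) + m ≤ 0 := by
  by_contra! hnm
  have h1 : ∀ k : ℕ, kmono q (n + k, m) ∈ T := by
    intro k
    induction k with
    | zero => exact h
    | succ k ih => exact hT.kmono_succ_mem hq (n := n + k) ih (by push_cast; omega)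
  -- The shift to `k + 1` keeps the exponent away from (0, 0), where the projected monomial is zero.
  have := finite_of_kmono_mem (T := T) (fun k : ℕ => (n + (k + 1), m))
    (fun a b h => by simpa using h) (fun k => by simp) (fun k => h1 (k + 1))
  exact not_finite ℕ

/-- The index records which strings occur, and a string is detected by its bottom element g^{1-n} -
1: ∂_X descends to it and ad X climbs from it up to i = n - 1. -/
theorem IsStable.eq_tangent (hq : ∀ n : ℕ, 0 < n → q ^ n ≠ 1) {T : Submodule K (QB K q)}
    [FiniteDimensional K T] (hT : IsStable q T) : ∃ I, T = tangent q I := by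
  classical
  have hfin : {n : ℕ | 2 ≤ n ∧ kmono q (0, 1 - (n : ℤ)) ∈ T}.Finite := by
    refine finite_of_kmono_mem (T := T) (fun n : {n : ℕ | 2 ≤ n ∧ kmono q (0, 1 - (n : ℤ)) ∈ T} =>
      (0, 1 - (n.1 : ℤ))) ?_ ?_ (fun n => n.2.2)
    · rintro ⟨a, _⟩ ⟨b, _⟩ h
      simpa using h
    · rintro ⟨a, ha, _⟩ h
      simp at h
      omega
  refine ⟨⟨hfin.toFinset, fun n hn => ((Set.Finite.mem_toFinset _).1 hn).1⟩, le_antisymm ?_ ?_⟩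
  · intro x hx
    rw [← toKerCounit_of_counit_eq_zero (hT.counit_eq_zero x hx), toKerCounit_eq_sum]
    refine Submodule.sum_mem _ fun p hp => Submodule.smul_mem _ _ ?_
    have h1 := (Submodule.smul_mem_iff _ (Finsupp.mem_support_iff.1 hp)).1
      (hT.smul_kmono_mem hq hx p hp)
    obtain ⟨i, m⟩ := p
    have h2 := hT.add_nonpos hq h1
    -- Here i + m ≤ 0 forces i = 0 as well, and the projection of 1 is zero; this is why n = 1 is
    -- absent from the index.
    by_cases h0 : m = 0
    · have : i = 0 := by omega
      subst h0 this
      rw [kmono_zero_zero]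
      exact zero_mem _
    · obtain ⟨n, rfl⟩ : ∃ n : ℕ, m = 1 - (n : ℤ) := ⟨(1 - m).toNat, by omega⟩
      refine kmono_mem_tangent hq ?_ (by omega)
      refine (Set.Finite.mem_toFinset _).2 ⟨by omega, ?_⟩
      clear h2 hp
      induction i with
      | zero => exact h1
      | succ i ih => exact ih (hT.kmono_mem_of_succ hq h1)
  · refine tangent_induction (zero_mem _) (fun x y hx hy => add_mem hx hy)
      (fun k x hx => Submodule.smul_mem _ _ hx) fun n hn i hi => ?_
    induction i with
    | zero => exact ((Set.Finite.mem_toFinset _).1 hn).2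
    | succ i ih => exact hT.kmono_succ_mem hq (ih (by omega)) (by omega)

/-- Since I ↦ L_I is an order embedding and subspaces of L_I are finite-dimensional, irreducible
means that I is a minimal nonempty finite set. -/
theorem isIrreducible_tangent_iff (hq : ∀ n : ℕ, 0 < n → q ^ n ≠ 1) (I : CalcIndex) :
    IsIrreducibleTangentSpace (pairing q) (tangent q I) ↔
      ∃ n hn, I = CalcIndex.single n hn := by
  have h0 : tangent q ⟨∅, by simp⟩ = ⊥ := by
    refine Submodule.span_eq_bot.2 ?_
    rintro _ ⟨⟨⟨n, hn⟩, _⟩, rfl⟩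
    simp at hn
  constructor
  · rintro ⟨-, h1, h2⟩
    have hI : I.1.Nonempty := by
      rw [Finset.nonempty_iff_ne_empty]
      intro h
      exact h1 (by rw [← h0]; congr 1; exact Subtype.ext h)
    obtain ⟨n, hn⟩ := hI
    refine ⟨n, I.2 n hn, tangent_injective hq ?_⟩
    symm
    refine (h2 _ (isQuantumTangentSpace_tangent hq _) ((tangent_le_iff hq).2 ?_)).resolve_left ?_
    · simpa [CalcIndex.single] using hn
    · intro h
      have := congrArg Subtype.val (tangent_injective hq (h.trans h0.symm))
      simp [CalcIndex.single] at this
  · rintro ⟨n, hn, rfl⟩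
    refine ⟨isQuantumTangentSpace_tangent hq _, ?_, ?_⟩
    · intro h
      have := congrArg Subtype.val (tangent_injective hq (h.trans h0.symm))
      simp [CalcIndex.single] at this
    · intro L' hL' hle
      have : FiniteDimensional K L' := Submodule.finiteDimensional_of_le hle
      obtain ⟨J, rfl⟩ := hL'.isStable.eq_tangent hq
      rw [tangent_le_iff hq] at hle
      rcases Finset.subset_singleton_iff.1 hle with h | h
      · left
        rw [← h0]; congr 1; exact Subtype.ext h
      · right
        congr 1; exact Subtype.ext h

theorem iSupIndep_tangent_single (hq : ∀ n : ℕ, 0 < n → q ^ n ≠ 1) (I : CalcIndex) :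
    iSupIndep (fun n : I.1 => tangent q (CalcIndex.single n.1 (I.2 n.1 n.2))) := by
  intro n
  have h1 : tangent q (CalcIndex.single n.1 (I.2 n.1 n.2)) ≤
      Submodule.span K (tvec q '' {p : Idx I | p.1 = n}) := by
    refine Submodule.span_le.2 ?_
    rintro _ ⟨⟨⟨m, hm⟩, i⟩, rfl⟩
    obtain rfl : m = n := by simpa [CalcIndex.single] using hm
    exact Submodule.subset_span ⟨⟨n, i⟩, rfl, rfl⟩
  have h2 : ⨆ m : I.1, ⨆ _ : m ≠ n, tangent q (CalcIndex.single m.1 (I.2 m.1 m.2)) ≤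
      Submodule.span K (tvec q '' {p : Idx I | p.1 ≠ n}) := by
    refine iSup₂_le fun m hm => Submodule.span_le.2 ?_
    rintro _ ⟨⟨⟨k, hk⟩, i⟩, rfl⟩
    obtain rfl : k = m := by simpa [CalcIndex.single] using hk
    exact Submodule.subset_span ⟨⟨m, i⟩, hm, rfl⟩
  refine Disjoint.mono h1 h2 ((linearIndependent_tvec hq I).disjoint_span_image ?_)
  exact Set.disjoint_left.2 fun p hp hp' => hp' hp

theorem iSup_tangent_single (I : CalcIndex) :
    ⨆ n : I.1, tangent q (CalcIndex.single n.1 (I.2 n.1 n.2)) = tangent q I := by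
  refine le_antisymm (iSup_le fun n => Submodule.span_le.2 ?_) (Submodule.span_le.2 ?_)
  · rintro _ ⟨⟨⟨m, hm⟩, i⟩, rfl⟩
    obtain rfl : m = n := by simpa [CalcIndex.single] using hm
    exact Submodule.subset_span ⟨⟨n, i⟩, rfl⟩
  · rintro _ ⟨⟨n, i⟩, rfl⟩
    refine Submodule.mem_iSup_of_mem n (Submodule.subset_span
      ⟨⟨⟨n.1, by simp [CalcIndex.single]⟩, i⟩, rfl⟩)

end TangentSpaces
end QB

/-! ### The actions of A ⊗ A on A ⊗ Γ and Γ ⊗ A. -/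

namespace BimoduleTensor

section
set_option linter.unusedSectionVars false
variable {K : Type u} {A : Type v} {M : Type w} [Field K] [Ring A] [Algebra K A] [AddCommGroup M]
  [Module K M] [Module A M] [Module Aᵐᵒᵖ M] [IsScalarTower K A M] [IsScalarTower K Aᵐᵒᵖ M]

variable (K A M) in
/-- Left multiplication by elements of `A`. -/
noncomputable def lact : A →ₗ[K] M →ₗ[K] M := (Algebra.lsmul K K M : A →ₐ[K] _).toLinearMap

variable (K A M) in
/-- Right multiplication by elements of `A`. -/
noncomputable def ract : A →ₗ[K] M →ₗ[K] M :=
  (Algebra.lsmul K K M : Aᵐᵒᵖ →ₐ[K] _).toLinearMap ∘ₗ (opLinearEquiv K).toLinearMap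

@[simp] theorem lact_apply (a : A) (x : M) : lact K A M a x = a • x := rfl

@[simp] theorem ract_apply (a : A) (x : M) : ract K A M a x = op a • x := rfl

variable (K A M) in
/-- The left action of `A ⊗ A` on `A ⊗ Γ`. -/
noncomputable def lactL : A ⊗[K] A →ₗ[K] A ⊗[K] M →ₗ[K] A ⊗[K] M :=
  TensorProduct.map₂ (LinearMap.mul K A) (lact K A M)

variable (K A M) in
/-- The right action of `A ⊗ A` on `A ⊗ Γ`. -/
noncomputable def ractL : A ⊗[K] A →ₗ[K] A ⊗[K] M →ₗ[K] A ⊗[K] M :=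
  TensorProduct.map₂ (LinearMap.mul K A).flip (ract K A M)

variable (K A M) in
/-- The left action of `A ⊗ A` on `Γ ⊗ A`. -/
noncomputable def lactR : A ⊗[K] A →ₗ[K] M ⊗[K] A →ₗ[K] M ⊗[K] A :=
  TensorProduct.map₂ (lact K A M) (LinearMap.mul K A)

variable (K A M) in
/-- The right action of `A ⊗ A` on `Γ ⊗ A`. -/
noncomputable def ractR : A ⊗[K] A →ₗ[K] M ⊗[K] A →ₗ[K] M ⊗[K] A :=
  TensorProduct.map₂ (ract K A M) (LinearMap.mul K A).flip

@[simp] theorem lactL_tmul (a b c : A) (x : M) :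
    lactL K A M (a ⊗ₜ b) (c ⊗ₜ x) = (a * c) ⊗ₜ (b • x) := rfl

@[simp] theorem ractL_tmul (a b c : A) (x : M) :
    ractL K A M (a ⊗ₜ b) (c ⊗ₜ x) = (c * a) ⊗ₜ (op b • x) := rfl

@[simp] theorem lactR_tmul (a b c : A) (x : M) :
    lactR K A M (a ⊗ₜ b) (x ⊗ₜ c) = (a • x) ⊗ₜ (b * c) := rfl

@[simp] theorem ractR_tmul (a b c : A) (x : M) :
    ractR K A M (a ⊗ₜ b) (x ⊗ₜ c) = (op a • x) ⊗ₜ (c * b) := rfl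

theorem lactL_mul (s t : A ⊗[K] A) (y : A ⊗[K] M) :
    lactL K A M (s * t) y = lactL K A M s (lactL K A M t y) := by
  induction s with
  | zero => simp
  | add s s' hs hs' => simp only [add_mul, map_add, LinearMap.add_apply, hs, hs']
  | tmul a b =>
    induction t with
    | zero => simp
    | add t t' ht ht' => simp only [mul_add, map_add, LinearMap.add_apply, ht, ht']
    | tmul c d =>
      induction y with
      | zero => simp
      | add y y' hy hy' => simp only [map_add, hy, hy']
      | tmul e x => simp [mul_assoc, smul_smul]

theorem lactR_mul (s t : A ⊗[K] A) (y : M ⊗[K] A) :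
    lactR K A M (s * t) y = lactR K A M s (lactR K A M t y) := by
  induction s with
  | zero => simp
  | add s s' hs hs' => simp only [add_mul, map_add, LinearMap.add_apply, hs, hs']
  | tmul a b =>
    induction t with
    | zero => simp
    | add t t' ht ht' => simp only [mul_add, map_add, LinearMap.add_apply, ht, ht']
    | tmul c d =>
      induction y with
      | zero => simp
      | add y y' hy hy' => simp only [map_add, hy, hy']
      | tmul e x => simp [mul_assoc, smul_smul]

theorem ractL_mul (s t : A ⊗[K] A) (y : A ⊗[K] M) :
    ractL K A M (s * t) y = ractL K A M t (ractL K A M s y) := by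
  induction s with
  | zero => simp
  | add s s' hs hs' => simp only [add_mul, map_add, LinearMap.add_apply, hs, hs']
  | tmul a b =>
    induction t with
    | zero => simp
    | add t t' ht ht' => simp only [mul_add, map_add, LinearMap.add_apply, ht, ht']
    | tmul c d =>
      induction y with
      | zero => simp
      | add y y' hy hy' => simp only [map_add, hy, hy']
      | tmul e x => simp [mul_assoc, smul_smul]

theorem ractR_mul (s t : A ⊗[K] A) (y : M ⊗[K] A) :
    ractR K A M (s * t) y = ractR K A M t (ractR K A M s y) := by
  induction s with
  | zero => simp
  | add s s' hs hs' => simp only [add_mul, map_add, LinearMap.add_apply, hs, hs']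
  | tmul a b =>
    induction t with
    | zero => simp
    | add t t' ht ht' => simp only [mul_add, map_add, LinearMap.add_apply, ht, ht']
    | tmul c d =>
      induction y with
      | zero => simp
      | add y y' hy hy' => simp only [map_add, hy, hy']
      | tmul e x => simp [mul_assoc, smul_smul]

theorem lactL_ractL [SMulCommClass A Aᵐᵒᵖ M] (s t : A ⊗[K] A) (y : A ⊗[K] M) :
    lactL K A M s (ractL K A M t y) = ractL K A M t (lactL K A M s y) := by
  induction s with
  | zero => simp
  | add s s' hs hs' => simp only [map_add, LinearMap.add_apply, hs, hs']
  | tmul a b =>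
    induction t with
    | zero => simp
    | add t t' ht ht' => simp only [map_add, LinearMap.add_apply, ht, ht']
    | tmul c d =>
      induction y with
      | zero => simp
      | add y y' hy hy' => simp only [map_add, hy, hy']
      | tmul e x => simp [mul_assoc, smul_comm]

theorem lactR_ractR [SMulCommClass A Aᵐᵒᵖ M] (s t : A ⊗[K] A) (y : M ⊗[K] A) :
    lactR K A M s (ractR K A M t y) = ractR K A M t (lactR K A M s y) := by
  induction s with
  | zero => simp
  | add s s' hs hs' => simp only [map_add, LinearMap.add_apply, hs, hs']
  | tmul a b =>
    induction t with
    | zero => simp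
    | add t t' ht ht' => simp only [map_add, LinearMap.add_apply, ht, ht']
    | tmul c d =>
      induction y with
      | zero => simp
      | add y y' hy hy' => simp only [map_add, hy, hy']
      | tmul e x => simp [mul_assoc, smul_comm]

end
end BimoduleTensor

/-! ### Bicovariant calculi are recovered from their right invariant forms. -/

namespace BicovariantCalculus

section Bimodule
variable {K : Type u} {A : Type v} [Field K] [Ring A] [Bialgebra K A]
  (C : BicovariantCalculus.{u, v, w} K A)

theorem induction {P : C.Γ → Prop} (h : ∀ a b : A, P (a • C.d b))
    (hadd : ∀ x y, P x → P y → P (x + y))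
    (x : C.Γ) : P x := by
  have hx : x ∈ Submodule.span A (Set.range C.d) := by rw [C.span_d]; trivial
  -- Strengthening to all left multiples makes the scalar case of the span induction go through
  -- without any hypothesis on `P` and scalars.
  have key : ∀ a : A, P (a • x) := by
    induction hx using Submodule.span_induction with
    | mem x hx =>
      obtain ⟨b, rfl⟩ := hx
      exact fun a => h a b
    | zero =>
      intro a
      simpa using h 0 0
    | add x y _ _ hx hy =>
      intro a
      rw [smul_add]
      exact hadd _ _ (hx a) (hy a)
    | smul b x _ hx =>
      intro a
      rw [smul_smul]
      exact hx _
  simpa using key 1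

theorem op_smul_smul (a b : A) (x : C.Γ) : op b • a • x = a • op b • x :=
  (smul_comm a (op b) x).symm

theorem d_one : C.d 1 = 0 := by
  have h := C.leibniz 1 1
  simpa using h

/-- Right multiplication by elements of `A`. -/
noncomputable abbrev ract : A →ₗ[K] C.Γ →ₗ[K] C.Γ := BimoduleTensor.ract K A C.Γ

/-- The left action of `A ⊗ A` on `A ⊗ Γ`. -/
noncomputable abbrev lactL : A ⊗[K] A →ₗ[K] A ⊗[K] C.Γ →ₗ[K] A ⊗[K] C.Γ :=
  BimoduleTensor.lactL K A C.Γ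

/-- The right action of `A ⊗ A` on `A ⊗ Γ`. -/
noncomputable abbrev ractL : A ⊗[K] A →ₗ[K] A ⊗[K] C.Γ →ₗ[K] A ⊗[K] C.Γ :=
  BimoduleTensor.ractL K A C.Γ

/-- The left action of `A ⊗ A` on `Γ ⊗ A`. -/
noncomputable abbrev lactR : A ⊗[K] A →ₗ[K] C.Γ ⊗[K] A →ₗ[K] C.Γ ⊗[K] A :=
  BimoduleTensor.lactR K A C.Γ

/-- The right action of `A ⊗ A` on `Γ ⊗ A`. -/
noncomputable abbrev ractR : A ⊗[K] A →ₗ[K] C.Γ ⊗[K] A →ₗ[K] C.Γ ⊗[K] A :=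
  BimoduleTensor.ractR K A C.Γ

/-- The map id ⊗ d is again a derivation, now from A ⊗ A to A ⊗ Γ; this makes the left coaction
compatible with right multiplication. -/
theorem lTensor_d_mul (s t : A ⊗[K] A) : C.d.lTensor A (s * t) =
    C.ractL t (C.d.lTensor A s) + C.lactL s (C.d.lTensor A t) := by
  induction s with
  | zero => simp
  | add s s' hs hs' => simp only [add_mul, map_add, LinearMap.add_apply, hs, hs']; abel
  | tmul a b =>
    induction t with
    | zero => simp
    | add t t' ht ht' => simp only [mul_add, map_add, LinearMap.add_apply, ht, ht']; abel
    | tmul c d => simp [C.leibniz, TensorProduct.tmul_add]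

theorem rTensor_d_mul (s t : A ⊗[K] A) : C.d.rTensor A (s * t) =
    C.ractR t (C.d.rTensor A s) + C.lactR s (C.d.rTensor A t) := by
  induction s with
  | zero => simp
  | add s s' hs hs' => simp only [add_mul, map_add, LinearMap.add_apply, hs, hs']; abel
  | tmul a b =>
    induction t with
    | zero => simp
    | add t t' ht ht' => simp only [mul_add, map_add, LinearMap.add_apply, ht, ht']; abel
    | tmul c d => simp [C.leibniz, TensorProduct.add_tmul]

theorem coactL_smul (a : A) (x : C.Γ) :
    C.coactL (a • x) = C.lactL (Coalgebra.comul (R := K) a) (C.coactL x) := by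
  induction x using C.induction with
  | h b c =>
    rw [smul_smul, C.coactL_smul_d, C.coactL_smul_d, Bialgebra.comul_mul]
    exact BimoduleTensor.lactL_mul _ _ _
  | hadd x y hx hy => rw [smul_add, map_add, hx, hy, map_add, map_add]

theorem coactR_smul (a : A) (x : C.Γ) :
    C.coactR (a • x) = C.lactR (Coalgebra.comul (R := K) a) (C.coactR x) := by
  induction x using C.induction with
  | h b c =>
    rw [smul_smul, C.coactR_smul_d, C.coactR_smul_d, Bialgebra.comul_mul]
    exact BimoduleTensor.lactR_mul _ _ _
  | hadd x y hx hy => rw [smul_add, map_add, hx, hy, map_add, map_add]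

/-- The Leibniz rule solved for right multiplication: it brings a form back to the shape a db on
which the coactions are prescribed. -/
theorem op_smul_smul_d (a b c : A) : op a • b • C.d c = b • C.d (c * a) - (b * c) • C.d a := by
  rw [C.leibniz, smul_add, smul_smul, add_sub_cancel_right, op_smul_smul]

theorem coactL_op_smul (a : A) (x : C.Γ) :
    C.coactL (op a • x) = C.ractL (Coalgebra.comul (R := K) a) (C.coactL x) := by
  induction x using C.induction with
  | h b c =>
    rw [op_smul_smul_d, map_sub, C.coactL_smul_d, C.coactL_smul_d, C.coactL_smul_d,
      Bialgebra.comul_mul, Bialgebra.comul_mul]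
    change C.lactL _ _ - C.lactL _ _ = C.ractL _ (C.lactL _ _)
    rw [C.lTensor_d_mul, BimoduleTensor.lactL_mul, map_add, add_sub_cancel_right,
      BimoduleTensor.lactL_ractL]
  | hadd x y hx hy => rw [smul_add, map_add, hx, hy, map_add, map_add]

theorem coactR_op_smul (a : A) (x : C.Γ) :
    C.coactR (op a • x) = C.ractR (Coalgebra.comul (R := K) a) (C.coactR x) := by
  induction x using C.induction with
  | h b c =>
    rw [op_smul_smul_d, map_sub, C.coactR_smul_d, C.coactR_smul_d, C.coactR_smul_d,
      Bialgebra.comul_mul, Bialgebra.comul_mul]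
    change C.lactR _ _ - C.lactR _ _ = C.ractR _ (C.lactR _ _)
    rw [C.rTensor_d_mul, BimoduleTensor.lactR_mul, map_add, add_sub_cancel_right,
      BimoduleTensor.lactR_ractR]
  | hadd x y hx hy => rw [smul_add, map_add, hx, hy, map_add, map_add]

theorem coactL_d (a : A) :
    C.coactL (C.d a) = C.d.lTensor A (Coalgebra.comul (R := K) a) := by
  rw [← one_smul A (C.d a), C.coactL_smul_d, Bialgebra.comul_one, Algebra.TensorProduct.one_def]
  induction C.d.lTensor A (Coalgebra.comul (R := K) a) with
  | zero => simp
  | add y y' hy hy' => rw [map_add, hy, hy']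
  | tmul e x => rw [TensorProduct.map₂_apply_tmul]; simp

theorem coactR_d (a : A) :
    C.coactR (C.d a) = C.d.rTensor A (Coalgebra.comul (R := K) a) := by
  rw [← one_smul A (C.d a), C.coactR_smul_d, Bialgebra.comul_one, Algebra.TensorProduct.one_def]
  induction C.d.rTensor A (Coalgebra.comul (R := K) a) with
  | zero => simp
  | add y y' hy hy' => rw [map_add, hy, hy']
  | tmul e x => rw [TensorProduct.map₂_apply_tmul]; simp

theorem mem_rightInvariants {x : C.Γ} : x ∈ C.rightInvariants ↔ C.coactR x = x ⊗ₜ 1 := by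
  rw [rightInvariants, LinearMap.mem_ker, LinearMap.sub_apply, sub_eq_zero]
  rfl

theorem IsMorphism.ext {C : BicovariantCalculus.{u, v, w} K A}
    {D : BicovariantCalculus.{u, v, w'} K A} {f f' : C.Γ →ₗ[A] D.Γ} (hf : IsMorphism C D f)
    (hf' : IsMorphism C D f') : f = f' := by
  ext x
  induction x using C.induction with
  | h a b => rw [map_smul, map_smul, hf.2, hf'.2]
  | hadd x y hx hy => rw [map_add, map_add, hx, hy]

theorem IsMorphism.comp {C : BicovariantCalculus.{u, v, w} K A}
    {D : BicovariantCalculus.{u, v, w'} K A} {f : C.Γ →ₗ[A] D.Γ} {f' : D.Γ →ₗ[A] C.Γ}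
    (hf' : IsMorphism D C f') (hf : IsMorphism C D f) : f' ∘ₗ f = LinearMap.id := by
  refine IsMorphism.ext (C := C) (D := C) ⟨fun a x => ?_, fun a => ?_⟩
    ⟨fun a x => rfl, fun a => rfl⟩
  · rw [LinearMap.comp_apply, hf.1, hf'.1]; rfl
  · rw [LinearMap.comp_apply, hf.2, hf'.2]

end Bimodule

section Hopf
variable {K : Type u} {A : Type v} [Field K] [Ring A] [HopfAlgebra K A]

/-- The map `a ⊗ b ↦ d(a) S(b)`. -/
noncomputable def preRightForm (C : BicovariantCalculus.{u, v, w} K A) : A ⊗[K] A →ₗ[K] C.Γ :=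
  TensorProduct.lift (((Algebra.lsmul K K C.Γ : Aᵐᵒᵖ →ₐ[K] _).toLinearMap ∘ₗ
    (opLinearEquiv K).toLinearMap ∘ₗ HopfAlgebra.antipode K).flip ∘ₗ C.d)

theorem preRightForm_tmul (C : BicovariantCalculus.{u, v, w} K A) (a b : A) :
    C.preRightForm (a ⊗ₜ b) = op (HopfAlgebra.antipode K b) • C.d a := rfl

theorem rightForm_apply (C : BicovariantCalculus.{u, v, w} K A) (a : A) :
    C.rightForm a = C.preRightForm (Coalgebra.comul (R := K) a) := rfl

theorem rightForm_one (C : BicovariantCalculus.{u, v, w} K A) : C.rightForm 1 = 0 := by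
  rw [rightForm_apply, Bialgebra.comul_one, Algebra.TensorProduct.one_def, preRightForm_tmul,
    d_one, smul_zero]

theorem IsMorphism.rightForm {C : BicovariantCalculus.{u, v, w} K A}
    {D : BicovariantCalculus.{u, v, w'} K A} {f : C.Γ →ₗ[A] D.Γ} (hf : IsMorphism C D f) (a : A) :
    f (C.rightForm a) = D.rightForm a := by
  rw [rightForm_apply, rightForm_apply]
  induction Coalgebra.comul (R := K) a with
  | zero => simp
  | add x y hx hy => rw [map_add, map_add, map_add, hx, hy]
  | tmul a b => rw [preRightForm_tmul, preRightForm_tmul, hf.1, hf.2]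

/-- As ω(1) = 0, the whole kernel of ω is its part in ker ε plus the scalars, so comparing crossed
submodules is enough. -/
theorem ker_rightForm_le {C : BicovariantCalculus.{u, v, w} K A}
    {D : BicovariantCalculus.{u, v, w'} K A} (h : C.crossedSubmodule ≤ D.crossedSubmodule) :
    LinearMap.ker C.rightForm ≤ LinearMap.ker D.rightForm := by
  intro v hv
  have h1 : toKerCounit K v ∈ C.crossedSubmodule := by
    refine ⟨QB.counit_toKerCounit v, ?_⟩
    change C.rightForm _ = 0
    rw [toKerCounit, map_sub, Algebra.algebraMap_eq_smul_one, map_smul, rightForm_one,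
      LinearMap.mem_ker.1 hv]
    simp
  have h2 : D.rightForm _ = 0 := (h h1).2
  rw [toKerCounit, map_sub, Algebra.algebraMap_eq_smul_one, map_smul, rightForm_one] at h2
  simpa using h2

/-- The map `v ⊗ b ↦ ω(v) b`. -/
noncomputable def formMul (C : BicovariantCalculus.{u, v, w} K A) : A ⊗[K] A →ₗ[K] C.Γ :=
  TensorProduct.lift (C.ract.flip ∘ₗ C.rightForm)

theorem formMul_tmul (C : BicovariantCalculus.{u, v, w} K A) (v b : A) :
    C.formMul (v ⊗ₜ b) = op b • C.rightForm v := rfl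

end Hopf

section QB
variable {K : Type u} [Field K] {q : Kˣ} (C : BicovariantCalculus.{u, u, w} K (QB K q))
open QB

/-- The case a = g^s of ω(av) = a₁ω(v)S(a₂) + ε(v)ω(a): the Leibniz rule gives two terms, and
v₁S(v₂) = ε(v) simplifies the second. -/
theorem rightForm_gz_mul (s : ℤ) (v : QB K q) : C.rightForm (gz q s * v) =
    gz q s • op (gz q (-s)) • C.rightForm v +
      Coalgebra.counit (R := K) v • op (gz q (-s)) • C.d (gz q s) := by
  have key : ∀ t : QB K q ⊗[K] QB K q, C.preRightForm ((gz q s ⊗ₜ gz q s) * t) =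
      gz q s • op (gz q (-s)) • C.preRightForm t +
      op (gz q (-s)) • op (LinearMap.mul' K _ ((HopfAlgebra.antipode K).lTensor _ t)) •
        C.d (gz q s) := by
    intro t
    induction t with
    | zero => simp
    | add x y hx hy => simp only [mul_add, map_add, smul_add, op_add, add_smul, hx, hy]; abel
    | tmul a b =>
      rw [Algebra.TensorProduct.tmul_mul_tmul, preRightForm_tmul, preRightForm_tmul, antipode_mul,
        antipode_gz, C.leibniz, op_mul, mul_smul, smul_add, smul_add, LinearMap.lTensor_tmul,
        LinearMap.mul'_apply, op_mul, mul_smul, add_comm, smul_comm (gz q s), smul_comm (gz q s)]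
  rw [rightForm_apply, comul_gz_mul, key, rightForm_apply,
    HopfAlgebra.mul_antipode_lTensor_comul_apply, Algebra.algebraMap_eq_smul_one, op_smul,
    smul_assoc, op_one, one_smul, smul_comm (op (gz q (-s))) (Coalgebra.counit (R := K) v)]

/-- The same rule for a = X. On M all terms vanish, which is why M is a left ideal. -/
theorem rightForm_X_mul (v : QB K q) : C.rightForm (X q * v) =
    X q • C.rightForm v - op (X q) • gz q 1 • op (gz q (-1)) • C.rightForm v +
      Coalgebra.counit (R := K) v • (C.d (X q) - op (X q) • op (gz q (-1)) • C.d (gz q 1)) := by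
  have key : ∀ t : QB K q ⊗[K] QB K q,
      C.preRightForm ((X q ⊗ₜ 1 + gz q 1 ⊗ₜ X q) * t) =
      X q • C.preRightForm t - op (X q) • gz q 1 • op (gz q (-1)) • C.preRightForm t +
      (op (LinearMap.mul' K _ ((HopfAlgebra.antipode K).lTensor _ t)) • C.d (X q) -
        op (X q) • op (gz q (-1)) •
          op (LinearMap.mul' K _ ((HopfAlgebra.antipode K).lTensor _ t)) • C.d (gz q 1)) := by
    intro t
    induction t with
    | zero => simp
    | add x y hx hy => simp only [mul_add, map_add, smul_add, op_add, add_smul, hx, hy]; abel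
    | tmul a b =>
      rw [add_mul, Algebra.TensorProduct.tmul_mul_tmul, Algebra.TensorProduct.tmul_mul_tmul,
        one_mul, map_add, preRightForm_tmul, preRightForm_tmul, preRightForm_tmul, antipode_mul,
        antipode_X, mul_neg, op_neg, neg_smul, op_mul, op_mul, mul_smul, mul_smul, C.leibniz,
        C.leibniz, LinearMap.lTensor_tmul, LinearMap.mul'_apply, op_mul, mul_smul, mul_smul]
      simp only [smul_add, smul_comm (gz q 1), smul_comm (X q)]
      abel
  rw [rightForm_apply, comul_X_mul, key, rightForm_apply,
    HopfAlgebra.mul_antipode_lTensor_comul_apply, Algebra.algebraMap_eq_smul_one, op_smul]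
  simp only [smul_assoc, op_one, one_smul, smul_sub]
  simp only [smul_comm _ (Coalgebra.counit (R := K) v)]

/-- The recursions for ω(g^s v) and ω(Xv) reduce invariance to that of ω(v) and to the known
coactions of dg and dX. -/
theorem rightForm_mem_rightInvariants (v : QB K q) : C.rightForm v ∈ C.rightInvariants := by
  rw [mem_rightInvariants]
  have hg : ∀ s : ℤ, ∀ v : QB K q, C.coactR (C.rightForm v) = C.rightForm v ⊗ₜ 1 →
      C.coactR (C.rightForm (gz q s * v)) = C.rightForm (gz q s * v) ⊗ₜ 1 := by
    intro s v hv
    rw [rightForm_gz_mul, map_add, map_smul C.coactR (Coalgebra.counit (R := K) v), coactR_smul,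
      coactR_op_smul, coactR_op_smul, hv, coactR_d, comul_gz, comul_gz]
    simp [← gz_add, TensorProduct.add_tmul, TensorProduct.smul_tmul']
  induction v using left_induction q with
  | h1 => simp [rightForm_one]
  | hadd a b ha hb => rw [map_add, map_add, ha, hb, TensorProduct.add_tmul]
  | hsmul k a ha => rw [map_smul, map_smul, ha, TensorProduct.smul_tmul']
  | hX v hv =>
    have h1 : op (gz q 1) • gz q 1 • op (gz q (-1)) • C.rightForm v = gz q 1 • C.rightForm v := by
      rw [op_smul_smul, smul_smul (op (gz q 1)), ← op_mul, ← gz_add]; simp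
    have h2 : op (gz q 1) • op (gz q (-1)) • C.d (gz q 1) = C.d (gz q 1) := by
      rw [smul_smul (op (gz q 1)), ← op_mul, ← gz_add]; simp
    rw [rightForm_X_mul, map_add, map_sub, map_smul C.coactR (Coalgebra.counit (R := K) v), map_sub]
    simp only [coactR_smul, coactR_op_smul, hv, coactR_d, comul_gz, comul_X, map_add,
      LinearMap.add_apply, BimoduleTensor.lactR_tmul, BimoduleTensor.ractR_tmul,
      LinearMap.rTensor_tmul, one_mul, mul_one,
      ← gz_add, add_neg_cancel, gz_zero, h1, h2, TensorProduct.add_tmul, TensorProduct.sub_tmul]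
    simp only [← TensorProduct.smul_tmul' (Coalgebra.counit (R := K) v), TensorProduct.sub_tmul,
      smul_sub, smul_add]
    abel
  | hg v hv => exact hg 1 v hv
  | hg' v hv => exact hg (-1) v hv

/-! ### The isomorphism `Γ ≅ Γ_inv ⊗ A` -/

/-- Multiplication by Δ(g^s) corresponds to left multiplication on Γ up to a multiple of d(g^s).
Read backwards, it expresses the left action through right multiplication and d; `formMul_X_mul`
does this for X. -/
theorem formMul_gz_mul (s : ℤ) (t : QB K q ⊗[K] QB K q) :
    C.formMul ((gz q s ⊗ₜ gz q s) * t) = gz q s • C.formMul t +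
      op (TensorProduct.lid K _ ((Coalgebra.counit (R := K)).rTensor _ t)) • C.d (gz q s) := by
  induction t with
  | zero => simp
  | add x y hx hy => simp only [mul_add, map_add, smul_add, op_add, add_smul, hx, hy]; abel
  | tmul v b =>
    rw [Algebra.TensorProduct.tmul_mul_tmul, formMul_tmul, formMul_tmul, rightForm_gz_mul, op_mul,
      mul_smul, smul_add, op_smul_smul, smul_comm (op (gz q s)) _ (_ • _),
      smul_smul (op (gz q s)), smul_smul (op (gz q s)), ← op_mul, ← gz_add]
    simp [smul_comm (op b) (Coalgebra.counit (R := K) v), op_smul_smul]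

theorem formMul_X_mul (t : QB K q ⊗[K] QB K q) :
    C.formMul ((X q ⊗ₜ 1 + gz q 1 ⊗ₜ X q) * t) = X q • C.formMul t +
      op (TensorProduct.lid K _ ((Coalgebra.counit (R := K)).rTensor _ t)) • C.d (X q) := by
  induction t with
  | zero => simp
  | add x y hx hy => simp only [mul_add, map_add, smul_add, op_add, add_smul, hx, hy]; abel
  | tmul v b =>
    rw [add_mul, Algebra.TensorProduct.tmul_mul_tmul, Algebra.TensorProduct.tmul_mul_tmul, map_add,
      formMul_tmul, formMul_tmul, formMul_tmul, rightForm_gz_mul, rightForm_X_mul, one_mul,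
      op_mul, mul_smul]
    simp only [smul_add, smul_sub, LinearMap.rTensor_tmul, TensorProduct.lid_tmul, op_smul,
      smul_assoc, smul_comm _ (Coalgebra.counit (R := K) v), ← op_smul_smul]
    abel

/-- The reconstruction formula da = ω(a₁)a₂. In the induction, the correction term of the two rules
above collapses by the counit axiom to the missing half of the Leibniz rule. -/
theorem formMul_comul (a : QB K q) : C.formMul (Coalgebra.comul (R := K) a) = C.d a := by
  induction a using left_induction q with
  | h1 =>
    rw [Bialgebra.comul_one, Algebra.TensorProduct.one_def, formMul_tmul, rightForm_one, d_one,
      smul_zero]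
  | hadd a b ha hb => rw [map_add, map_add, map_add, ha, hb]
  | hsmul k a ha => rw [map_smul, map_smul, map_smul, ha]
  | hX a ha =>
    rw [comul_X_mul, formMul_X_mul, ha, Coalgebra.rTensor_counit_comul, TensorProduct.lid_tmul,
      one_smul, C.leibniz, add_comm]
  | hg a ha =>
    rw [comul_gz_mul, formMul_gz_mul, ha, Coalgebra.rTensor_counit_comul, TensorProduct.lid_tmul,
      one_smul, C.leibniz, add_comm]
  | hg' a ha =>
    rw [comul_gz_mul, formMul_gz_mul, ha, Coalgebra.rTensor_counit_comul, TensorProduct.lid_tmul,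
      one_smul, C.leibniz, add_comm]

theorem formMul_mul_right (t : QB K q ⊗[K] QB K q) (a : QB K q) :
    C.formMul (t * (1 ⊗ₜ a)) = op a • C.formMul t := by
  induction t with
  | zero => simp
  | add x y hx hy => rw [add_mul, map_add, map_add, smul_add, hx, hy]
  | tmul v b =>
    rw [Algebra.TensorProduct.tmul_mul_tmul, formMul_tmul, formMul_tmul, mul_one, op_mul, mul_smul]

/-- The range is closed under right multiplication and contains dA; the rules for Δ(g^s) and ΔX then
give closure under left multiplication. -/
theorem formMul_surjective : Function.Surjective C.formMul := by
  have hr : ∀ (a : QB K q), ∀ x ∈ LinearMap.range C.formMul,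
      op a • x ∈ LinearMap.range C.formMul := by
    rintro a _ ⟨t, rfl⟩
    exact ⟨_, C.formMul_mul_right t a⟩
  have hd : ∀ a, C.d a ∈ LinearMap.range C.formMul := fun a => ⟨_, C.formMul_comul a⟩
  have hg : ∀ (s : ℤ), ∀ x ∈ LinearMap.range C.formMul,
      gz q s • x ∈ LinearMap.range C.formMul := by
    rintro s _ ⟨t, rfl⟩
    rw [← sub_eq_of_eq_add (C.formMul_gz_mul s t)]
    exact sub_mem ⟨_, rfl⟩ (hr _ _ (hd _))
  have hl : ∀ (a : QB K q), ∀ x ∈ LinearMap.range C.formMul,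
      a • x ∈ LinearMap.range C.formMul := by
    intro a
    refine mul_induction q (P := fun a => ∀ x ∈ LinearMap.range C.formMul,
      a • x ∈ LinearMap.range C.formMul) ?_ ?_ ?_ ?_ (hg 1) (hg (-1)) a
    · intro k x hx
      rw [algebraMap_smul]
      exact Submodule.smul_mem _ _ hx
    · intro a b ha hb x hx
      rw [add_smul]
      exact add_mem (ha x hx) (hb x hx)
    · intro a b ha hb x hx
      rw [mul_smul]
      exact ha _ (hb x hx)
    · rintro _ ⟨t, rfl⟩
      rw [← sub_eq_of_eq_add (C.formMul_X_mul t)]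
      exact sub_mem ⟨_, rfl⟩ (hr _ _ (hd _))
  intro x
  change x ∈ LinearMap.range C.formMul
  induction x using C.induction with
  | h a b => exact hl a _ (hd b)
  | hadd x y hx hy => exact add_mem hx hy

variable (K q) in
/-- The map `a ⊗ b ↦ a S(b₍₁₎) ⊗ b₍₂₎`. -/
noncomputable def untwist : QB K q ⊗[K] QB K q →ₗ[K] QB K q ⊗[K] QB K q :=
  (LinearMap.mul' K (QB K q)).rTensor _ ∘ₗ (TensorProduct.assoc K _ _ _).symm.toLinearMap ∘ₗ
    ((HopfAlgebra.antipode K).rTensor (QB K q) ∘ₗ Coalgebra.comul).lTensor _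

/-- This is a₁S(a₂) ⊗ a₃ = 1 ⊗ a, proved on generators. -/
theorem untwist_comul (a : QB K q) : untwist K q (Coalgebra.comul (R := K) a) = 1 ⊗ₜ a := by
  have h : ∀ (a b c : QB K q), (LinearMap.mul' K (QB K q)).rTensor (QB K q)
      ((TensorProduct.assoc K _ _ _).symm (a ⊗ₜ[K] (b ⊗ₜ[K] c))) = (a * b) ⊗ₜ c := by
    intro a b c; simp
  have hg : ∀ (s : ℤ) (t : QB K q ⊗[K] QB K q), untwist K q ((gz q s ⊗ₜ gz q s) * t) =
      TensorProduct.map (LinearMap.mulLeft K (gz q s) ∘ₗ LinearMap.mulRight K (gz q (-s)))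
        (LinearMap.mulLeft K (gz q s)) (untwist K q t) := by
    intro s t
    induction t with
    | zero => simp
    | add x y hx hy => simp only [mul_add, map_add, hx, hy]
    | tmul a b =>
      simp only [untwist, Algebra.TensorProduct.tmul_mul_tmul, LinearMap.comp_apply,
        LinearMap.lTensor_tmul, comul_gz_mul, LinearEquiv.coe_coe]
      induction Coalgebra.comul (R := K) b with
      | zero => simp
      | add x y hx hy => simp only [mul_add, map_add, TensorProduct.tmul_add, hx, hy]
      | tmul b c =>
        simp only [Algebra.TensorProduct.tmul_mul_tmul, LinearMap.rTensor_tmul, h, antipode_mul,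
          antipode_gz]
        simp [mul_assoc]
  have hX : ∀ (t : QB K q ⊗[K] QB K q), untwist K q ((X q ⊗ₜ 1 + gz q 1 ⊗ₜ X q) * t) =
      (X q ⊗ₜ 1) * untwist K q t - TensorProduct.map (LinearMap.mulLeft K (gz q 1) ∘ₗ
        LinearMap.mulRight K (gz q (-1) * X q)) LinearMap.id (untwist K q t) +
      TensorProduct.map (LinearMap.mulLeft K (gz q 1) ∘ₗ LinearMap.mulRight K (gz q (-1)))
        (LinearMap.mulLeft K (X q)) (untwist K q t) := by
    intro t
    induction t with
    | zero => simp
    | add x y hx hy => simp only [mul_add, map_add, hx, hy]; abel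
    | tmul a b =>
      simp only [untwist, add_mul, Algebra.TensorProduct.tmul_mul_tmul, LinearMap.comp_apply,
        map_add, LinearMap.lTensor_tmul, comul_X_mul, LinearEquiv.coe_coe, one_mul]
      induction Coalgebra.comul (R := K) b with
      | zero => simp
      | add x y hx hy =>
        simp only [mul_add, map_add, TensorProduct.tmul_add] at hx hy ⊢
        have := congrArg₂ (· + ·) hx hy
        convert this using 1 <;> abel
      | tmul b c =>
        simp only [Algebra.TensorProduct.tmul_mul_tmul, LinearMap.rTensor_tmul, h,
          antipode_mul, antipode_gz, map_add, TensorProduct.tmul_add, antipode_X]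
        simp [mul_assoc, TensorProduct.neg_tmul]
        abel
  induction a using left_induction q with
  | h1 => simp [untwist, Algebra.TensorProduct.one_def]
  | hadd a b ha hb => rw [map_add, map_add, ha, hb, TensorProduct.tmul_add]
  | hsmul k a ha => rw [map_smul, map_smul, ha, TensorProduct.tmul_smul]
  | hX a ha =>
    rw [comul_X_mul, hX, ha]
    simp [← mul_assoc, ← gz_add]
  | hg a ha =>
    rw [comul_gz_mul, hg, ha]
    simp [← gz_add]
  | hg' a ha =>
    rw [comul_gz_mul, hg, ha]
    simp [← gz_add]

/-- The inverse of `ω ⊗ b ↦ ω b`. -/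
noncomputable def split : C.Γ →ₗ[K] C.Γ ⊗[K] QB K q :=
  (TensorProduct.lift C.ract.flip).rTensor _ ∘ₗ (TensorProduct.assoc K _ _ _).symm.toLinearMap ∘ₗ
    ((HopfAlgebra.antipode K).rTensor (QB K q) ∘ₗ Coalgebra.comul).lTensor _ ∘ₗ C.coactR

/-- For invariant x the right coaction sends xb to xb₁ ⊗ b₂, and then xb₁S(b₂) ⊗ b₃ = x ⊗ b. -/
theorem split_op_smul {x : C.Γ} (hx : x ∈ C.rightInvariants) (b : QB K q) :
    C.split (op b • x) = x ⊗ₜ b := by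
  have key : ∀ t : QB K q ⊗[K] QB K q, (TensorProduct.lift C.ract.flip).rTensor (QB K q)
      ((TensorProduct.assoc K _ _ _).symm (((HopfAlgebra.antipode K).rTensor (QB K q) ∘ₗ
        Coalgebra.comul).lTensor _ (C.ractR t (x ⊗ₜ 1)))) =
      (C.ract.flip x).rTensor (QB K q) (untwist K q t) := by
    intro t
    induction t with
    | zero => simp
    | add s t hs ht => simp only [map_add, LinearMap.add_apply, hs, ht]
    | tmul a b =>
      simp only [untwist, LinearMap.comp_apply, BimoduleTensor.ractR_tmul, one_mul,
        LinearMap.lTensor_tmul, LinearEquiv.coe_coe]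
      induction Coalgebra.comul (R := K) b with
      | zero => simp
      | add s t hs ht => simp only [map_add, TensorProduct.tmul_add, hs, ht]
      | tmul b c => simp [smul_smul]
  have h : C.split (op b • x) = (C.ract.flip x).rTensor (QB K q)
      (untwist K q (Coalgebra.comul (R := K) b)) := by
    rw [← key, ← (C.mem_rightInvariants).1 hx, ← coactR_op_smul]
    rfl
  rw [h, untwist_comul]
  simp

theorem split_formMul (t : QB K q ⊗[K] QB K q) :
    C.split (C.formMul t) = C.rightForm.rTensor _ t := by
  induction t with
  | zero => simp
  | add s t hs ht => simp only [map_add, hs, ht]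
  | tmul v b =>
    rw [formMul_tmul, split_op_smul _ (C.rightForm_mem_rightInvariants v), LinearMap.rTensor_tmul]

/-- Write an invariant form as a sum of terms ω(v)b; splitting it in two ways and applying id ⊗ ε
gives it as the sum of the ω(v)ε(b). -/
theorem rightInvariants_eq_range : C.rightInvariants = LinearMap.range C.rightForm := by
  refine le_antisymm ?_ ?_
  · intro x hx
    obtain ⟨t, rfl⟩ := C.formMul_surjective x
    have h1 := C.split_op_smul hx 1
    rw [op_one, one_smul, split_formMul] at h1
    have h2 := congrArg (fun y => TensorProduct.rid K C.Γ
      ((Coalgebra.counit (R := K)).lTensor C.Γ y)) h1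
    simp only [LinearMap.lTensor_tmul, TensorProduct.rid_tmul, Bialgebra.counit_one, one_smul] at h2
    rw [← h2]
    refine ⟨TensorProduct.rid K _ ((Coalgebra.counit (R := K)).lTensor _ t), ?_⟩
    generalize t = t
    induction t with
    | zero => simp
    | add s t hs ht => simp only [map_add, hs, ht]
    | tmul v b => simp
  · rintro _ ⟨v, rfl⟩
    exact C.rightForm_mem_rightInvariants v

/-! ### Morphisms -/

variable {C} in
-- The morphism sends ω_C(v)b to ω_D(v)b, which is well defined because `split` separates the two
-- factors. Right linearity is then clear, and left linearity comes from `formMul_gz_mul` and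
-- `formMul_X_mul`, valid in both calculi.
theorem exists_isMorphism {D : BicovariantCalculus.{u, u, w'} K (QB K q)}
    (h : C.crossedSubmodule ≤ D.crossedSubmodule) : ∃ f, IsMorphism C D f := by
  -- The map ω_C(v) ↦ ω_D(v) is well defined on the range of ω_C by `ker_rightForm_le`; its linear
  -- extension to all of Γ is arbitrary.
  obtain ⟨k, hk⟩ : ∃ k : C.Γ →ₗ[K] D.Γ, k ∘ₗ C.rightForm = D.rightForm := by
    obtain ⟨s, hs⟩ := C.rightForm.rangeRestrict.exists_rightInverse_of_surjective
      C.rightForm.range_rangeRestrict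
    obtain ⟨k, hk⟩ := (D.rightForm ∘ₗ s).exists_extend
    refine ⟨k, LinearMap.ext fun v => ?_⟩
    have h1 : k (C.rightForm v) = D.rightForm (s (C.rightForm.rangeRestrict v)) :=
      congrArg (fun f => f (C.rightForm.rangeRestrict v)) hk
    have h2 : C.rightForm (s (C.rightForm.rangeRestrict v)) = C.rightForm v :=
      congrArg Subtype.val (congrArg (fun f => f (C.rightForm.rangeRestrict v)) hs)
    rw [LinearMap.comp_apply, h1, ← sub_eq_zero, ← map_sub]
    exact ker_rightForm_le h (by rw [LinearMap.mem_ker, map_sub, h2, sub_self])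
  let f : C.Γ →ₗ[K] D.Γ := TensorProduct.lift D.ract.flip ∘ₗ k.rTensor _ ∘ₗ C.split
  have hf : ∀ t, f (C.formMul t) = D.formMul t := by
    intro t
    simp only [f, LinearMap.comp_apply, split_formMul]
    rw [← LinearMap.comp_apply (k.rTensor _), ← LinearMap.rTensor_comp, hk]
    induction t with
    | zero => simp
    | add s t hs ht => simp only [map_add, hs, ht]
    | tmul v b => rfl
  have hd : ∀ a, f (C.d a) = D.d a := fun a => by rw [← formMul_comul, hf, formMul_comul]
  have hr : ∀ (a : QB K q) (x : C.Γ), f (op a • x) = op a • f x := by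
    intro a x
    obtain ⟨t, rfl⟩ := C.formMul_surjective x
    rw [← formMul_mul_right, hf, hf, formMul_mul_right]
  have hg : ∀ (s : ℤ) (x : C.Γ), f (gz q s • x) = gz q s • f x := by
    intro s x
    obtain ⟨t, rfl⟩ := C.formMul_surjective x
    rw [← sub_eq_of_eq_add (C.formMul_gz_mul s t), map_sub, hr, hd, hf, hf,
      sub_eq_of_eq_add (D.formMul_gz_mul s t)]
  have hl : ∀ (a : QB K q) (x : C.Γ), f (a • x) = a • f x := by
    intro a
    refine mul_induction q (P := fun a => ∀ x : C.Γ, f (a • x) = a • f x) ?_ ?_ ?_ ?_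
      (hg 1) (hg (-1)) a
    · intro k x
      rw [algebraMap_smul, algebraMap_smul, map_smul]
    · intro a b ha hb x
      rw [add_smul, add_smul, map_add, ha, hb]
    · intro a b ha hb x
      rw [mul_smul, mul_smul, ha, hb]
    · intro x
      obtain ⟨t, rfl⟩ := C.formMul_surjective x
      rw [← sub_eq_of_eq_add (C.formMul_X_mul t), map_sub, hr, hd, hf, hf,
        sub_eq_of_eq_add (D.formMul_X_mul t)]
  exact ⟨{ f with map_smul' := hl }, hr, hd⟩

variable {C} in
theorem isomorphic_of_crossedSubmodule_eq {D : BicovariantCalculus.{u, u, w'} K (QB K q)}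
    (h : C.crossedSubmodule = D.crossedSubmodule) : C.Isomorphic D := by
  obtain ⟨f, hf⟩ := exists_isMorphism h.le
  obtain ⟨f', hf'⟩ := exists_isMorphism h.ge
  exact ⟨LinearEquiv.ofLinearMap f f' (hf.comp hf') (hf'.comp hf), hf⟩

variable {C} in
theorem Isomorphic.crossedSubmodule_eq {D : BicovariantCalculus.{u, u, w'} K (QB K q)}
    (h : C.Isomorphic D) : C.crossedSubmodule = D.crossedSubmodule := by
  obtain ⟨e, he⟩ := h
  ext v
  have h1 : e (C.rightForm v) = D.rightForm v := he.rightForm v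
  simp only [crossedSubmodule, Submodule.mem_inf, LinearMap.mem_ker, ← h1,
    EmbeddingLike.map_eq_zero_iff]

end QB
end BicovariantCalculus

/-! ### The transpose of ad X, and annihilators of tangent spaces. -/

namespace QB

section Annihilators
variable {K : Type u} [Field K] {q : Kˣ}

variable (q) in
/-- The operator on `C_q(B₊)` dual to the adjoint action of `X`. -/
noncomputable def coadX : QB K q →ₗ[K] QB K q :=
  (basis q).constr K fun p => pInt q p.1 • ((1 - gz q 1) * mono q (p.1 - 1, p.2))

theorem coadX_mono (n : ℕ) (m : ℤ) : coadX q (mono q (n, m)) =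
    pInt q n • ((1 - gz q 1) * mono q (n - 1, m)) := by
  rw [← basis_apply, coadX, Module.Basis.constr_basis]

theorem pInt_zero : pInt q 0 = 0 := by simp [pInt, qInt]

theorem coadX_one : coadX q 1 = 0 := by
  rw [← mono_zero_zero, coadX_mono, pInt_zero, zero_smul]

theorem counit_coadX (v : QB K q) : Coalgebra.counit (R := K) (coadX q v) = 0 := by
  have : Coalgebra.counit (R := K) ∘ₗ coadX q = 0 := by
    refine linearMap_ext q fun n m => ?_
    simp [coadX_mono]
  exact congrArg (fun f => f v) this

/-- With `coadX_X_mul` these are the twisted Leibniz rules that will match the recursion of the left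
coaction on ω. -/
theorem coadX_gz_mul (s : ℤ) (v : QB K q) :
    coadX q (gz q s * v) = qz q (-s) • (gz q s * coadX q v) := by
  have : coadX q ∘ₗ LinearMap.mulLeft K (gz q s) =
      qz q (-s) • LinearMap.mulLeft K (gz q s) ∘ₗ coadX q := by
    refine linearMap_ext q fun n m => ?_
    simp only [LinearMap.comp_apply, LinearMap.smul_apply, LinearMap.mulLeft_apply, gz_mul_mono,
      map_smul, coadX_mono]
    rcases n with _ | n
    · simp [pInt_zero]
    · have h : gz q s * (1 - gz q 1) = (1 - gz q 1) * gz q s := by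
        rw [mul_sub, sub_mul, ← gz_add, ← gz_add, add_comm, mul_one, one_mul]
      rw [← mul_assoc, h, mul_assoc, Nat.add_sub_cancel, gz_mul_mono, mul_smul_comm,
        smul_comm (pInt q (n + 1)) (qz q (-(s * n))), smul_smul (qz q (-s)), ← qz_add]
      congr 2; push_cast; ring
  exact congrArg (fun f => f v) this

theorem degScale_gz_mul (s : ℤ) (v : QB K q) :
    degScale q (gz q s * v) = gz q s * degScale q v := by
  have : degScale q ∘ₗ LinearMap.mulLeft K (gz q s) =
      LinearMap.mulLeft K (gz q s) ∘ₗ degScale q := by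
    refine linearMap_ext q fun n m => ?_
    simp only [LinearMap.comp_apply, LinearMap.mulLeft_apply, gz_mul_mono,
      map_smul, degScale_mono]
    rw [smul_comm]
  exact congrArg (fun f => f v) this

theorem degScale_X_mul (v : QB K q) :
    degScale q (X q * v) = qz q (-1) • (X q * degScale q v) := by
  have : degScale q ∘ₗ LinearMap.mulLeft K (X q) =
      qz q (-1) • LinearMap.mulLeft K (X q) ∘ₗ degScale q := by
    refine linearMap_ext q fun n m => ?_
    simp only [LinearMap.comp_apply, LinearMap.smul_apply, LinearMap.mulLeft_apply, X_mul_mono,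
      map_smul, degScale_mono, smul_smul, ← qz_add]
    congr 2; push_cast; ring
  exact congrArg (fun f => f v) this

theorem pInt_succ (n : ℕ) : pInt q (n + 1) = 1 + qz q (-1) * pInt q n := qInt_succ' _ _

theorem pInt_succ' (n : ℕ) : pInt q (n + 1) = pInt q n + qz q (-(n : ℤ)) := by
  rw [pInt, qInt_succ, ← pInt, qz_neg_natCast, inv_eq_qz]

theorem coadX_X_mul (v : QB K q) :
    coadX q (X q * v) = v - gz q 1 * degScale q v + qz q (-1) • (X q * coadX q v) := by
  have : coadX q ∘ₗ LinearMap.mulLeft K (X q) = LinearMap.id -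
      LinearMap.mulLeft K (gz q 1) ∘ₗ degScale q +
      qz q (-1) • LinearMap.mulLeft K (X q) ∘ₗ coadX q := by
    refine linearMap_ext q fun n m => ?_
    simp only [LinearMap.comp_apply, LinearMap.smul_apply, LinearMap.mulLeft_apply, X_mul_mono,
      map_smul, degScale_mono, coadX_mono, LinearMap.add_apply, LinearMap.sub_apply,
      LinearMap.id_apply, Nat.add_sub_cancel]
    rcases n with _ | n
    · simp [pInt_succ, pInt_zero, sub_mul]
    · have h1 : X q * ((1 - gz q 1) * mono q (n, m)) =
          mono q (n + 1, m) - qz q 1 • (gz q 1 * mono q (n + 1, m)) := by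
        rw [sub_mul, one_mul, mul_sub, X_mul_mono, ← mul_assoc, X_mul_gz, smul_mul_assoc,
          mul_assoc, X_mul_mono]
      have h2 : pInt q (n + 1 + 1) • ((1 - gz q 1) * mono q (n + 1, m)) =
          (1 + qz q (-1) * pInt q (n + 1)) • mono q (n + 1, m) -
          (pInt q (n + 1) + qz q (-((n + 1 : ℕ) : ℤ))) • (gz q 1 * mono q (n + 1, m)) := by
        rw [← pInt_succ, ← pInt_succ', sub_mul, one_mul, smul_sub]
      have h3 : qz q (-1) * qz q 1 = 1 := qz_neg_mul q 1
      rw [h2, Nat.add_sub_cancel, h1, smul_sub, smul_sub, smul_comm (pInt q (n + 1)) (qz q 1),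
        smul_smul (qz q (-1)) (qz q 1), h3]
      module
  exact congrArg (fun f => f v) this

theorem pairing_adX (x v : QB K q) :
    pairing q (adX q x) v = pairing q x (coadX q v) := by
  have : pairing q ∘ₗ adX q = (LinearMap.lcomp K K (coadX q)) ∘ₗ pairing q := by
    refine linearMap_ext q fun n m => linearMap_ext q fun r s => ?_
    simp only [LinearMap.comp_apply, LinearMap.lcomp_apply, adX_mono, map_smul,
      LinearMap.smul_apply, coadX_mono, smul_eq_mul]
    rcases r with _ | r
    · simp [pInt_zero, pairing_mono]
    · rw [sub_mul (1 : QB K q), one_mul, map_sub, pairing_gz_mul, Nat.add_sub_cancel,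
        pairing_mono, pairing_mono]
      simp only [add_left_inj, normX_succ]
      split_ifs with h
      · subst h
        rw [mul_one]; ring
      · simp
  exact congrArg (fun f => f x v) this

/-- A functional vanishing on the annihilator of a finite dimensional subspace `Λ` is represented
by an element of `Λ`. -/
theorem exists_pairing_eq {Λ : Submodule K (QB K q)} [FiniteDimensional K Λ]
    (f : QB K q →ₗ[K] K) (hf : ∀ v, (∀ x ∈ Λ, pairing q x v = 0) → f v = 0) :
    ∃ x ∈ Λ, pairing q x = f := by
  have h := Subspace.dualCoannihilator_dualAnnihilator_eq (W := Λ.map (pairing q))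
  have h1 : f ∈ (Λ.map (pairing q)).dualCoannihilator.dualAnnihilator := by
    rw [Submodule.mem_dualAnnihilator]
    intro v hv
    rw [Submodule.mem_dualCoannihilator] at hv
    exact hf v fun x hx => hv _ ⟨x, hx, rfl⟩
  rw [h] at h1
  exact h1

variable (q) in
/-- The annihilator in `ker ε` of the tangent space `L_I`. -/
noncomputable def perp (I : CalcIndex) : Submodule K (QB K q) :=
  LinearMap.ker (Coalgebra.counit (R := K) (A := QB K q)) ⊓
    ⨅ x ∈ tangent q I, LinearMap.ker (pairing q x)

theorem mem_perp {I : CalcIndex} {v : QB K q} : v ∈ perp q I ↔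
    Coalgebra.counit (R := K) v = 0 ∧ ∀ x ∈ tangent q I, pairing q x v = 0 := by
  simp [perp]

theorem mem_tangent_of_perp (hq : ∀ n : ℕ, 0 < n → q ^ n ≠ 1) {I : CalcIndex} {x : QB K q}
    (hx : Coalgebra.counit (R := K) x = 0) (h : ∀ v ∈ perp q I, pairing q x v = 0) :
    x ∈ tangent q I := by
  -- Since ⟨1, ·⟩ = ε, annihilating inside ker ε is the same as annihilating L_I + K·1; the extra
  -- scalar is removed afterwards by applying ε.
  obtain ⟨y, hy, hxy⟩ := exists_pairing_eq (Λ := tangent q I ⊔ Submodule.span K {1})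
    (pairing q x) fun v hv => h v (mem_perp.2 ⟨by
      rw [← pairing_one]
      exact hv 1 (Submodule.mem_sup_right (Submodule.mem_span_singleton_self 1)),
      fun y hy => hv y (Submodule.mem_sup_left hy)⟩)
  obtain rfl := pairing_injective hq hxy
  obtain ⟨l, hl, k, hk, rfl⟩ := Submodule.mem_sup.1 hy
  obtain ⟨k, rfl⟩ := Submodule.mem_span_singleton.1 hk
  have : k = 0 := by simpa [counit_tangent l hl] using hx
  simpa [this] using hl

end Annihilators
end QB

/-! ### The left coaction on right invariant forms. -/

namespace BicovariantCalculus
open QB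

section Coaction
variable {K : Type u} [Field K] {q : Kˣ} (C : BicovariantCalculus.{u, u, w} K (QB K q))

theorem mem_crossedSubmodule {v : QB K q} : v ∈ C.crossedSubmodule ↔
    Coalgebra.counit (R := K) v = 0 ∧ C.rightForm v = 0 := Iff.rfl

theorem mem_tangentSpace {x : QB K q} : x ∈ C.tangentSpace (pairing q) ↔
    Coalgebra.counit (R := K) x = 0 ∧ ∀ v ∈ C.crossedSubmodule, pairing q x v = 0 := by
  simp [tangentSpace]

theorem tangentSpace_eq_tangent (hq : ∀ n : ℕ, 0 < n → q ^ n ≠ 1) {I : CalcIndex}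
    (h : C.crossedSubmodule = perp q I) : C.tangentSpace (pairing q) = tangent q I := by
  ext x
  rw [mem_tangentSpace, h]
  exact ⟨fun hx => mem_tangent_of_perp hq hx.1 hx.2,
    fun hx => ⟨counit_tangent x hx, fun v hv => (mem_perp.1 hv).2 x hx⟩⟩

/-- The action on forms of a functional through the left coaction. -/
noncomputable def actL (f : QB K q →ₗ[K] K) : C.Γ →ₗ[K] C.Γ :=
  (TensorProduct.lid K C.Γ).toLinearMap ∘ₗ f.rTensor C.Γ ∘ₗ C.coactL

theorem actL_gz_smul (f : QB K q →ₗ[K] K) (s : ℤ) (x : C.Γ) :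
    C.actL f (gz q s • x) = gz q s • C.actL (f ∘ₗ LinearMap.mulLeft K (gz q s)) x := by
  simp only [actL, LinearMap.comp_apply, coactL_smul, comul_gz]
  induction C.coactL x with
  | zero => simp
  | add x y hx hy => simp only [map_add, smul_add, hx, hy]
  | tmul a y => simp [smul_comm (f (gz q s * a))]

theorem actL_X_smul (f : QB K q →ₗ[K] K) (x : C.Γ) :
    C.actL f (X q • x) = C.actL (f ∘ₗ LinearMap.mulLeft K (X q)) x +
      X q • C.actL (f ∘ₗ LinearMap.mulLeft K (gz q 1)) x := by
  simp only [actL, LinearMap.comp_apply, coactL_smul, comul_X]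
  induction C.coactL x with
  | zero => simp
  | add x y hx hy =>
    simp only [map_add, smul_add, LinearMap.add_apply] at hx hy ⊢
    have := congrArg₂ (· + ·) hx hy
    convert this using 1; abel
  | tmul a y => simp [smul_comm (f (gz q 1 * a))]

theorem actL_op_gz_smul (f : QB K q →ₗ[K] K) (s : ℤ) (x : C.Γ) :
    C.actL f (op (gz q s) • x) = op (gz q s) • C.actL (f ∘ₗ LinearMap.mulRight K (gz q s)) x := by
  simp only [actL, LinearMap.comp_apply, coactL_op_smul, comul_gz]
  induction C.coactL x with
  | zero => simp
  | add x y hx hy => simp only [map_add, smul_add, hx, hy]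
  | tmul a y => simp [smul_comm (f (a * gz q s))]

theorem actL_op_X_smul (f : QB K q →ₗ[K] K) (x : C.Γ) :
    C.actL f (op (X q) • x) = C.actL (f ∘ₗ LinearMap.mulRight K (X q)) x +
      op (X q) • C.actL (f ∘ₗ LinearMap.mulRight K (gz q 1)) x := by
  simp only [actL, LinearMap.comp_apply, coactL_op_smul, comul_X]
  induction C.coactL x with
  | zero => simp
  | add x y hx hy =>
    simp only [map_add, smul_add, LinearMap.add_apply] at hx hy ⊢
    have := congrArg₂ (· + ·) hx hy
    convert this using 1; abel
  | tmul a y => simp [smul_comm (f (a * gz q 1))]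

theorem actL_smul_left (k : K) (f : QB K q →ₗ[K] K) (x : C.Γ) :
    C.actL (k • f) x = k • C.actL f x := by
  simp [actL, LinearMap.rTensor_smul]

theorem actL_zero_left (x : C.Γ) : C.actL 0 x = 0 := by
  simp [actL]

theorem actL_d (f : QB K q →ₗ[K] K) (a : QB K q) : C.actL f (C.d a) =
    C.d (TensorProduct.lid K _ (f.rTensor _ (Coalgebra.comul (R := K) a))) := by
  simp only [actL, LinearMap.comp_apply, coactL_d]
  induction Coalgebra.comul (R := K) a with
  | zero => simp
  | add x y hx hy => simp only [map_add, hx, hy]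
  | tmul a y => simp

/-- Counitality of the left coaction is not among the axioms of a calculus; it follows from the
prescribed values on a db. -/
theorem actL_counit (x : C.Γ) : C.actL (Coalgebra.counit (R := K)) x = x := by
  induction x using C.induction with
  | hadd x y hx hy => rw [map_add, hx, hy]
  | h a b =>
    have key : ∀ (t : QB K q ⊗[K] QB K q) (y : QB K q ⊗[K] C.Γ),
        TensorProduct.lid K C.Γ ((Coalgebra.counit (R := K)).rTensor C.Γ (C.lactL t y)) =
        TensorProduct.lid K _ ((Coalgebra.counit (R := K)).rTensor (QB K q) t) •
          TensorProduct.lid K C.Γ ((Coalgebra.counit (R := K)).rTensor C.Γ y) := by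
      intro t y
      induction t with
      | zero => simp
      | add s t hs ht => simp only [map_add, LinearMap.add_apply, add_smul, hs, ht]
      | tmul a b =>
        induction y with
        | zero => simp
        | add s t hs ht => simp only [map_add, smul_add, hs, ht]
        | tmul c y =>
          simp [mul_smul, smul_comm b (Coalgebra.counit (R := K) c)]
    rw [actL, LinearMap.comp_apply, LinearMap.comp_apply, coactL_smul]
    change TensorProduct.lid K C.Γ _ = _
    rw [key, Coalgebra.rTensor_counit_comul]
    have h := C.actL_d (Coalgebra.counit (R := K)) b
    rw [Coalgebra.rTensor_counit_comul, actL, LinearMap.comp_apply, LinearMap.comp_apply] at h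
    change TensorProduct.lid K C.Γ _ = _ at h
    rw [h]
    simp

theorem pairing_comp_mulLeft_gz (i : ℕ) (m s : ℤ) :
    pairing q (mono q (i, m)) ∘ₗ LinearMap.mulLeft K (gz q s) =
      qz q (-((i + m) * s)) • pairing q (mono q (i, m)) :=
  LinearMap.ext fun a => pairing_gz_mul q i m s a

theorem pairing_comp_mulRight_gz (i : ℕ) (m s : ℤ) :
    pairing q (mono q (i, m)) ∘ₗ LinearMap.mulRight K (gz q s) =
      qz q (-(m * s)) • pairing q (mono q (i, m)) := by
  refine linearMap_ext q fun r t => ?_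
  simp only [LinearMap.comp_apply, LinearMap.mulRight_apply, LinearMap.smul_apply, mono_mul_gz,
    pairing_mono, smul_eq_mul]
  split_ifs
  · rw [mul_left_comm, ← qz_add]; congr 2; ring
  · simp

theorem pairing_g_comp_mulRight_X :
    pairing q (mono q (0, 1)) ∘ₗ LinearMap.mulRight K (X q) = 0 := by
  refine linearMap_ext q fun r t => ?_
  simp [mono_mul_X, pairing_mono]

/-- From ΔX = X ⊗ 1 + g ⊗ X: ⟨X, aX⟩ = ⟨X, a⟩⟨1, X⟩ + ⟨g, a⟩⟨X, X⟩, where ⟨1, X⟩ = 0 and ⟨X, X⟩ = 1.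
-/
theorem pairing_X_comp_mulRight_X :
    pairing q (mono q (1, 0)) ∘ₗ LinearMap.mulRight K (X q) = pairing q (mono q (0, 1)) := by
  refine linearMap_ext q fun r t => ?_
  simp only [LinearMap.comp_apply, LinearMap.mulRight_apply, mono_mul_X, map_smul, pairing_mono,
    smul_eq_mul]
  rcases r with _ | r
  · simp [normX, qFactorial, qInt]
  · simp

theorem pairing_g_comp_mulLeft_X :
    pairing q (mono q (0, 1)) ∘ₗ LinearMap.mulLeft K (X q) = 0 :=
  LinearMap.ext fun a => pairing_X_mul_zero q 1 a

theorem pairing_X_comp_mulLeft_X :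
    pairing q (mono q (1, 0)) ∘ₗ LinearMap.mulLeft K (X q) = Coalgebra.counit (R := K) := by
  refine LinearMap.ext fun a => ?_
  have := pairing_X_mul_succ q 0 0 a
  rw [pInt_succ, pInt_zero, mono_zero_zero, pairing_one] at this
  simpa using this

/-- The action of `g` on forms through the left coaction. -/
noncomputable def actG : C.Γ →ₗ[K] C.Γ := C.actL (pairing q (mono q (0, 1)))

/-- The action of `X` on forms through the left coaction. -/
noncomputable def actX : C.Γ →ₗ[K] C.Γ := C.actL (pairing q (mono q (1, 0)))

theorem actG_gz_smul (s : ℤ) (x : C.Γ) :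
    C.actG (gz q s • x) = qz q (-s) • gz q s • C.actG x := by
  rw [actG, actL_gz_smul, pairing_comp_mulLeft_gz, actL_smul_left, smul_comm (gz q s) (qz q _)]
  simp

theorem actG_op_gz_smul (s : ℤ) (x : C.Γ) :
    C.actG (op (gz q s) • x) = qz q (-s) • op (gz q s) • C.actG x := by
  rw [actG, actL_op_gz_smul, pairing_comp_mulRight_gz, actL_smul_left,
    smul_comm (op (gz q s)) (qz q _), one_mul]

theorem actG_X_smul (x : C.Γ) : C.actG (X q • x) = qz q (-1) • X q • C.actG x := by
  rw [actG, actL_X_smul, pairing_comp_mulLeft_gz, pairing_g_comp_mulLeft_X, actL_smul_left,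
    actL_zero_left, smul_comm (X q) (qz q _)]
  simp

theorem actG_op_X_smul (x : C.Γ) : C.actG (op (X q) • x) = qz q (-1) • op (X q) • C.actG x := by
  rw [actG, actL_op_X_smul, pairing_comp_mulRight_gz, pairing_g_comp_mulRight_X, actL_smul_left,
    actL_zero_left, smul_comm (op (X q)) (qz q _), zero_add, one_mul]

theorem actG_d_gz (s : ℤ) : C.actG (C.d (gz q s)) = qz q (-s) • C.d (gz q s) := by
  rw [actG, actL_d, ← braidedDerivation_apply, braidedDerivation_gz, if_pos rfl, map_smul, one_mul]

theorem actG_d_X : C.actG (C.d (X q)) = qz q (-1) • C.d (X q) := by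
  have h := braidedDerivation_mono_zero_mono q 1 1 0
  rw [show mono q (1, 0) = X q by simp [mono_def]] at h
  rw [actG, actL_d, ← braidedDerivation_apply, h, map_smul]
  simp

theorem actX_gz_smul (s : ℤ) (x : C.Γ) :
    C.actX (gz q s • x) = qz q (-s) • gz q s • C.actX x := by
  rw [actX, actL_gz_smul, pairing_comp_mulLeft_gz, actL_smul_left, smul_comm (gz q s) (qz q _)]
  simp

theorem actX_op_gz_smul (s : ℤ) (x : C.Γ) :
    C.actX (op (gz q s) • x) = op (gz q s) • C.actX x := by
  rw [actX, actL_op_gz_smul, pairing_comp_mulRight_gz, actL_smul_left]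
  simp

theorem actX_X_smul (x : C.Γ) : C.actX (X q • x) = x + qz q (-1) • X q • C.actX x := by
  rw [actX, actL_X_smul, pairing_comp_mulLeft_gz, pairing_X_comp_mulLeft_X, actL_smul_left,
    actL_counit, smul_comm (X q) (qz q _)]
  simp

theorem actX_op_X_smul (x : C.Γ) : C.actX (op (X q) • x) = C.actG x + op (X q) • C.actX x := by
  rw [actX, actL_op_X_smul, pairing_comp_mulRight_gz, pairing_X_comp_mulRight_X, actL_smul_left,
    actG]
  simp

theorem actX_d_gz (s : ℤ) : C.actX (C.d (gz q s)) = 0 := by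
  rw [actX, actL_d, ← braidedDerivation_apply, braidedDerivation_gz, if_neg one_ne_zero, map_zero]

theorem actX_d_X : C.actX (C.d (X q)) = 0 := by
  have h := braidedDerivation_mono_one_mono q 1 0
  rw [show mono q (1, 0) = X q by simp [mono_def], mono_zero_zero] at h
  rw [actX, actL_d, ← braidedDerivation_apply, show mono q (1, 0) = X q by simp [mono_def], h,
    map_smul, d_one, smul_zero]

/-- Conceptually the left coaction of ω(v) is v₁S(v₃) ⊗ ω(v₂), so evaluating its first leg at g
transposes ad g, which is self-adjoint. The proof compares recursions under left multiplication by
generators. -/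
theorem actG_rightForm (v : QB K q) : C.actG (C.rightForm v) = C.rightForm (degScale q v) := by
  have hc : ∀ (s : ℤ) (x : C.Γ), C.actG (gz q s • op (gz q (-s)) • x) =
      gz q s • op (gz q (-s)) • C.actG x := by
    intro s x
    rw [actG_gz_smul, actG_op_gz_smul, smul_comm (gz q s) (qz q _), smul_smul, neg_neg, qz_neg_mul,
      one_smul]
  have hd : ∀ (s : ℤ), C.actG (op (gz q (-s)) • C.d (gz q s)) = op (gz q (-s)) • C.d (gz q s) := by
    intro s
    rw [actG_op_gz_smul, actG_d_gz, smul_comm _ (qz q _), smul_smul, neg_neg, qz_mul_neg, one_smul]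
  have hg : ∀ s : ℤ, ∀ v, C.actG (C.rightForm v) = C.rightForm (degScale q v) →
      C.actG (C.rightForm (gz q s * v)) = C.rightForm (degScale q (gz q s * v)) := by
    intro s v hv
    rw [degScale_gz_mul, rightForm_gz_mul, rightForm_gz_mul, counit_degScale, map_add,
      map_smul _ (Coalgebra.counit (R := K) v), hc, hd, hv]
  induction v using left_induction q with
  | h1 => rw [degScale_one, rightForm_one, map_zero]
  | hadd a b ha hb => simp only [map_add, ha, hb]
  | hsmul k a ha => simp only [map_smul, ha]
  | hg v hv => exact hg 1 v hv
  | hg' v hv => exact hg (-1) v hv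
  | hX v hv =>
    rw [degScale_X_mul, map_smul, rightForm_X_mul, rightForm_X_mul, counit_degScale, map_add,
      map_sub, map_smul _ (Coalgebra.counit (R := K) v), map_sub, actG_X_smul, actG_op_X_smul,
      actG_op_X_smul, hc, hd, hv, actG_d_X]
    generalize X q • C.rightForm _ = y₁
    generalize op (X q) • gz q 1 • op (gz q (-1)) • C.rightForm _ = y₂
    generalize op (X q) • op (gz q (-1)) • C.d (gz q 1) = y₃
    module

/-- Evaluating the first leg at X transposes ad X in the same way; the term with `actG` reflects the
summand g ⊗ X of ΔX. -/
theorem actX_rightForm (v : QB K q) : C.actX (C.rightForm v) = C.rightForm (coadX q v) := by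
  have hc : ∀ (s : ℤ) (x : C.Γ), C.actX (gz q s • op (gz q (-s)) • x) =
      qz q (-s) • gz q s • op (gz q (-s)) • C.actX x := by
    intro s x
    rw [actX_gz_smul, actX_op_gz_smul]
  have hd : ∀ (s : ℤ), C.actX (op (gz q (-s)) • C.d (gz q s)) = 0 := by
    intro s
    rw [actX_op_gz_smul, actX_d_gz, smul_zero]
  have hg : ∀ s : ℤ, ∀ v, C.actX (C.rightForm v) = C.rightForm (coadX q v) →
      C.actX (C.rightForm (gz q s * v)) = C.rightForm (coadX q (gz q s * v)) := by
    intro s v hv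
    rw [coadX_gz_mul, map_smul, rightForm_gz_mul, rightForm_gz_mul, counit_coadX, map_add,
      map_smul _ (Coalgebra.counit (R := K) v), hc, hd, hv, smul_zero, zero_smul, add_zero,
      add_zero]
  induction v using left_induction q with
  | h1 => rw [coadX_one, rightForm_one, map_zero, map_zero]
  | hadd a b ha hb => simp only [map_add, ha, hb]
  | hsmul k a ha => simp only [map_smul, ha]
  | hg v hv => exact hg 1 v hv
  | hg' v hv => exact hg (-1) v hv
  | hX v hv =>
    have h1 : C.actG (gz q 1 • op (gz q (-1)) • C.rightForm v) =
        gz q 1 • op (gz q (-1)) • C.rightForm (degScale q v) := by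
      rw [actG_gz_smul, actG_op_gz_smul, smul_comm (gz q 1) (qz q _), smul_smul, neg_neg,
        qz_neg_mul, one_smul, actG_rightForm]
    have h2 : C.actG (op (gz q (-1)) • C.d (gz q 1)) = op (gz q (-1)) • C.d (gz q 1) := by
      rw [actG_op_gz_smul, actG_d_gz, smul_comm _ (qz q _), smul_smul, neg_neg, qz_mul_neg,
        one_smul]
    rw [coadX_X_mul, map_add, map_sub, map_smul, rightForm_X_mul, rightForm_X_mul,
      rightForm_gz_mul, counit_degScale, counit_coadX, map_add,
      map_sub, map_smul _ (Coalgebra.counit (R := K) v), map_sub, actX_X_smul, actX_op_X_smul,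
      actX_op_X_smul, hc, hd, hv, actX_d_X, h1, h2, smul_comm (op (X q)) (qz q (-1))]
    simp only [smul_zero, zero_smul, add_zero]
    -- What remains is linear over K in a few fixed vectors.
    generalize X q • C.rightForm _ = y₁
    generalize op (X q) • gz q 1 • op (gz q (-1)) • C.rightForm _ = y₂
    generalize op (gz q (-1)) • C.d (gz q 1) = y₃
    generalize gz q 1 • op (gz q (-1)) • C.rightForm _ = y₄
    module

end Coaction
end BicovariantCalculus

/-! ### Products of factors g - q^c and expansion into eigenvectors. -/

namespace QB

section Factors
variable {K : Type u} [Field K] {q : Kˣ}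

variable (q) in
/-- The product `(g - q ^ c) (g - q ^ (c + 1)) ⋯ (g - q ^ (c + r - 1))`. -/
noncomputable def gProd (c : ℕ) : ℕ → QB K q
  | 0 => 1
  | r + 1 => gProd c r * (gz q 1 - algebraMap K _ (qz q (c + r)))

/-- Splits off the lowest root instead of the highest. With c = 0 this absorbs the factor g - 1
produced by `coadX`. -/
theorem gProd_succ' (c r : ℕ) : gProd q c (r + 1) =
    gProd q (c + 1) r * (gz q 1 - algebraMap K _ (qz q c)) := by
  induction r with
  | zero => simp [gProd]
  | succ r ih =>
    have h : Commute (gz q 1 - algebraMap K (QB K q) (qz q c))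
        (gz q 1 - algebraMap K _ (qz q (((c + 1 : ℕ) : ℤ) + r))) :=
      ((Commute.refl (gz q 1)).sub_right
        (Algebra.commute_algebraMap_right _ _)).sub_left (Algebra.commute_algebraMap_left _ _)
    rw [gProd, ih, gProd, mul_assoc, mul_assoc, ← h.eq]
    congr 4
    push_cast; ring_nf

/-- Since `coadX` commutes with g up to q^{-1}, and q^{-1}g - q^c = q^{-1}(g - q^{c+1}), passing
through the product shifts every root by one. -/
theorem coadX_gProd_mul (c r : ℕ) (v : QB K q) :
    coadX q (gProd q c r * v) = qz q (-(r : ℤ)) • (gProd q (c + 1) r * coadX q v) := by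
  induction r generalizing v with
  | zero => simp [gProd]
  | succ r ih =>
    have h : qz q (c + r) = qz q (-1) * qz q (((c + 1 : ℕ) : ℤ) + r) := by
      rw [← qz_add]; congr 1; push_cast; ring
    rw [gProd, gProd, mul_assoc, ih, sub_mul, map_sub, coadX_gz_mul, ← Algebra.smul_def, map_smul,
      h, mul_smul, ← smul_sub, Algebra.smul_def (qz q (_ + _)), ← sub_mul, mul_smul_comm, smul_smul,
      ← qz_add, mul_assoc]
    congr 2; push_cast; ring

/-- A vector annihilated by `(g - 1) (g - q) ⋯ (g - q ^ (r - 1))` is a sum of eigenvectors. -/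
theorem exists_eigenvectors (hq : ∀ n : ℕ, 0 < n → q ^ n ≠ 1) {Q : Type*} [AddCommGroup Q]
    [Module K Q] [Module (QB K q) Q] [IsScalarTower K (QB K q) Q] (r : ℕ) (w : Q)
    (hw : gProd q 0 r • w = 0) :
    ∃ y : ℕ → Q, ∀ s : ℤ, gz q s • w = ∑ j ∈ Finset.range r, qz q (j * s) • y j := by
  induction r generalizing w with
  | zero =>
    have : w = 0 := by simpa [gProd] using hw
    exact ⟨0, fun s => by simp [this]⟩
  | succ r ih =>
    rw [gProd, mul_smul] at hw
    obtain ⟨y, hy⟩ := ih _ hw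
    -- The induction hypothesis expands (g - q^r)w; dividing the component of eigenvalue q^j by q^j
    -- - q^r solves for w up to an eigenvector of eigenvalue q^r.
    let z : ℕ → Q := fun j => (qz q j - qz q r)⁻¹ • y j
    let e : ℤ → Q := fun s => gz q s • w - ∑ j ∈ Finset.range r, qz q (j * s) • z j
    -- The remainder satisfies a first order recursion, so it is the new component `e 0` times
    -- q^{rs}, for negative s too.
    have he : ∀ s, e (s + 1) = qz q r • e s := by
      intro s
      have h1 := hy s
      have h2 : gz q s • (gz q 1 - algebraMap K (QB K q) (qz q (((0 : ℕ) : ℤ) + r))) • w =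
          gz q (s + 1) • w - qz q r • gz q s • w := by
        rw [sub_smul, smul_sub, smul_smul, ← gz_add, Nat.cast_zero, zero_add, smul_smul,
          ← Algebra.commutes, mul_smul, algebraMap_smul]
      have h3 : ∑ j ∈ Finset.range r, qz q (j * s) • y j =
          ∑ j ∈ Finset.range r, qz q (j * (s + 1)) • z j -
            qz q r • ∑ j ∈ Finset.range r, qz q (j * s) • z j := by
        rw [Finset.smul_sum, ← Finset.sum_sub_distrib]
        refine Finset.sum_congr rfl fun j hj => ?_
        have hne : qz q j - qz q r ≠ 0 := by
          rw [sub_ne_zero]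
          intro h
          have := qz_injective hq h
          have := Finset.mem_range.1 hj
          omega
        have hyz : y j = (qz q j - qz q r) • z j := by
          simp only [z]
          rw [smul_smul, mul_inv_cancel₀ hne, one_smul]
        clear_value z
        rw [hyz, smul_smul, smul_smul, ← sub_smul, mul_add, qz_add, mul_one]
        congr 1; ring
      rw [h2, h3] at h1
      simp only [e]
      rw [smul_sub, sub_eq_sub_iff_sub_eq_sub]
      exact h1
    have he' : ∀ s, e s = qz q (r * s) • e 0 := by
      intro s
      induction s with
      | zero => simp
      | succ i ih =>
        rw [he, ih, smul_smul, ← qz_add]; congr 2; ring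
      | pred i ih =>
        have h1 := he (-(i : ℤ) - 1)
        rw [sub_add_cancel, ih] at h1
        have h2 := congrArg (fun x => qz q (-(r : ℤ)) • x) h1
        simp only [smul_smul, ← qz_add] at h2
        rw [neg_add_cancel, qz_zero, one_smul] at h2
        rw [← h2]; congr 2; ring
    refine ⟨fun j => if j = r then e 0 else z j, fun s => ?_⟩
    rw [Finset.sum_range_succ]
    beta_reduce
    rw [if_pos rfl, ← he' s]
    have h4 : ∑ j ∈ Finset.range r, qz q (j * s) • (if j = r then e 0 else z j) =
        ∑ j ∈ Finset.range r, qz q (j * s) • z j := by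
      refine Finset.sum_congr rfl fun j hj => ?_
      rw [if_neg (Finset.mem_range.1 hj).ne]
    rw [h4]
    simp [e]

end Factors
end QB

/-! ### Crossed submodules of finite-dimensional calculi. -/

namespace BicovariantCalculus
open QB

section Classification
variable {K : Type u} [Field K] {q : Kˣ} (C : BicovariantCalculus.{u, u, w} K (QB K q))

theorem gz_mul_mem {v : QB K q} (hv : v ∈ C.crossedSubmodule) (s : ℤ) :
    gz q s * v ∈ C.crossedSubmodule := by
  rw [mem_crossedSubmodule] at hv ⊢
  simp [rightForm_gz_mul, hv.1, hv.2]

/-- In the rules for ω(g^s v) and ω(Xv) one term contains ω(v) and the other ε(v); both are zero on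
M. -/
theorem mul_mem {v : QB K q} (hv : v ∈ C.crossedSubmodule) (a : QB K q) :
    a * v ∈ C.crossedSubmodule := by
  refine mul_induction q (P := fun a => ∀ v ∈ C.crossedSubmodule, a * v ∈ C.crossedSubmodule)
    ?_ ?_ ?_ ?_ (fun v hv => C.gz_mul_mem hv 1) (fun v hv => C.gz_mul_mem hv (-1)) a v hv
  · intro k v hv
    rw [← Algebra.smul_def]
    exact Submodule.smul_mem _ _ hv
  · intro a b ha hb v hv
    rw [add_mul]
    exact add_mem (ha v hv) (hb v hv)
  · intro a b ha hb v hv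
    rw [mul_assoc]
    exact ha _ (hb v hv)
  · intro v hv
    rw [mem_crossedSubmodule] at hv ⊢
    simp [rightForm_X_mul, hv.1, hv.2]

theorem degScale_mem {v : QB K q} (hv : v ∈ C.crossedSubmodule) :
    degScale q v ∈ C.crossedSubmodule := by
  rw [mem_crossedSubmodule] at hv ⊢
  rw [counit_degScale, ← actG_rightForm, hv.1, hv.2, map_zero]
  exact ⟨rfl, rfl⟩

/-- Here and in `degScale_mem` left covariance enters: the left coaction carries the relation ω(v) =
0 along. -/
theorem coadX_mem {v : QB K q} (hv : v ∈ C.crossedSubmodule) :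
    coadX q v ∈ C.crossedSubmodule := by
  rw [mem_crossedSubmodule] at hv ⊢
  rw [counit_coadX, ← actX_rightForm, hv.2, map_zero]
  exact ⟨rfl, rfl⟩

/-- Nonzero forms ω(X^n) would be eigenvectors of `actG` with distinct eigenvalues, hence
independent, contradicting finite dimension. -/
theorem exists_X_pow_mem (hq : ∀ n : ℕ, 0 < n → q ^ n ≠ 1)
    [FiniteDimensional K C.rightInvariants] : ∃ N, mono q (N, 0) ∈ C.crossedSubmodule := by
  by_contra! hN
  -- Only positive powers are used, because 1 is not in ker ε.
  have h0 : ∀ n : ℕ, C.rightForm (mono q (n + 1, 0)) ≠ 0 := by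
    intro n h
    exact hN (n + 1) (C.mem_crossedSubmodule.2 ⟨by simp [counit_mono], h⟩)
  have hli := Module.End.eigenvectors_linearIndependent' C.actG
    (fun n : ℕ => qz q (-((n + 1 : ℕ) : ℤ)))
    (fun a b h => by have := qz_injective hq h; omega)
    (fun n => C.rightForm (mono q (n + 1, 0))) (fun n => ⟨by
      rw [Module.End.mem_eigenspace_iff, actG_rightForm, degScale_mono, map_smul], h0 n⟩)
  have hli' : LinearIndependent K (fun n : ℕ =>
      (⟨C.rightForm (mono q (n + 1, 0)), C.rightForm_mem_rightInvariants _⟩ :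
        C.rightInvariants)) := LinearIndependent.of_comp C.rightInvariants.subtype hli
  have := hli'.finite
  exact not_finite ℕ

/-- Descends from X^N by `coadX`: each application lowers the power of X by one, shifts the roots
already present and creates a factor 1 - g, the new lowest root up to sign. -/
theorem gProd_mul_mem (hq : ∀ n : ℕ, 0 < n → q ^ n ≠ 1) {N : ℕ}
    (hN : mono q (N, 0) ∈ C.crossedSubmodule) (r i : ℕ) (h : i + r = N) :
    gProd q 0 r * mono q (i, 0) ∈ C.crossedSubmodule := by
  induction r generalizing i with
  | zero =>
    subst h
    simpa [gProd] using hN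
  | succ r ih =>
    have h1 := C.coadX_mem (ih (i + 1) (by omega))
    rw [coadX_gProd_mul, coadX_mono, mul_smul_comm, smul_smul, Nat.add_sub_cancel,
      ← neg_sub (gz q 1) 1, neg_mul, mul_neg, smul_neg, neg_mem_iff, ← mul_assoc] at h1
    rw [gProd_succ', Nat.cast_zero, qz_zero, map_one]
    exact (Submodule.smul_mem_iff _ (mul_ne_zero (qz_ne_zero _ _) (pInt_ne_zero hq i))).1 h1

/-- The left ideal underlying the crossed submodule. -/
noncomputable def crossedIdeal : Submodule (QB K q) (QB K q) where
  carrier := C.crossedSubmodule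
  add_mem' := add_mem
  zero_mem' := zero_mem _
  smul_mem' a _ hv := C.mul_mem hv a

/-- The crossed submodule of a finite dimensional calculus contains the annihilator of a finite
dimensional subspace. -/
theorem exists_annihilator_le (hq : ∀ n : ℕ, 0 < n → q ^ n ≠ 1)
    [FiniteDimensional K C.rightInvariants] : ∃ Λ : Submodule K (QB K q),
      FiniteDimensional K Λ ∧ ∀ v, (∀ x ∈ Λ, pairing q x v = 0) → v ∈ C.crossedSubmodule := by
  obtain ⟨N, hN⟩ := C.exists_X_pow_mem hq
  have h1 : ∀ i : ℕ, ∃ y : ℕ → QB K q ⧸ C.crossedIdeal, ∀ s : ℤ,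
      gz q s • C.crossedIdeal.mkQ (mono q (i, 0)) =
        ∑ j ∈ Finset.range (N - i), qz q (j * s) • y j := by
    intro i
    refine exists_eigenvectors hq _ _ ?_
    rw [← map_smul, Submodule.mkQ_apply, Submodule.Quotient.mk_eq_zero, smul_eq_mul]
    rcases le_or_gt i N with h | h
    -- For i > N, the other case, the sum over `Finset.range (N - i)` is empty and X^i already lies
    -- in the left ideal.
    · exact C.gProd_mul_mem hq hN _ _ (by omega)
    · have : mono q (i, 0) = mono q (i - N, 0) * mono q (N, 0) := by
        simp [mono_def, ← pow_add, Nat.sub_add_cancel h.le]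
      rw [this, ← mul_assoc]
      exact C.mul_mem hN _
  choose y hy using h1
  refine ⟨Submodule.span K ((fun p : ℕ × ℕ => mono q (p.1, -((p.1 : ℤ) + p.2))) ''
    (Finset.range N ×ˢ Finset.range N : Finset (ℕ × ℕ))),
    FiniteDimensional.span_of_finite K ((Finset.finite_toSet _).image _), fun v hv => ?_⟩
  -- Modulo M one has X^i g^s = q^{si} g^s X^i = Σ_j q^{(i+j)s} y_{i,j}, and q^{(i+j)s} is ⟨X^i
  -- g^{-(i+j)}, X^i g^s⟩ divided by `normX q i`; this dictates the functionals.
  let f : QB K q →ₗ[K] QB K q ⧸ C.crossedIdeal := ∑ i ∈ Finset.range N,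
    ∑ j ∈ Finset.range (N - i), (normX q i)⁻¹ •
      (pairing q (mono q (i, -((i : ℤ) + j)))).smulRight (y i j)
  have key : C.crossedIdeal.mkQ.restrictScalars K = f := by
    refine linearMap_ext q fun n s => ?_
    have h2 : mono q (n, s) = qz q (s * n) • gz q s * mono q (n, 0) := by
      rw [smul_mul_assoc, gz_mul_mono, smul_smul, qz_mul_neg, one_smul, add_zero]
    simp only [f, LinearMap.sum_apply, LinearMap.smul_apply, LinearMap.smulRight_apply,
      pairing_mono]
    rw [LinearMap.restrictScalars_apply, h2, smul_mul_assoc, ← smul_eq_mul (gz q s),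
      Submodule.mkQ_apply, Submodule.Quotient.mk_smul, Submodule.Quotient.mk_smul,
      ← Submodule.mkQ_apply, hy]
    refine Eq.trans ?_ (Finset.sum_eq_single n ?_ ?_).symm
    · rw [Finset.smul_sum]
      refine Finset.sum_congr rfl fun j _ => ?_
      rw [if_pos rfl, smul_smul, smul_smul, ← mul_assoc, inv_mul_cancel₀ (normX_ne_zero hq n),
        one_mul, ← qz_add]
      congr 2; ring
    · intro i _ hi
      simp [hi]
    · intro h
      rw [Nat.sub_eq_zero_of_le (by simpa using h)]
      simp
  have h3 : C.crossedIdeal.mkQ v = f v := congrArg (fun f => f v) key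
  have h4 : f v = 0 := by
    simp only [f, LinearMap.sum_apply, LinearMap.smul_apply, LinearMap.smulRight_apply]
    refine Finset.sum_eq_zero fun i hi => Finset.sum_eq_zero fun j hj => ?_
    rw [hv _ (Submodule.subset_span ⟨(i, j), ?_, rfl⟩), zero_smul, smul_zero]
    simp only [Finset.mem_range, Finset.coe_product, Finset.coe_range, Set.mem_prod,
      Set.mem_Iio] at hi hj ⊢
    omega
  rw [h4, Submodule.mkQ_apply, Submodule.Quotient.mk_eq_zero] at h3
  exact h3

/-- Each operator on the tangent space is transpose to an operator preserving M: ad g and ad X to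
the coadjoint ones, ∂_g and ∂_X to left multiplications. -/
theorem isStable_tangentSpace : IsStable q (C.tangentSpace (pairing q)) := by
  -- Projecting to ker ε subtracts a multiple of ⟨1, ·⟩ = ε, which is zero on M.
  have hk : ∀ y v : QB K q, v ∈ C.crossedSubmodule →
      pairing q (toKerCounit K y) v = pairing q y v := by
    intro y v hv
    rw [toKerCounit, Algebra.algebraMap_eq_smul_one, map_sub, map_smul, LinearMap.sub_apply,
      LinearMap.smul_apply, pairing_one, (C.mem_crossedSubmodule.1 hv).1, smul_zero, sub_zero]
  constructor
  · exact fun x hx => (C.mem_tangentSpace.1 hx).1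
  · intro x hx
    rw [mem_tangentSpace] at hx ⊢
    refine ⟨by rw [counit_degScale, hx.1], fun v hv => ?_⟩
    rw [pairing_degScale]
    exact hx.2 _ (C.degScale_mem hv)
  · intro x hx
    rw [mem_tangentSpace] at hx ⊢
    refine ⟨counit_adX q x, fun v hv => ?_⟩
    rw [pairing_adX]
    exact hx.2 _ (C.coadX_mem hv)
  · intro x hx
    rw [mem_tangentSpace] at hx ⊢
    refine ⟨counit_toKerCounit _, fun v hv => ?_⟩
    rw [hk _ _ hv, pairing_braidedDerivation_gz]
    exact hx.2 _ (C.mul_mem hv _)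
  · intro x hx
    rw [mem_tangentSpace] at hx ⊢
    refine ⟨counit_toKerCounit _, fun v hv => ?_⟩
    rw [hk _ _ hv, pairing_braidedDerivation_X]
    exact hx.2 _ (C.mul_mem hv _)

/-- Functionals vanishing on M are all of the form ⟨x, ·⟩ with x in a fixed finite-dimensional
space. So the tangent space is finite-dimensional, hence some L_I, and M is its full annihilator in
ker ε. -/
theorem exists_crossedSubmodule_eq_perp (hq : ∀ n : ℕ, 0 < n → q ^ n ≠ 1)
    [FiniteDimensional K C.rightInvariants] : ∃ I, C.crossedSubmodule = perp q I := by
  obtain ⟨Λ, hΛ, hann⟩ := C.exists_annihilator_le hq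
  have hrep : ∀ f : QB K q →ₗ[K] K, (∀ v ∈ C.crossedSubmodule, f v = 0) →
      ∃ x ∈ Λ, pairing q x = f := fun f hf =>
    exists_pairing_eq f fun v hv => hf v (hann v hv)
  have hle : C.tangentSpace (pairing q) ≤ Λ := by
    intro x hx
    obtain ⟨y, hy, hxy⟩ := hrep (pairing q x) (C.mem_tangentSpace.1 hx).2
    exact pairing_injective hq hxy ▸ hy
  have : FiniteDimensional K (C.tangentSpace (pairing q)) := Submodule.finiteDimensional_of_le hle
  obtain ⟨I, hI⟩ := C.isStable_tangentSpace.eq_tangent hq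
  refine ⟨I, le_antisymm (fun v hv => mem_perp.2 ⟨(C.mem_crossedSubmodule.1 hv).1, fun x hx => ?_⟩)
    fun v hv => ?_⟩
  · rw [← hI, mem_tangentSpace] at hx
    exact hx.2 v hv
  -- A vector outside M is separated from M by a functional ⟨x, ·⟩; projecting x to ker ε gives a
  -- tangent vector that still separates, as the vector lies in ker ε.
  · by_contra hne
    obtain ⟨f, hfv, hf⟩ := Submodule.exists_le_ker_of_notMem hne
    obtain ⟨x, -, rfl⟩ := hrep f hf
    apply hfv
    rw [mem_perp, ← hI] at hv
    have h1 := hv.2 (toKerCounit K x) (C.mem_tangentSpace.2 ⟨counit_toKerCounit x, fun v hv => by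
      rw [toKerCounit, Algebra.algebraMap_eq_smul_one, map_sub, map_smul, LinearMap.sub_apply,
        LinearMap.smul_apply, pairing_one, (C.mem_crossedSubmodule.1 hv).1, smul_zero, sub_zero]
      exact hf hv⟩)
    rwa [toKerCounit, Algebra.algebraMap_eq_smul_one, map_sub, map_smul, LinearMap.sub_apply,
      LinearMap.smul_apply, pairing_one, hv.1, smul_zero, sub_zero] at h1

end Classification
end BicovariantCalculus

/-! ### Inner calculi, and the bimodule underlying Γ_I. -/

namespace BimoduleTensor

section Inner
variable {K : Type u} {A : Type v} {M : Type w} [Field K] [Ring A] [Bialgebra K A]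
  [AddCommGroup M] [Module K M] [Module A M] [Module Aᵐᵒᵖ M]
  [IsScalarTower K A M] [IsScalarTower K Aᵐᵒᵖ M]

variable (K A) in
/-- The inner derivation `a ↦ a η - η a`. -/
noncomputable def innerD (η : M) : A →ₗ[K] M := (lact K A M).flip η - (ract K A M).flip η

theorem innerD_apply (η : M) (a : A) : innerD K A η a = a • η - op a • η := rfl

/-- On A ⊗ Γ the map id ⊗ d is the commutator with 1 ⊗ η, so for left invariant η the required value
of the coaction on db is automatic. -/
theorem lTensor_innerD (η : M) (t : A ⊗[K] A) : (innerD K A η).lTensor A t =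
    lactL K A M t (1 ⊗ₜ η) - ractL K A M t (1 ⊗ₜ η) := by
  induction t with
  | zero => simp
  | add x y hx hy => simp only [map_add, LinearMap.add_apply, hx, hy]; abel
  | tmul a b => simp [innerD_apply, TensorProduct.tmul_sub]

theorem rTensor_innerD (η : M) (t : A ⊗[K] A) : (innerD K A η).rTensor A t =
    lactR K A M t (η ⊗ₜ 1) - ractR K A M t (η ⊗ₜ 1) := by
  induction t with
  | zero => simp
  | add x y hx hy => simp only [map_add, LinearMap.add_apply, hx, hy]; abel
  | tmul a b => simp [innerD_apply, TensorProduct.sub_tmul]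

/-- The calculus with differential `a ↦ a η - η a` on a bicovariant bimodule generated by
biinvariant `η`. -/
noncomputable def innerCalculus [SMulCommClass A Aᵐᵒᵖ M] (η : M)
    (hη : Submodule.span A (Set.range (innerD K A η)) = ⊤)
    (cL : M →ₗ[K] A ⊗[K] M)
    (hl : ∀ a x, cL (a • x) = lactL K A M (Coalgebra.comul a) (cL x))
    (hl' : ∀ (a : A) x, cL (op a • x) = ractL K A M (Coalgebra.comul a) (cL x))
    (hl0 : cL η = 1 ⊗ₜ η) (cR : M →ₗ[K] M ⊗[K] A)
    (hr : ∀ a x, cR (a • x) = lactR K A M (Coalgebra.comul a) (cR x))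
    (hr' : ∀ (a : A) x, cR (op a • x) = ractR K A M (Coalgebra.comul a) (cR x))
    (hr0 : cR η = η ⊗ₜ 1) : BicovariantCalculus.{u, v, w} K A where
  Γ := M
  d := innerD K A η
  leibniz a b := by
    simp only [innerD_apply, smul_sub, op_mul, mul_smul, smul_comm a (op b)]
    abel
  span_d := hη
  coactL := cL
  coactL_smul_d a b := by
    rw [hl, innerD_apply, map_sub, hl, hl', hl0, ← lTensor_innerD]
    rfl
  coactR := cR
  coactR_smul_d a b := by
    rw [hr, innerD_apply, map_sub, hr, hr', hr0, ← rTensor_innerD]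
    rfl

end Inner

end BimoduleTensor

namespace QB

variable {K : Type u} [Field K] (q : Kˣ)

/-- The bimodule of one-forms of the calculus `Γ_I`, free as a right module. -/
def Forms (I : CalcIndex) : Type u := Idx I → QB K q

namespace Forms
variable {q} {I : CalcIndex}

noncomputable instance : AddCommGroup (Forms q I) := inferInstanceAs (AddCommGroup (Idx I → QB K q))

noncomputable instance : Module K (Forms q I) := inferInstanceAs (Module K (Idx I → QB K q))

noncomputable instance : Module (QB K q)ᵐᵒᵖ (Forms q I) :=
  inferInstanceAs (Module (QB K q)ᵐᵒᵖ (Idx I → QB K q))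

instance : IsScalarTower K (QB K q)ᵐᵒᵖ (Forms q I) :=
  inferInstanceAs (IsScalarTower K (QB K q)ᵐᵒᵖ (Idx I → QB K q))

instance : SMulCommClass (QB K q)ᵐᵒᵖ K (Forms q I) :=
  inferInstanceAs (SMulCommClass (QB K q)ᵐᵒᵖ K (Idx I → QB K q))

@[ext] theorem ext {x y : Forms q I} (h : ∀ p, x p = y p) : x = y := funext h

@[simp] theorem add_apply (x y : Forms q I) (p : Idx I) : (x + y) p = x p + y p := rfl

@[simp] theorem sub_apply (x y : Forms q I) (p : Idx I) : (x - y) p = x p - y p := rfl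

@[simp] theorem zero_apply (p : Idx I) : (0 : Forms q I) p = 0 := rfl

@[simp] theorem smul_apply (k : K) (x : Forms q I) (p : Idx I) : (k • x) p = k • x p := rfl

@[simp] theorem op_smul_apply (a : QB K q) (x : Forms q I) (p : Idx I) :
    (op a • x) p = x p * a := rfl

/-- A coordinate of a form. -/
def coord (p : Idx I) : Forms q I →ₗ[K] QB K q where
  toFun x := x p
  map_add' _ _ := rfl
  map_smul' _ _ := rfl

@[simp] theorem coord_apply (p : Idx I) (x : Forms q I) : coord p x = x p := rfl

@[simp] theorem sum_apply {ι : Type*} (s : Finset ι) (f : ι → Forms q I) (p : Idx I) :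
    (∑ i ∈ s, f i) p = ∑ i ∈ s, f i p := map_sum (coord p) f s

variable (q) in
/-- The basic forms `η_i` of the component `n`, with `η_i = 0` for `i ≥ n`. -/
noncomputable def eta (n : I.1) (i : ℕ) : Forms q I :=
  fun p => if p.1 = n ∧ p.2.1 = i then 1 else 0

theorem eta_apply (n : I.1) (i : ℕ) (p : Idx I) :
    eta q n i p = if p.1 = n ∧ p.2.1 = i then 1 else 0 := rfl

theorem idx_eq_iff {p p' : Idx I} : p = p' ↔ p.1 = p'.1 ∧ p.2.1 = p'.2.1 := by
  refine ⟨fun h => h ▸ ⟨rfl, rfl⟩, ?_⟩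
  obtain ⟨n, i⟩ := p
  obtain ⟨n', i'⟩ := p'
  rintro ⟨h, h'⟩
  obtain rfl : n = n' := h
  obtain rfl : i = i' := Fin.ext h'
  rfl

theorem eta_apply' (p p' : Idx I) : eta q p'.1 p'.2.1 p = if p = p' then 1 else 0 := by
  rw [eta_apply]
  simp only [idx_eq_iff]

theorem eta_eq_zero {n : I.1} {i : ℕ} (h : n.1 ≤ i) : eta q n i = 0 := by
  ext ⟨m, k⟩
  rw [eta_apply, if_neg, zero_apply]
  rintro ⟨h, h'⟩
  obtain rfl : m = n := h
  have : k.1 < m.1 := k.2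
  simp only at h' this
  omega

theorem eq_sum (x : Forms q I) : x = ∑ p : Idx I, op (x p) • eta q p.1 p.2.1 := by
  ext p
  rw [sum_apply, Finset.sum_eq_single p]
  · simp [eta_apply']
  · intro p' _ h
    simp [eta_apply', h.symm]
  · simp

theorem induction {P : Forms q I → Prop} (h0 : P 0) (hadd : ∀ x y, P x → P y → P (x + y))
    (h : ∀ (b : QB K q) (n : I.1) (i : ℕ), i < n.1 → P (op b • eta q n i))
    (x : Forms q I) : P x := by
  rw [eq_sum x]
  exact Finset.sum_induction _ P hadd h0 fun p _ => h _ _ _ p.2.2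

/-- The shift `η_i ↦ η_{i+1}`. -/
def shift (x : Forms q I) : Forms q I := fun p => match p with
  | ⟨_, ⟨0, _⟩⟩ => 0
  | ⟨n, ⟨i + 1, h⟩⟩ => x ⟨n, ⟨i, Nat.lt_of_succ_lt h⟩⟩

/-- The exponent `n - 1 - i` attached to an index. -/
def weight (p : Idx I) : ℤ := (p.1.1 : ℤ) - 1 - p.2.1

/-- The shifted coordinate comes from a position whose weight is larger by one, or is zero at the
bottom; this is all that a comparison of two shifted forms uses. -/
theorem shift_apply_weight {P : QB K q → QB K q → Prop} (x y : Forms q I) (p : Idx I)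
    (h0 : P 0 0) (h : ∀ p' : Idx I, weight p' = weight p + 1 → P (x p') (y p')) :
    P (shift x p) (shift y p) := by
  obtain ⟨n, ⟨_ | i, hi⟩⟩ := p
  · exact h0
  · refine h ⟨n, ⟨i, _⟩⟩ ?_
    simp only [weight]
    push_cast
    ring

theorem shift_eta (n : I.1) (i : ℕ) : shift (eta q n i) = eta q n (i + 1) := by
  ext ⟨m, ⟨_ | k, hk⟩⟩ <;> simp [shift, eta_apply]

/-- Left multiplication by `X`. -/
noncomputable def mulX (x : Forms q I) : Forms q I :=
  fun p => qz q (weight p) • (X q * x p) + shift x p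

theorem mulX_apply (x : Forms q I) (p : Idx I) :
    mulX x p = qz q (weight p) • (X q * x p) + shift x p := rfl

/-- Left multiplication by `g ^ s`. -/
noncomputable def mulG (s : ℤ) (x : Forms q I) : Forms q I :=
  fun p => qz q (s * weight p) • (gz q s * x p)

theorem mulG_apply (s : ℤ) (x : Forms q I) (p : Idx I) :
    mulG s x p = qz q (s * weight p) • (gz q s * x p) := rfl

variable (q I) in
/-- Left multiplication by `X`. -/
noncomputable def endX : Module.End (QB K q)ᵐᵒᵖ (Forms q I) where
  toFun := mulX
  map_add' x y := by
    ext ⟨m, ⟨_ | k, hk⟩⟩ <;> simp [mulX_apply, shift, mul_add]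
    abel
  map_smul' a x := by
    induction a using MulOpposite.rec' with | _ a
    ext ⟨m, ⟨_ | k, hk⟩⟩ <;> simp [mulX_apply, shift, mul_assoc, add_mul]

variable (q I) in
/-- Left multiplication by `g ^ s`. -/
noncomputable def endG (s : ℤ) : Module.End (QB K q)ᵐᵒᵖ (Forms q I) where
  toFun := mulG s
  map_add' x y := by ext p; simp [mulG_apply, mul_add]
  map_smul' a x := by
    induction a using MulOpposite.rec' with | _ a
    ext p; simp [mulG_apply, mul_assoc]

theorem endX_apply (x : Forms q I) (p : Idx I) :
    endX q I x p = qz q (weight p) • (X q * x p) + shift x p := rfl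

theorem endG_apply (s : ℤ) (x : Forms q I) (p : Idx I) :
    endG q I s x p = qz q (s * weight p) • (gz q s * x p) := rfl

theorem endG_mul (s t : ℤ) : endG q I s * endG q I t = endG q I (s + t) := by
  ext x p
  rw [Module.End.mul_apply, endG_apply, endG_apply, endG_apply, mul_smul_comm, smul_smul, ← qz_add,
    ← mul_assoc, ← gz_add, add_mul]

theorem endG_zero : endG q I 0 = 1 := by
  ext x p
  simp [endG_apply]

/-- On the diagonal part this is Xg = qgX in A; on the shift part the factor q comes from the change
of weight by one. -/
theorem endX_mul_endG : endX q I * endG q I 1 = (q : K) • (endG q I 1 * endX q I) := by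
  ext x p
  have h : shift (endG q I 1 x) p = (q : K) • qz q (weight p) • (gz q 1 * shift x p) := by
    refine shift_apply_weight (P := fun a b => a = (q : K) • qz q (weight p) • (gz q 1 * b))
      _ _ _ (by simp) fun p' hp' => ?_
    rw [endG_apply, one_mul, hp', add_comm, qz_add, qz_one, mul_smul]
  change endX q I (endG q I 1 x) p = (q : K) • endG q I 1 (endX q I x) p
  rw [endX_apply, endG_apply, endG_apply, h, endX_apply, one_mul, mul_add, smul_add, smul_add,
    mul_smul_comm, mul_smul_comm, ← mul_assoc, X_mul_gz, smul_mul_assoc, mul_assoc, qz_one]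
  congr 1
  simp only [smul_smul]
  congr 1
  ring

variable (q I) in
/-- The left action of the algebra on forms. -/
noncomputable def leftAct : QB K q →ₐ[K] Module.End (QB K q)ᵐᵒᵖ (Forms q I) :=
  lift q (endX q I) ⟨endG q I 1, endG q I (-1), by rw [endG_mul]; exact endG_zero,
    by rw [endG_mul]; exact endG_zero⟩ endX_mul_endG

noncomputable instance : Module (QB K q) (Forms q I) :=
  Module.compHom (Forms q I) (leftAct q I).toRingHom

theorem smul_def (a : QB K q) (x : Forms q I) : a • x = leftAct q I a x := rfl

instance : SMulCommClass (QB K q) (QB K q)ᵐᵒᵖ (Forms q I) :=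
  ⟨fun a b x => (leftAct q I a).map_smul b x⟩

instance : IsScalarTower K (QB K q) (Forms q I) :=
  ⟨fun k a x => by rw [smul_def, map_smul]; rfl⟩

theorem X_smul_apply (x : Forms q I) (p : Idx I) :
    (X q • x) p = qz q (weight p) • (X q * x p) + shift x p := by
  rw [smul_def, leftAct, lift_X, endX_apply]

theorem gz_one_smul_apply (x : Forms q I) (p : Idx I) :
    (gz q 1 • x) p = qz q (weight p) • (gz q 1 * x p) := by
  rw [smul_def, leftAct, gz_one, lift_g, ← gz_one]
  exact (endG_apply 1 x p).trans (by rw [one_mul])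

theorem gz_one_smul_eta (n : I.1) (i : ℕ) :
    gz q 1 • eta q n i = qz q (n.1 - 1 - i : ℤ) • op (gz q 1) • eta q n i := by
  ext ⟨m, k⟩
  rw [gz_one_smul_apply, smul_apply, op_smul_apply, eta_apply]
  split_ifs with h
  · obtain ⟨rfl, rfl⟩ := h
    simp [weight]
  · simp

theorem X_smul_eta (n : I.1) (i : ℕ) :
    X q • eta q n i = qz q (n.1 - 1 - i : ℤ) • op (X q) • eta q n i + eta q n (i + 1) := by
  ext ⟨m, k⟩
  rw [X_smul_apply, add_apply, smul_apply, op_smul_apply, eta_apply, shift_eta]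
  split_ifs with h
  · obtain ⟨rfl, rfl⟩ := h
    simp [weight]
  · simp

end Forms
end QB

/-! ### The coactions on Γ_I and q-binomial coefficients. -/

namespace QB

section Binomial
variable {K : Type u} [Field K]

/-- The `t`-binomial coefficient `(a + j)! / (a! j!)`. -/
def tBinom (t : K) : ℕ → ℕ → K
  | 0, _ => 1
  | _ + 1, 0 => 1
  | a + 1, j + 1 => t ^ (j + 1) * tBinom t a (j + 1) + tBinom t (a + 1) j

@[simp] theorem tBinom_zero_left (t : K) (j : ℕ) : tBinom t 0 j = 1 := by
  cases j <;> rw [tBinom]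

@[simp] theorem tBinom_zero_right (t : K) (a : ℕ) : tBinom t a 0 = 1 := by
  cases a <;> rw [tBinom]

theorem tBinom_succ_succ (t : K) (a j : ℕ) : tBinom t (a + 1) (j + 1) =
    t ^ (j + 1) * tBinom t a (j + 1) + tBinom t (a + 1) j := by
  rw [tBinom]

/-- The mirror Pascal rule; the recursion for the coaction coefficients needs both. -/
theorem tBinom_succ_succ' (t : K) (a j : ℕ) : tBinom t (a + 1) (j + 1) =
    tBinom t a (j + 1) + t ^ (a + 1) * tBinom t (a + 1) j := by
  induction a generalizing j with
  | zero =>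
    induction j with
    | zero => simp [tBinom_succ_succ, add_comm]
    | succ j ih =>
      have h1 := tBinom_succ_succ t 0 (j + 1)
      have h2 := tBinom_succ_succ t 0 j
      simp only [tBinom_zero_left] at ih h1 h2 ⊢
      linear_combination h1 + ih - t * h2
  | succ a iha =>
    induction j with
    | zero =>
      have h := tBinom_succ_succ t (a + 1) 0
      have h1 := tBinom_succ_succ t a 0
      have h2 := iha 0
      simp only [tBinom_zero_right] at *
      linear_combination h + t * h2 - h1
    | succ j ihj =>
      have h1 := tBinom_succ_succ t (a + 1) (j + 1)
      have h2 := tBinom_succ_succ t (a + 1) j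
      have h3 := tBinom_succ_succ t a (j + 1)
      have h4 := iha (j + 1)
      linear_combination h1 + t ^ (j + 2) * h4 + ihj - h3 - t ^ (a + 1 + 1) * h2

end Binomial

namespace Forms
open BimoduleTensor
variable {K : Type u} [Field K] {q : Kˣ} {I : CalcIndex}

variable (q) in
/-- The product `(1 - q ^ (n - 1 - j)) (1 - q ^ (n - 2 - j)) ⋯`, with `a` factors. -/
def fallProd (n : ℕ) (a j : ℕ) : K :=
  ∏ k ∈ Finset.range a, (1 - qz q ((n : ℤ) - 1 - j - k))

theorem fallProd_succ (n a j : ℕ) :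
    fallProd q n (a + 1) j = fallProd q n a j * (1 - qz q ((n : ℤ) - 1 - j - a)) := by
  rw [fallProd, Finset.prod_range_succ, fallProd]

theorem fallProd_succ' (n a j : ℕ) :
    fallProd q n (a + 1) j = fallProd q n a (j + 1) * (1 - qz q ((n : ℤ) - 1 - j)) := by
  rw [fallProd, Finset.prod_range_succ', fallProd]
  congr 1
  · refine Finset.prod_congr rfl fun k _ => ?_
    congr 2; push_cast; ring
  · congr 2; push_cast; ring

variable (q) in
/-- The coefficient of `X ^ a g ^ j ⊗ η_j` in the left coaction of `η_{a+j}`. -/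
def thetaCoeff (n a j : ℕ) : K := tBinom (qz q (-1)) a j * fallProd q n a j

theorem thetaCoeff_zero_left (n j : ℕ) : thetaCoeff q n 0 j = 1 := by
  simp [thetaCoeff, fallProd]

theorem thetaCoeff_succ_zero (n a : ℕ) : thetaCoeff q n (a + 1) 0 =
    (1 - qz q ((n : ℤ) - 1 - a)) * thetaCoeff q n a 0 := by
  rw [thetaCoeff, fallProd_succ, thetaCoeff, tBinom_zero_right, tBinom_zero_right]
  push_cast
  rw [sub_zero]
  ring

/-- The recursion imposed by η_{i+1} = Xη_i - q^{n-1-i}η_i X. After removing the common `fallProd`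
it is one Pascal rule minus a multiple of the other. -/
theorem thetaCoeff_succ_succ (n a j : ℕ) : thetaCoeff q n (a + 1) (j + 1) =
    (1 - qz q ((n : ℤ) - 1 - a - 2 * (j + 1 : ℕ))) * thetaCoeff q n a (j + 1) +
      qz q (-((a + 1 : ℕ) : ℤ)) * thetaCoeff q n (a + 1) j := by
  have hpow : ∀ k : ℕ, qz q (-1) ^ k = qz q (-(k : ℤ)) := by
    intro k
    rw [← inv_eq_qz, qz_neg_natCast]
  have h1 := tBinom_succ_succ (qz q (-1)) a j
  have h2 := tBinom_succ_succ' (qz q (-1)) a j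
  rw [hpow] at h1 h2
  have e1 : qz q ((n : ℤ) - 1 - (j + 1 : ℕ) - a) =
      qz q (n - 1) * qz q (-((a + 1 : ℕ) : ℤ)) * qz q (-(j : ℤ)) := by
    rw [← qz_add, ← qz_add]; congr 1; push_cast; ring
  have e2 : qz q ((n : ℤ) - 1 - a - 2 * (j + 1 : ℕ)) = qz q (n - 1) *
      qz q (-((a + 1 : ℕ) : ℤ)) * qz q (-(j : ℤ)) * qz q (-((j + 1 : ℕ) : ℤ)) := by
    rw [← qz_add, ← qz_add, ← qz_add]; congr 1; push_cast; ring
  have e3 : qz q ((n : ℤ) - 1 - j) = qz q (n - 1) * qz q (-(j : ℤ)) := by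
    rw [← qz_add]; congr 1
  rw [thetaCoeff, thetaCoeff, thetaCoeff, fallProd_succ' n a j, fallProd_succ n a (j + 1),
    e1, e2, e3]
  linear_combination fallProd q n a (j + 1) *
    (h2 - qz q (n - 1) * qz q (-((a + 1 : ℕ) : ℤ)) * qz q (-(j : ℤ)) * h1)

variable (q) in
/-- The vector `X ^ a g ^ j ⊗ η_j`. -/
noncomputable def thetaTerm (n : I.1) (a j : ℕ) : QB K q ⊗[K] Forms q I :=
  mono q (a, (j : ℤ)) ⊗ₜ eta q n j

variable (q) in
/-- The left coaction of `η_i`. -/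
noncomputable def theta (n : I.1) (i : ℕ) : QB K q ⊗[K] Forms q I :=
  ∑ p ∈ Finset.HasAntidiagonal.antidiagonal i, thetaCoeff q n.1 p.1 p.2 • thetaTerm q n p.1 p.2

theorem theta_zero (n : I.1) : theta q n 0 = 1 ⊗ₜ eta q n 0 := by
  simp [theta, thetaCoeff_zero_left, thetaTerm, mono_zero_zero]

/-- Consistency with η_n = 0: in the terms with a > 0 and a + j = n the last factor of `fallProd` is
1 - q^0, and for a = 0 the form η_n itself is zero. -/
theorem theta_self (n : I.1) : theta q n n.1 = 0 := by
  refine Finset.sum_eq_zero fun p hp => ?_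
  obtain ⟨a, j⟩ := p
  rw [Finset.HasAntidiagonal.mem_antidiagonal] at hp
  rcases a with _ | a
  · simp only [thetaTerm]
    rw [eta_eq_zero (by simp only at hp; omega), TensorProduct.tmul_zero, smul_zero]
  · simp only [thetaCoeff, fallProd_succ] at hp ⊢
    have h : (n.1 : ℤ) - 1 - j - a = 0 := by omega
    rw [h, qz_zero, sub_self, mul_zero, mul_zero, zero_smul]

theorem lactL_comul_X_thetaTerm (n : I.1) (a j : ℕ) :
    lactL K _ _ (Coalgebra.comul (R := K) (X q)) (thetaTerm q n a j) =
      qz q (n.1 - 1 - (a + j : ℕ)) •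
        ractL K _ _ (Coalgebra.comul (R := K) (X q)) (thetaTerm q n a j) +
      ((1 - qz q ((n.1 : ℤ) - 1 - a - 2 * j)) • thetaTerm q n (a + 1) j +
        qz q (-(a : ℤ)) • thetaTerm q n a (j + 1)) := by
  have e : qz q ((n.1 : ℤ) - 1 - a - 2 * j) = qz q (n.1 - 1 - (a + j : ℕ)) * qz q (-(j : ℤ)) := by
    rw [← qz_add]; congr 1; push_cast; ring
  have e' : qz q (-(a : ℤ)) * qz q (n.1 - 1 - j) = qz q (n.1 - 1 - (a + j : ℕ)) := by
    rw [← qz_add]; congr 1; push_cast; ring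
  rw [comul_X, thetaTerm, map_add, map_add, LinearMap.add_apply, LinearMap.add_apply, lactL_tmul,
    lactL_tmul, ractL_tmul, ractL_tmul, X_mul_mono, gz_mul_mono, mono_mul_X, mono_mul_gz,
    X_smul_eta, one_smul, op_one, one_smul, e, ← e', thetaTerm, thetaTerm, one_mul,
    TensorProduct.tmul_add, TensorProduct.tmul_smul, Nat.cast_add, Nat.cast_one, add_comm 1 (j : ℤ)]
  simp only [← TensorProduct.smul_tmul', smul_add, smul_smul]
  module

theorem lactL_comul_X_theta (n : I.1) (i : ℕ) :
    lactL K _ _ (Coalgebra.comul (R := K) (X q)) (theta q n i) =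
      qz q (n.1 - 1 - i) • ractL K _ _ (Coalgebra.comul (R := K) (X q)) (theta q n i) +
        theta q n (i + 1) := by
  -- The new coaction is sorted by origin: `A` collects terms where X raised the left leg, `B` those
  -- where it shifted η_j. Each is zero on one edge of the antidiagonal.
  let A : ℕ × ℕ → QB K q ⊗[K] Forms q I := fun p => match p with
    | (0, _) => 0
    | (a + 1, j) => ((1 - qz q ((n.1 : ℤ) - 1 - a - 2 * j)) * thetaCoeff q n.1 a j) •
        thetaTerm q n (a + 1) j
  let B : ℕ × ℕ → QB K q ⊗[K] Forms q I := fun p => match p with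
    | (_, 0) => 0
    | (a, j + 1) => (qz q (-(a : ℤ)) * thetaCoeff q n.1 a j) • thetaTerm q n a (j + 1)
  have hAB : theta q n (i + 1) =
      ∑ p ∈ Finset.HasAntidiagonal.antidiagonal (i + 1), (A p + B p) := by
    refine Finset.sum_congr rfl fun p hp => ?_
    obtain ⟨a, j⟩ := p
    rcases a with _ | a <;> rcases j with _ | j
    · simp at hp
    · simp [A, B, thetaCoeff_zero_left]
    · simp [A, B, thetaCoeff_succ_zero]
    · simp only [A, B]
      rw [thetaCoeff_succ_succ, add_smul]
  rw [hAB, Finset.sum_add_distrib, Finset.Nat.sum_antidiagonal_succ,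
    Finset.Nat.sum_antidiagonal_succ']
  simp only [theta, map_sum, Finset.smul_sum]
  change _ = _ + ((0 + ∑ p ∈ _, _) + (0 + ∑ p ∈ _, _))
  rw [zero_add, zero_add, ← Finset.sum_add_distrib, ← Finset.sum_add_distrib]
  refine Finset.sum_congr rfl fun p hp => ?_
  obtain ⟨a, j⟩ := p
  rw [Finset.HasAntidiagonal.mem_antidiagonal] at hp
  rw [map_smul, lactL_comul_X_thetaTerm, hp, map_smul, smul_add, smul_add, smul_smul, smul_smul,
    smul_smul, smul_smul, mul_comm (thetaCoeff _ _ _ _), mul_comm (thetaCoeff _ _ _ _),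
    mul_comm (thetaCoeff _ _ _ _)]

theorem lactL_comul_gz_theta (n : I.1) (i : ℕ) :
    lactL K _ _ (Coalgebra.comul (R := K) (gz q 1)) (theta q n i) =
      qz q (n.1 - 1 - i) • ractL K _ _ (Coalgebra.comul (R := K) (gz q 1)) (theta q n i) := by
  simp only [theta, map_sum, Finset.smul_sum]
  refine Finset.sum_congr rfl fun p hp => ?_
  obtain ⟨a, j⟩ := p
  rw [Finset.HasAntidiagonal.mem_antidiagonal] at hp
  have e : qz q (-(a : ℤ)) * qz q (n.1 - 1 - j) = qz q (n.1 - 1 - i) := by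
    rw [← qz_add, ← hp]; congr 1; push_cast; ring
  rw [map_smul, map_smul, thetaTerm, comul_gz, lactL_tmul, ractL_tmul, gz_one_smul_eta, gz_mul_mono,
    mono_mul_gz, TensorProduct.tmul_smul, ← TensorProduct.smul_tmul', one_mul, smul_comm (qz q _),
    add_comm 1 (j : ℤ), smul_comm (qz q (_ - _)) (thetaCoeff _ _ _ _), smul_smul (qz q _) (qz q _),
    ← e, mul_comm]

variable (q I) in
/-- The left coaction. -/
noncomputable def coactL : Forms q I →ₗ[K] QB K q ⊗[K] Forms q I :=
  ∑ p : Idx I, (ractL K _ _).flip (theta q p.1 p.2.1) ∘ₗ Coalgebra.comul ∘ₗ coord p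

variable (q I) in
/-- The right coaction. -/
noncomputable def coactR : Forms q I →ₗ[K] Forms q I ⊗[K] QB K q :=
  ∑ p : Idx I, (ractR K _ _).flip (eta q p.1 p.2.1 ⊗ₜ 1) ∘ₗ Coalgebra.comul ∘ₗ coord p

theorem coactL_apply (x : Forms q I) : coactL q I x =
    ∑ p : Idx I, ractL K _ _ (Coalgebra.comul (R := K) (x p)) (theta q p.1 p.2.1) := by
  simp [coactL]

theorem coactR_apply (x : Forms q I) : coactR q I x =
    ∑ p : Idx I, ractR K _ _ (Coalgebra.comul (R := K) (x p)) (eta q p.1 p.2.1 ⊗ₜ 1) := by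
  simp [coactR]

theorem coactL_op_smul (a : QB K q) (x : Forms q I) :
    coactL q I (op a • x) = ractL K _ _ (Coalgebra.comul (R := K) a) (coactL q I x) := by
  simp only [coactL_apply, map_sum, op_smul_apply, Bialgebra.comul_mul, ractL_mul]

theorem coactR_op_smul (a : QB K q) (x : Forms q I) :
    coactR q I (op a • x) = ractR K _ _ (Coalgebra.comul (R := K) a) (coactR q I x) := by
  simp only [coactR_apply, map_sum, op_smul_apply, Bialgebra.comul_mul, ractR_mul]

theorem ractL_comul_one (y : QB K q ⊗[K] Forms q I) :
    ractL K _ _ (Coalgebra.comul (R := K) (1 : QB K q)) y = y := by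
  rw [Bialgebra.comul_one, Algebra.TensorProduct.one_def]
  induction y with
  | zero => simp
  | add x y hx hy => rw [map_add, hx, hy]
  | tmul a b => simp

theorem lactL_comul_one (y : QB K q ⊗[K] Forms q I) :
    lactL K _ _ (Coalgebra.comul (R := K) (1 : QB K q)) y = y := by
  rw [Bialgebra.comul_one, Algebra.TensorProduct.one_def]
  induction y with
  | zero => simp
  | add x y hx hy => rw [map_add, hx, hy]
  | tmul a b => simp

theorem lactR_comul_one (y : Forms q I ⊗[K] QB K q) :
    lactR K _ _ (Coalgebra.comul (R := K) (1 : QB K q)) y = y := by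
  rw [Bialgebra.comul_one, Algebra.TensorProduct.one_def]
  induction y with
  | zero => simp
  | add x y hx hy => rw [map_add, hx, hy]
  | tmul a b => simp

/-- The boundary value i = n is included because Xη_{n-1} involves η_n = 0. -/
theorem coactL_eta (n : I.1) {i : ℕ} (hi : i ≤ n.1) : coactL q I (eta q n i) = theta q n i := by
  rcases hi.eq_or_lt with rfl | hi
  · rw [eta_eq_zero le_rfl, theta_self, map_zero]
  · rw [coactL_apply, Finset.sum_eq_single ⟨n, ⟨i, hi⟩⟩]
    · have := eta_apply' (q := q) (I := I) ⟨n, ⟨i, hi⟩⟩ ⟨n, ⟨i, hi⟩⟩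
      simp only [if_true] at this
      rw [this, ractL_comul_one]
    · intro p _ hp
      have := eta_apply' (q := q) p ⟨n, ⟨i, hi⟩⟩
      rw [if_neg hp] at this
      simp only at this
      rw [this]
      simp
    · simp

theorem coactR_eta (n : I.1) (i : ℕ) : coactR q I (eta q n i) = eta q n i ⊗ₜ 1 := by
  rcases le_or_gt n.1 i with hi | hi
  · rw [eta_eq_zero hi, map_zero, TensorProduct.zero_tmul]
  · rw [coactR_apply, Finset.sum_eq_single ⟨n, ⟨i, hi⟩⟩]
    · have := eta_apply' (q := q) (I := I) ⟨n, ⟨i, hi⟩⟩ ⟨n, ⟨i, hi⟩⟩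
      simp only [if_true] at this
      rw [this, Bialgebra.comul_one, Algebra.TensorProduct.one_def]
      simp
    · intro p _ hp
      have := eta_apply' (q := q) p ⟨n, ⟨i, hi⟩⟩
      rw [if_neg hp] at this
      simp only at this
      rw [this]
      simp
    · simp

theorem coactL_smul (a : QB K q) (x : Forms q I) :
    coactL q I (a • x) = lactL K _ _ (Coalgebra.comul (R := K) a) (coactL q I x) := by
  have hg : ∀ x : Forms q I, coactL q I (gz q 1 • x) =
      lactL K _ _ (Coalgebra.comul (R := K) (gz q 1)) (coactL q I x) := by
    intro x
    induction x using Forms.induction with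
    | h0 => rw [smul_zero, map_zero, map_zero]
    | hadd x y hx hy => rw [smul_add, map_add, hx, hy, map_add, map_add]
    | h b n i hi =>
      rw [smul_comm, gz_one_smul_eta, coactL_op_smul, coactL_op_smul, map_smul, coactL_op_smul,
        coactL_eta n hi.le, lactL_ractL, lactL_comul_gz_theta]
  refine mul_induction q (P := fun a => ∀ x : Forms q I, coactL q I (a • x) =
    lactL K _ _ (Coalgebra.comul (R := K) a) (coactL q I x)) (fun k x => ?_) (fun a b ha hb x => ?_)
    (fun a b ha hb x => ?_) (fun x => ?_) hg (fun x => ?_) a x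
  · rw [algebraMap_smul, map_smul, Algebra.algebraMap_eq_smul_one, map_smul, map_smul,
      LinearMap.smul_apply, lactL_comul_one]
  · rw [add_smul, map_add, ha, hb, map_add, map_add, LinearMap.add_apply]
  · rw [mul_smul, ha, hb, Bialgebra.comul_mul, lactL_mul]
  · induction x using Forms.induction with
    | h0 => rw [smul_zero, map_zero, map_zero]
    | hadd x y hx hy => rw [smul_add, map_add, hx, hy, map_add, map_add]
    | h b n i hi =>
      rw [smul_comm, X_smul_eta, coactL_op_smul, coactL_op_smul, map_add, map_smul, coactL_op_smul,
        coactL_eta n hi.le, coactL_eta n hi, lactL_ractL, lactL_comul_X_theta]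
  -- The rule for g^{-1} follows from that for g by invertibility.
  · have h := hg (gz q (-1) • x)
    rw [smul_smul, ← gz_add, add_neg_cancel, gz_zero, one_smul] at h
    rw [h, ← lactL_mul, ← Bialgebra.comul_mul, ← gz_add, neg_add_cancel, gz_zero, lactL_comul_one]

theorem coactR_smul (a : QB K q) (x : Forms q I) :
    coactR q I (a • x) = lactR K _ _ (Coalgebra.comul (R := K) a) (coactR q I x) := by
  have hg : ∀ x : Forms q I, coactR q I (gz q 1 • x) =
      lactR K _ _ (Coalgebra.comul (R := K) (gz q 1)) (coactR q I x) := by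
    intro x
    induction x using Forms.induction with
    | h0 => rw [smul_zero, map_zero, map_zero]
    | hadd x y hx hy => rw [smul_add, map_add, hx, hy, map_add, map_add]
    | h b n i hi =>
      rw [smul_comm, gz_one_smul_eta, coactR_op_smul, coactR_op_smul, map_smul, coactR_op_smul,
        coactR_eta, lactR_ractR, comul_gz, ractR_tmul, lactR_tmul, gz_one_smul_eta,
        one_mul, mul_one, TensorProduct.smul_tmul']
  refine mul_induction q (P := fun a => ∀ x : Forms q I, coactR q I (a • x) =
    lactR K _ _ (Coalgebra.comul (R := K) a) (coactR q I x)) (fun k x => ?_) (fun a b ha hb x => ?_)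
    (fun a b ha hb x => ?_) (fun x => ?_) hg (fun x => ?_) a x
  · rw [algebraMap_smul, map_smul, Algebra.algebraMap_eq_smul_one, map_smul, map_smul,
      LinearMap.smul_apply, lactR_comul_one]
  · rw [add_smul, map_add, ha, hb, map_add, map_add, LinearMap.add_apply]
  · rw [mul_smul, ha, hb, Bialgebra.comul_mul, lactR_mul]
  · induction x using Forms.induction with
    | h0 => rw [smul_zero, map_zero, map_zero]
    | hadd x y hx hy => rw [smul_add, map_add, hx, hy, map_add, map_add]
    | h b n i hi =>
      rw [smul_comm, X_smul_eta, coactR_op_smul, coactR_op_smul, map_add, map_smul, coactR_op_smul,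
        coactR_eta, coactR_eta, lactR_ractR, comul_X]
      simp only [map_add, LinearMap.add_apply, ractR_tmul, lactR_tmul, X_smul_eta, gz_one_smul_eta,
        TensorProduct.add_tmul, ← TensorProduct.smul_tmul', one_mul, mul_one,
        smul_add]
      abel_nf
  · have h := hg (gz q (-1) • x)
    rw [smul_smul, ← gz_add, add_neg_cancel, gz_zero, one_smul] at h
    rw [h, ← lactR_mul, ← Bialgebra.comul_mul, ← gz_add, neg_add_cancel, gz_zero, lactR_comul_one]

end Forms
end QB

/-! ### The differential of Γ_I and its crossed submodule. -/

namespace QB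

namespace Forms
open BimoduleTensor
variable {K : Type u} [Field K] {q : Kˣ} {I : CalcIndex}

theorem gz_neg_one_smul_apply (x : Forms q I) (p : Idx I) :
    (gz q (-1) • x) p = qz q (-weight p) • (gz q (-1) * x p) := by
  rw [smul_def, leftAct, gz_neg_one, lift_gInv, ← gz_neg_one]
  exact (endG_apply (-1) x p).trans (by rw [neg_one_mul])

variable (q I) in
/-- The biinvariant form `η_0` generating the differential. -/
noncomputable def eta0 : Forms q I := ∑ n : I.1, eta q n 0

theorem eta0_apply (p : Idx I) : eta0 q I p = if p.2.1 = 0 then 1 else 0 := by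
  rw [eta0, sum_apply, Finset.sum_eq_single p.1]
  · simp [eta_apply]
  · intro n _ hn
    simp [eta_apply, hn.symm]
  · simp

theorem coactL_eta0 : coactL q I (eta0 q I) = 1 ⊗ₜ eta0 q I := by
  rw [eta0, map_sum, TensorProduct.tmul_sum]
  exact Finset.sum_congr rfl fun n _ => by rw [coactL_eta n (Nat.zero_le _), theta_zero]

theorem coactR_eta0 : coactR q I (eta0 q I) = eta0 q I ⊗ₜ 1 := by
  rw [eta0, map_sum, TensorProduct.sum_tmul]
  exact Finset.sum_congr rfl fun n _ => coactR_eta n 0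

theorem span_innerD (hq : ∀ n : ℕ, 0 < n → q ^ n ≠ 1) :
    Submodule.span (QB K q) (Set.range (innerD K (QB K q) (eta0 q I))) = ⊤ := by
  set S := Submodule.span (QB K q) (Set.range (innerD K (QB K q) (eta0 q I))) with hS
  -- The left span of exact forms is a right submodule by the Leibniz rule.
  have hop : ∀ (b : QB K q), ∀ x ∈ S, op b • x ∈ S := by
    intro b x hx
    rw [hS] at hx
    induction hx using Submodule.span_induction with
    | mem x hx =>
      obtain ⟨c, rfl⟩ := hx
      have h : op b • innerD K (QB K q) (eta0 q I) c = innerD K (QB K q) (eta0 q I) (c * b) -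
          c • innerD K (QB K q) (eta0 q I) b := by
        simp only [innerD_apply, smul_sub, op_mul, mul_smul, smul_comm c (op b)]
        abel
      rw [h]
      exact sub_mem (Submodule.subset_span ⟨_, rfl⟩)
        (Submodule.smul_mem _ _ (Submodule.subset_span ⟨_, rfl⟩))
    | zero => rw [smul_zero]; exact zero_mem _
    | add x y _ _ hx hy => rw [smul_add]; exact add_mem hx hy
    | smul a x _ hx => rw [← smul_comm a (op b)]; exact Submodule.smul_mem _ _ hx
  have hK : ∀ (k : K), ∀ x ∈ S, k • x ∈ S := fun k x hx => by
    rw [← algebraMap_smul (QB K q) k x]; exact Submodule.smul_mem _ _ hx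
  -- This is dg · g^{-1}. Conjugation by g, which preserves S, has distinct eigenvalues q^{n-1} on
  -- its summands, so S contains each of them.
  have h1 : ∑ n : I.1, (qz q ((n.1 : ℤ) - 1) - 1) • eta q n 0 ∈ S.restrictScalars K := by
    have h2 := hop (gz q (-1)) _ (Submodule.subset_span ⟨gz q 1, rfl⟩)
    rw [innerD_apply, smul_sub, smul_smul, ← op_mul, ← gz_add, add_neg_cancel, gz_zero, op_one,
      one_smul, eta0, Finset.smul_sum, Finset.smul_sum, ← Finset.sum_sub_distrib] at h2
    refine (congrArg (· ∈ S) (Finset.sum_congr rfl fun n _ => ?_)).mpr h2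
    rw [gz_one_smul_eta, smul_comm (op _) (qz q _), smul_smul (op _), ← op_mul, ← gz_add,
      add_neg_cancel, gz_zero, op_one, one_smul, Nat.cast_zero, sub_zero, sub_smul, one_smul]
  have h3 : ∀ n : I.1, eta q n 0 ∈ S := by
    intro n
    have h4 := mem_of_sum_mem (S.restrictScalars K)
      (fun _ : Unit => lact K (QB K q) (Forms q I) (gz q 1) ∘ₗ ract K _ _ (gz q (-1)))
      (fun _ x hx => Submodule.smul_mem S _ (hop _ x hx)) (fun _ (n : I.1) => qz q ((n.1 : ℤ) - 1))
      Finset.univ _ (fun _ n _ => by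
        rw [LinearMap.comp_apply, lact_apply, ract_apply, smul_comm (op _) (_ - _ : K),
          smul_comm (gz q 1) (_ - _ : K), smul_comm (gz q 1) (op _), gz_one_smul_eta,
          smul_comm (op _) (qz q _), smul_smul (op _), ← op_mul, ← gz_add, add_neg_cancel, gz_zero,
          op_one, one_smul, Nat.cast_zero, sub_zero, smul_comm])
      (fun n _ n' _ hne => ⟨(), fun h => hne (Subtype.ext (by have := qz_injective hq h; omega))⟩)
      h1 n (Finset.mem_univ n)
    -- Here n ≥ 2 is essential: for n = 1 the form η_0 would commute with g.
    have hne : qz q ((n.1 : ℤ) - 1) - 1 ≠ 0 := by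
      rw [sub_ne_zero, Ne, qz_eq_one_iff hq]
      have := I.2 n.1 n.2
      omega
    have h5 := hK (qz q ((n.1 : ℤ) - 1) - 1)⁻¹ _ h4
    rwa [smul_smul, inv_mul_cancel₀ hne, one_smul] at h5
  have h6 : ∀ (n : I.1) (i : ℕ), eta q n i ∈ S := by
    intro n i
    induction i with
    | zero => exact h3 n
    | succ i ih =>
      rw [← add_sub_cancel_left (qz q (n.1 - 1 - i : ℤ) • op (X q) • eta q n i) (eta q n (i + 1)),
        ← X_smul_eta]
      exact sub_mem (Submodule.smul_mem _ _ ih) (hK _ _ (hop _ _ ih))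
  rw [eq_top_iff]
  intro x _
  induction x using Forms.induction with
  | h0 => exact zero_mem _
  | hadd x y hx hy => exact add_mem (hx trivial) (hy trivial)
  | h b n i _ => exact hop _ _ (h6 n i)

/-- The left coordinates of `a η_0`. -/
theorem smul_eta0_apply (hq : ∀ n : ℕ, 0 < n → q ^ n ≠ 1) (a : QB K q) (p : Idx I) :
    (a • eta0 q I) p =
      (normX q p.2.1)⁻¹ • braidedDerivation (pairing q) (mono q p.exps) a := by
  refine left_induction q (P := fun a => ∀ p : Idx I, (a • eta0 q I) p =
    (normX q p.2.1)⁻¹ • braidedDerivation (pairing q) (mono q p.exps) a) ?_ ?_ ?_ ?_ ?_ ?_ a p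
  · intro p
    have h := braidedDerivation_gz q p.2.1 (1 - p.1.1) 0
    rw [gz_zero] at h
    rw [one_smul, eta0_apply, Idx.exps, h]
    split_ifs with h0
    · rw [h0]; simp
    · simp
  · intro a b ha hb p
    rw [add_smul, add_apply, ha, hb, map_add, smul_add]
  · intro k a ha p
    rw [smul_assoc, smul_apply, ha, map_smul, smul_comm]
  · intro a ha p
    rw [mul_smul, X_smul_apply, ha]
    obtain ⟨n, ⟨_ | i, hi⟩⟩ := p
    · simp only [Idx.exps, shift, weight]
      rw [braidedDerivation_X_mul_zero, add_zero, mul_smul_comm, smul_comm]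
      congr 3
      push_cast; ring
    -- The shift of the left action matches the lowering term of the Leibniz rule for ∂; dividing by
    -- `normX` makes its coefficient 1.
    · simp only [Idx.exps, shift, weight]
      rw [braidedDerivation_X_mul_succ, ha, smul_add, normX_succ, smul_smul, mul_smul_comm,
        smul_comm (qz q _), add_comm, mul_inv, mul_right_comm, inv_mul_cancel₀ (pInt_ne_zero hq i),
        one_mul]
      congr 4
      push_cast; ring
  · intro a ha p
    rw [mul_smul, gz_one_smul_apply, ha, Idx.exps, braidedDerivation_gz_mul, mul_smul_comm,
      smul_comm]
    congr 3
    simp only [weight]; ring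
  · intro a ha p
    rw [mul_smul, gz_neg_one_smul_apply, ha, Idx.exps, braidedDerivation_gz_mul, mul_smul_comm,
      smul_comm]
    congr 3
    simp only [weight]; ring

/-- Subtracting η_0 a from a η_0 changes only the coordinates with i = 0, which is the -1 in g^{1-n}
- 1. -/
theorem innerD_eta0_apply (hq : ∀ n : ℕ, 0 < n → q ^ n ≠ 1) (a : QB K q) (p : Idx I) :
    innerD K (QB K q) (eta0 q I) a p = braidedDerivation (pairing q) (tvec q p) a := by
  rw [innerD_apply, sub_apply, op_smul_apply, smul_eta0_apply hq, eta0_apply, tvec,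
    braidedDerivation_smul]
  obtain ⟨n, ⟨_ | i, hi⟩⟩ := p
  · simp [Idx.exps, kmono_zero, braidedDerivation_sub, braidedDerivation_one]
  · simp [Idx.exps, kmono_succ]

theorem linearIndependent_eta :
    LinearIndependent K (fun p : Idx I => eta q p.1 p.2.1) := by
  rw [Fintype.linearIndependent_iff]
  intro c hc p
  have h := congrArg (fun x => Coalgebra.counit (R := K) (coord p x)) hc
  simp only [map_sum, map_smul, coord_apply, eta_apply', smul_eq_mul, map_zero] at h
  rw [Finset.sum_eq_single p] at h
  · simpa using h
  · intro p' _ hp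
    simp [hp.symm]
  · simp

end Forms

section Calculus
open BimoduleTensor BicovariantCalculus
variable {K : Type u} [Field K] {q : Kˣ}

/-- The calculus `Γ_I`. -/
noncomputable def calculus (hq : ∀ n : ℕ, 0 < n → q ^ n ≠ 1) (I : CalcIndex) :
    BicovariantCalculus.{u, u, u} K (QB K q) :=
  innerCalculus (Forms.eta0 q I) (Forms.span_innerD hq) (Forms.coactL q I) Forms.coactL_smul
    Forms.coactL_op_smul Forms.coactL_eta0 (Forms.coactR q I) Forms.coactR_smul
    Forms.coactR_op_smul Forms.coactR_eta0

variable (hq : ∀ n : ℕ, 0 < n → q ^ n ≠ 1) (I : CalcIndex)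

theorem calculus_d_apply (a : QB K q) (p : Idx I) :
    ((calculus hq I).d a : Forms q I) p = braidedDerivation (pairing q) (tvec q p) a :=
  Forms.innerD_eta0_apply hq a p

/-- This is ⟨x, v₁⟩v₂S(v₃) = ⟨x, v⟩1. It turns the formula for d into one for ω. -/
theorem mul_braidedDerivation_antipode (x v : QB K q) :
    LinearMap.mul' K (QB K q) (TensorProduct.map (braidedDerivation (pairing q) x)
      (HopfAlgebra.antipode K) (Coalgebra.comul (R := K) v)) =
    algebraMap K _ (pairing q x v) := by
  let m : QB K q ⊗[K] QB K q →ₗ[K] QB K q :=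
    LinearMap.mul' K (QB K q) ∘ₗ (HopfAlgebra.antipode K).lTensor (QB K q)
  let Φ : QB K q ⊗[K] (QB K q ⊗[K] QB K q) →ₗ[K] QB K q :=
    (TensorProduct.lid K (QB K q)).toLinearMap ∘ₗ TensorProduct.map (pairing q x) m
  have h1 : ∀ t : QB K q ⊗[K] QB K q, LinearMap.mul' K (QB K q)
      (TensorProduct.map (braidedDerivation (pairing q) x) (HopfAlgebra.antipode K) t) =
      Φ (TensorProduct.assoc K _ _ _ (Coalgebra.comul.rTensor (QB K q) t)) := by
    intro t
    induction t with
    | zero => simp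
    | add s t hs ht => simp only [map_add, hs, ht]
    | tmul a b =>
      rw [TensorProduct.map_tmul, LinearMap.rTensor_tmul, braidedDerivation_apply]
      induction Coalgebra.comul (R := K) a with
      | zero => simp
      | add s t hs ht => simp only [map_add, TensorProduct.add_tmul, hs, ht]
      | tmul c d => simp [Φ, m]
  have h2 : ∀ t : QB K q ⊗[K] QB K q, Φ (Coalgebra.comul.lTensor (QB K q) t) =
      algebraMap K _ (pairing q x (TensorProduct.rid K _
        ((Coalgebra.counit (R := K)).lTensor (QB K q) t))) := by
    intro t
    induction t with
    | zero => simp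
    | add s t hs ht => simp only [map_add, hs, ht]
    | tmul a b =>
      simp only [Φ, m, LinearMap.lTensor_tmul, LinearMap.comp_apply, TensorProduct.map_tmul,
        HopfAlgebra.mul_antipode_lTensor_comul_apply, LinearEquiv.coe_coe, TensorProduct.lid_tmul,
        TensorProduct.rid_tmul, map_smul, Algebra.algebraMap_eq_smul_one, smul_smul, smul_eq_mul]
      rw [mul_comm]
  rw [h1, Coalgebra.coassoc_apply, h2, Coalgebra.lTensor_counit_comul]
  simp

theorem calculus_rightForm_apply (v : QB K q) (p : Idx I) :
    ((calculus hq I).rightForm v : Forms q I) p = algebraMap K _ (pairing q (tvec q p) v) := by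
  rw [← mul_braidedDerivation_antipode, rightForm_apply]
  induction Coalgebra.comul (R := K) v with
  | zero => simp; rfl
  | add s t hs ht => simp only [map_add, ← hs, ← ht]; rfl
  | tmul a b =>
    rw [preRightForm_tmul, TensorProduct.map_tmul, LinearMap.mul'_apply, ← calculus_d_apply hq]
    rfl

/-- The coordinates of ω(v) are the scalars ⟨x, v⟩ for x in a basis of L_I, so ω(v) = 0 says exactly
that v annihilates L_I. -/
theorem calculus_crossedSubmodule : (calculus hq I).crossedSubmodule = perp q I := by
  ext v
  rw [mem_crossedSubmodule, mem_perp]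
  refine and_congr_right fun _ => ⟨fun h => ?_, fun h => Forms.ext fun p => ?_⟩
  · suffices tangent q I ≤ LinearMap.ker ((pairing q).flip v) from fun x hx => this hx
    refine Submodule.span_le.2 ?_
    rintro _ ⟨p, rfl⟩
    have h1 := calculus_rightForm_apply hq I v p
    rw [h] at h1
    have h2 := congrArg (Coalgebra.counit (R := K)) h1
    rw [Bialgebra.counit_algebraMap] at h2
    exact h2.symm.trans (map_zero _)
  · rw [calculus_rightForm_apply, h _ (Submodule.subset_span ⟨p, rfl⟩), map_zero]
    rfl

theorem calculus_tangentSpace : (calculus hq I).tangentSpace (pairing q) = tangent q I :=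
  tangentSpace_eq_tangent _ hq (calculus_crossedSubmodule hq I)

/-- The basic forms of the calculus `Γ_I`. -/
noncomputable def calculusEta (n : I.1) (i : ℕ) : (calculus hq I).Γ := Forms.eta q n i

theorem calculusEta_mem (n : I.1) (i : ℕ) :
    calculusEta hq I n i ∈ (calculus hq I).rightInvariants :=
  (mem_rightInvariants _).2 (Forms.coactR_eta n i)

theorem calculus_rightInvariants : (calculus hq I).rightInvariants =
    Submodule.span K (Set.range fun p : Idx I => calculusEta hq I p.1 p.2.1) := by
  refine le_antisymm ?_ (Submodule.span_le.2 ?_)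
  · rw [rightInvariants_eq_range]
    rintro _ ⟨v, rfl⟩
    have h : (calculus hq I).rightForm v = ∑ p : Idx I,
        op (algebraMap K (QB K q) (pairing q (tvec q p) v)) • calculusEta hq I p.1 p.2.1 := by
      refine (Forms.eq_sum _).trans (Finset.sum_congr rfl fun p _ => ?_)
      rw [calculus_rightForm_apply]
      rfl
    rw [h]
    refine sum_mem fun p _ => ?_
    rw [Algebra.algebraMap_eq_smul_one, op_smul, op_one, smul_assoc,
      one_smul]
    exact Submodule.smul_mem _ _ (Submodule.subset_span ⟨p, rfl⟩)
  · rintro _ ⟨p, rfl⟩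
    exact calculusEta_mem hq I _ _

instance : FiniteDimensional K (calculus hq I).rightInvariants := by
  rw [calculus_rightInvariants]
  exact FiniteDimensional.span_of_finite K (Set.finite_range _)

theorem finrank_calculus_rightInvariants :
    Module.finrank K (calculus hq I).rightInvariants = ∑ n ∈ I.1, n := by
  rw [calculus_rightInvariants, ← card_idx]
  exact finrank_span_eq_card (b := fun p : Idx I => calculusEta hq I p.1 p.2.1)
    Forms.linearIndependent_eta

/-- The basis of the tangent space dual to the basic forms. -/
noncomputable def tangentBasis : Module.Basis (Idx I) K (tangent q I) :=
  Module.Basis.span (linearIndependent_tvec hq I)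

theorem tangentBasis_apply (p : Idx I) : (tangentBasis hq I p : QB K q) = tvec q p :=
  congrArg Subtype.val (Module.Basis.span_apply _ p)

/-- The isomorphism of right modules `Γ_I ≅ Lin(L_I, A)`. -/
noncomputable def calculusEquiv :
    (calculus hq I).Γ ≃ₗ[(QB K q)ᵐᵒᵖ] (tangent q I →ₗ[K] QB K q) :=
  (tangentBasis hq I).constr (QB K q)ᵐᵒᵖ

theorem calculusEquiv_tangentBasis (x : (calculus hq I).Γ) (p : Idx I) :
    calculusEquiv hq I x (tangentBasis hq I p) = (x : Forms q I) p :=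
  (tangentBasis hq I).constr_basis (QB K q)ᵐᵒᵖ x p

theorem calculusEquiv_d (a : QB K q) (x : tangent q I) :
    calculusEquiv hq I ((calculus hq I).d a) x = braidedDerivation (pairing q) x.1 a := by
  let f : tangent q I →ₗ[K] QB K q :=
    { toFun := fun x => braidedDerivation (pairing q) x.1 a
      map_add' := fun x y => braidedDerivation_add q _ _ _
      map_smul' := fun k x => braidedDerivation_smul q _ _ _ }
  suffices h : calculusEquiv hq I ((calculus hq I).d a) = f by rw [h]; rfl
  refine (tangentBasis hq I).ext fun p => ?_
  rw [calculusEquiv_tangentBasis, calculus_d_apply, ← tangentBasis_apply hq]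
  rfl

end Calculus
end QB

/-! ### Classification of calculi, coirreducibility and decomposition. -/

namespace QB

section Classification
open BicovariantCalculus
variable {K : Type u} [Field K] {q : Kˣ}

theorem tangent_le_of_perp_le (hq : ∀ n : ℕ, 0 < n → q ^ n ≠ 1)
    {I J : CalcIndex} (h : perp q I ≤ perp q J) :
    tangent q J ≤ tangent q I := fun x hx =>
  mem_tangent_of_perp hq (counit_tangent x hx) fun _ hv => (mem_perp.1 (h hv)).2 x hx

theorem perp_le_of_tangent_le {I J : CalcIndex} (h : tangent q J ≤ tangent q I) :
    perp q I ≤ perp q J := fun _ hv =>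
  mem_perp.2 ⟨(mem_perp.1 hv).1, fun x hx => (mem_perp.1 hv).2 x (h hx)⟩

theorem eq_of_isomorphic_calculus (hq : ∀ n : ℕ, 0 < n → q ^ n ≠ 1)
    {C : BicovariantCalculus.{u, u, w} K (QB K q)}
    {I J : CalcIndex} (hI : C.Isomorphic (calculus hq I))
    (hJ : C.Isomorphic (calculus hq J)) : I = J := by
  have h : perp q I = perp q J := by
    rw [← calculus_crossedSubmodule hq, ← hI.crossedSubmodule_eq, hJ.crossedSubmodule_eq,
      calculus_crossedSubmodule]
  exact tangent_injective hq
    (le_antisymm (tangent_le_of_perp_le hq h.ge) (tangent_le_of_perp_le hq h.le))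

theorem existsUnique_isomorphic_calculus (hq : ∀ n : ℕ, 0 < n → q ^ n ≠ 1)
    (C : BicovariantCalculus.{u, u, w} K (QB K q))
    [FiniteDimensional K C.rightInvariants] : ∃! I, C.Isomorphic (calculus hq I) := by
  obtain ⟨I, hI⟩ := C.exists_crossedSubmodule_eq_perp hq
  have h : C.Isomorphic (calculus hq I) :=
    C.isomorphic_of_crossedSubmodule_eq (by rw [hI, calculus_crossedSubmodule])
  exact ⟨I, h, fun J hJ => eq_of_isomorphic_calculus hq hJ h⟩

theorem existsUnique_eq_tangent (hq : ∀ n : ℕ, 0 < n → q ^ n ≠ 1) {T : Submodule K (QB K q)}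
    (hT : IsQuantumTangentSpace (pairing q) T) [FiniteDimensional K T] : ∃! I, T = tangent q I := by
  obtain ⟨I, hI⟩ := hT.isStable.eq_tangent hq
  exact ⟨I, hI, fun J hJ => tangent_injective hq (hJ.symm.trans hI)⟩

theorem exists_isMorphism_calculus (hq : ∀ n : ℕ, 0 < n → q ^ n ≠ 1)
    {I J : CalcIndex} (h : J.1 ⊆ I.1) :
    ∃ f, IsMorphism (calculus hq I) (calculus hq J) f :=
  exists_isMorphism (by
    rw [calculus_crossedSubmodule, calculus_crossedSubmodule]
    exact perp_le_of_tangent_le ((tangent_le_iff hq).2 h))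

/-- A morphism from `Γ_I` to `Γ_J` forgets coordinates. -/
theorem isMorphism_calculus_apply (hq : ∀ n : ℕ, 0 < n → q ^ n ≠ 1) {I J : CalcIndex}
    {f : (calculus hq I).Γ →ₗ[QB K q] (calculus hq J).Γ}
    (hf : IsMorphism (calculus hq I) (calculus hq J) f) (x : (calculus hq I).Γ) (p : Idx I)
    (p' : Idx J) (hp : p.exps = p'.exps) : (f x : Forms q J) p' = (x : Forms q I) p := by
  have ht : tvec q p = tvec q p' := by
    have h : p.2.1 = p'.2.1 := congrArg Prod.fst hp
    rw [tvec, tvec, hp, h]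
  obtain ⟨t, rfl⟩ := (calculus hq I).formMul_surjective x
  induction t with
  | zero => rw [map_zero, map_zero]; rfl
  | add s t hs ht =>
    rw [map_add, map_add]
    exact congrArg₂ (· + ·) hs ht
  | tmul v b =>
    rw [formMul_tmul, hf.1, hf.rightForm]
    change ((calculus hq J).rightForm v : Forms q J) p' * b =
      ((calculus hq I).rightForm v : Forms q I) p * b
    rw [calculus_rightForm_apply, calculus_rightForm_apply, ht]

theorem nontrivial_calculus (hq : ∀ n : ℕ, 0 < n → q ^ n ≠ 1)
    {I : CalcIndex} {n : ℕ} (hn : n ∈ I.1) :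
    Nontrivial (calculus hq I).Γ := by
  have h2 := I.2 n hn
  exact ⟨calculusEta hq I ⟨n, hn⟩ 0, 0, Forms.linearIndependent_eta.ne_zero
    (⟨⟨n, hn⟩, ⟨0, (by omega : 0 < n)⟩⟩ : Idx I)⟩

/-- Quotients of Γ_I correspond to larger crossed submodules, hence to smaller tangent spaces, so
this mirrors irreducibility of L_I. -/
theorem isCoirreducible_calculus_iff (hq : ∀ n : ℕ, 0 < n → q ^ n ≠ 1) (I : CalcIndex) :
    (calculus hq I).IsCoirreducible ↔ ∃ n hn, I = CalcIndex.single n hn := by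
  constructor
  · rintro ⟨h1, h2⟩
    obtain ⟨n, hn⟩ : I.1.Nonempty := by
      rw [Finset.nonempty_iff_ne_empty]
      intro h
      obtain ⟨x, y, hxy⟩ := h1
      refine hxy (Forms.ext fun p => ?_)
      exact absurd (h ▸ p.1.2 : p.1.1 ∈ (∅ : Finset ℕ)) (Finset.notMem_empty _)
    refine ⟨n, I.2 n hn, ?_⟩
    obtain ⟨f, hf⟩ := exists_isMorphism_calculus hq (I := I) (J := CalcIndex.single n (I.2 n hn))
      (Finset.singleton_subset_iff.2 hn)
    have h3 := nontrivial_calculus hq (I := CalcIndex.single n (I.2 n hn))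
      (Finset.mem_singleton_self n)
    rcases h2 _ f hf with h | h
    · exact eq_of_isomorphic_calculus hq (C := calculus hq I)
        ⟨LinearEquiv.refl _ _, fun _ _ => rfl, fun _ => rfl⟩ ⟨LinearEquiv.ofBijective f h, hf⟩
    · exact absurd h (not_subsingleton _)
  · intro hI
    have hirr := (isIrreducible_tangent_iff hq I).2 hI
    obtain ⟨n, hn, rfl⟩ := hI
    refine ⟨nontrivial_calculus hq (Finset.mem_singleton_self n), fun D f hf => ?_⟩
    -- Invariant forms are the values of ω, and morphisms carry ω to ω, so the quotient is
    -- finite-dimensional and the classification applies to it.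
    have hD : FiniteDimensional K D.rightInvariants := by
      have h : D.rightInvariants = ((calculus hq (CalcIndex.single n hn)).rightInvariants).map
          (f.restrictScalars K) := by
        rw [rightInvariants_eq_range, rightInvariants_eq_range, ← LinearMap.range_comp]
        congr 1
        ext v
        exact (hf.rightForm v).symm
      rw [h]
      infer_instance
    obtain ⟨J, hJ⟩ := D.exists_crossedSubmodule_eq_perp hq
    have hle : perp q (CalcIndex.single n hn) ≤ perp q J := by
      rw [← hJ, ← calculus_crossedSubmodule hq]
      intro v hv
      rw [mem_crossedSubmodule] at hv ⊢
      exact ⟨hv.1, by rw [← hf.rightForm, hv.2, map_zero]⟩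
    rcases hirr.2.2 _ (isQuantumTangentSpace_tangent hq J) (tangent_le_of_perp_le hq hle) with h | h
    · right
      -- If the tangent space of the quotient is zero, its crossed submodule is all of ker ε; then ω
      -- vanishes and no forms remain.
      have h0 : ∀ v, D.rightForm v = 0 := by
        intro v
        have h1 : toKerCounit K v ∈ D.crossedSubmodule := by
          rw [hJ, mem_perp, h]
          refine ⟨counit_toKerCounit v, fun x hx => ?_⟩
          rw [(Submodule.mem_bot K).1 hx]
          simp
        have h2 := (D.mem_crossedSubmodule.1 h1).2
        rw [toKerCounit, map_sub, Algebra.algebraMap_eq_smul_one, map_smul, rightForm_one,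
          smul_zero, sub_zero] at h2
        exact h2
      refine subsingleton_of_forall_eq 0 fun x => ?_
      obtain ⟨t, rfl⟩ := D.formMul_surjective x
      induction t with
      | zero => simp
      | add s t hs ht => rw [map_add, hs, ht, add_zero]
      | tmul v b => rw [formMul_tmul, h0, smul_zero]
    · left
      obtain ⟨e, he⟩ := (calculus hq (CalcIndex.single n hn)).isomorphic_of_crossedSubmodule_eq
        (D := D) (by rw [hJ, calculus_crossedSubmodule, tangent_injective hq h])
      rw [hf.ext he]
      exact e.bijective

/-- For n ∈ I the canonical morphism Γ_I → Γ^n keeps the coordinates of the component n, so jointly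
these morphisms permute coordinates and are bijective. -/
theorem exists_calculus_decomposition (hq : ∀ n : ℕ, 0 < n → q ^ n ≠ 1) (I : CalcIndex) :
    ∃ e : (calculus hq I).Γ ≃ₗ[QB K q]
        (∀ n : I.1, (calculus hq (CalcIndex.single n.1 (I.2 n.1 n.2))).Γ),
      (∀ (a : QB K q) (x : (calculus hq I).Γ), e (op a • x) = op a • e x) ∧
      ∀ (a : QB K q) (n : I.1), e ((calculus hq I).d a) n =
        (calculus hq (CalcIndex.single n.1 (I.2 n.1 n.2))).d a := by
  have h : ∀ n : I.1, ∃ f, IsMorphism (calculus hq I)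
      (calculus hq (CalcIndex.single n.1 (I.2 n.1 n.2))) f := fun n =>
    exists_isMorphism_calculus hq (Finset.singleton_subset_iff.2 n.2)
  choose f hf using h
  have hf' : ∀ (n : I.1) (i : Fin n.1) (x : (calculus hq I).Γ),
      (f n x : Forms q (CalcIndex.single n.1 (I.2 n.1 n.2)))
        ⟨⟨n.1, Finset.mem_singleton_self _⟩, i⟩ = (x : Forms q I) ⟨n, i⟩ := fun n i x =>
    isMorphism_calculus_apply hq (hf n) x _ _ rfl
  refine ⟨LinearEquiv.ofBijective (LinearMap.pi f) ⟨fun x y hxy => ?_, fun y => ?_⟩,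
    fun a x => funext fun n => (hf n).1 a x, fun a n => (hf n).2 a⟩
  · refine Forms.ext fun ⟨n, i⟩ => ?_
    rw [← hf' n i x, ← hf' n i y]
    exact congrArg (fun z : (calculus hq (CalcIndex.single n.1 (I.2 n.1 n.2))).Γ =>
      (z : Forms q _) ⟨⟨n.1, Finset.mem_singleton_self _⟩, i⟩) (congrFun hxy n)
  · refine ⟨fun p => (y p.1 : Forms q _) ⟨⟨p.1.1, Finset.mem_singleton_self _⟩, p.2⟩,
      funext fun n => Forms.ext fun ⟨⟨m, hm⟩, i⟩ => ?_⟩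
    obtain rfl : m = n.1 := Finset.mem_singleton.1 hm
    exact hf' n i _

end Classification

/-! ### The braided derivations as q-difference operators. -/

section Derivations
variable {K : Type u} [Field K] (q : Kˣ)

/-- The product `[b]_q [b - 1]_q ⋯ [b - i + 1]_q`. -/
def qDescFactorial (b i : ℕ) : K := ∏ k ∈ Finset.range i, qInt (q : K) (b - k)

@[simp] theorem qDescFactorial_zero (b : ℕ) : qDescFactorial q b 0 = 1 := by
  simp [qDescFactorial]

theorem qDescFactorial_succ (b i : ℕ) :
    qDescFactorial q b (i + 1) = qDescFactorial q b i * qInt (q : K) (b - i) :=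
  Finset.prod_range_succ _ _

theorem qDescFactorial_succ_succ (b i : ℕ) :
    qDescFactorial q (b + 1) (i + 1) = qInt (q : K) (b + 1) * qDescFactorial q b i := by
  rw [qDescFactorial, Finset.prod_range_succ', mul_comm]
  simp [qDescFactorial]

/-- The factor at k = b is [0]_q; this makes the truncated exponents `b - i` harmless below. -/
theorem qDescFactorial_eq_zero {b i : ℕ} (h : b < i) : qDescFactorial q b i = 0 :=
  Finset.prod_eq_zero (Finset.mem_range.2 h) (by simp [qInt])

theorem qInt_add (t : K) (a b : ℕ) : qInt t (a + b) = qInt t a + t ^ a * qInt t b := by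
  simp only [qInt, Finset.sum_range_add, Finset.mul_sum, pow_add]

/-- Multiply [b+1]_q = q^{b-i}[i+1]_q + [b-i]_q by the descending factorial of length i. -/
theorem qDescFactorial_pascal {b i : ℕ} (h : i ≤ b) : qDescFactorial q (b + 1) (i + 1) =
    qInt (q : K) (i + 1) * qz q ((b : ℤ) - i) * qDescFactorial q b i +
      qDescFactorial q b (i + 1) := by
  obtain ⟨c, rfl⟩ := Nat.exists_eq_add_of_le' h
  have h1 : ((c + i : ℕ) : ℤ) - i = c := by push_cast; ring
  rw [qDescFactorial_succ_succ, qDescFactorial_succ, add_assoc, qInt_add, h1, qz_natCast,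
    Nat.add_sub_cancel]
  ring

theorem dqX_pow_single (i b : ℕ) (a : ℤ) (k : K) : (dqX q ^ i) (AddMonoidAlgebra.single (b, a) k) =
    AddMonoidAlgebra.single (b - i, a) (k * qDescFactorial q b i) := by
  induction i with
  | zero => simp
  | succ i ih =>
    rw [pow_succ', Module.End.mul_apply, ih, dqX, onMonomials_single, AddMonoidAlgebra.smul_single,
      qDescFactorial_succ, smul_eq_mul, mul_assoc, Nat.sub_sub]

variable {q}

/-- Induction on b by the twisted Leibniz rule, whose two terms are recombined by
`qDescFactorial_pascal`. -/
theorem braidedDerivation_X_pow (hq : ∀ n : ℕ, 0 < n → q ^ n ≠ 1) (i b : ℕ) (m : ℤ) :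
    (normX q i)⁻¹ • braidedDerivation (pairing q) (mono q (i, m)) (X q ^ b) =
      ((qFactorial (q : K) i)⁻¹ * qDescFactorial q b i * qz q (-(i + m) * (b - i))) •
        X q ^ (b - i) := by
  induction b generalizing i with
  | zero =>
    have h := braidedDerivation_gz q i m 0
    rw [gz_zero] at h
    rw [pow_zero, h]
    rcases i with _ | i
    · simp [qFactorial]
    · simp [qDescFactorial_eq_zero q (Nat.succ_pos i)]
  | succ b ih =>
    rcases i with _ | i
    · have h := ih 0
      simp only [normX_zero, inv_one, one_smul, qDescFactorial_zero, Nat.sub_zero] at h ⊢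
      rw [pow_succ', braidedDerivation_X_mul_zero, h, mul_smul_comm, smul_smul]
      congr 1
      rw [mul_left_comm, ← qz_add]
      congr 2; push_cast; ring
    · have h1 : (normX q (i + 1))⁻¹ * pInt q (i + 1) = (normX q i)⁻¹ := by
        rw [normX_succ, mul_inv, mul_right_comm, inv_mul_cancel₀ (pInt_ne_zero hq i), one_mul]
      rw [pow_succ', braidedDerivation_X_mul_succ, smul_add, smul_smul, h1, ih,
        smul_comm, ← mul_smul_comm, ih, mul_smul_comm, smul_smul]
      rcases le_or_gt b i with hb | hb
      -- For b = i only the lowering term survives, and for b < i both sides are zero.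
      · rw [qDescFactorial_eq_zero q (Nat.lt_succ_of_le hb)]
        rcases hb.eq_or_lt with rfl | hb
        · simp only [qDescFactorial_succ_succ, Nat.sub_self, sub_self, mul_zero, qz_zero, zero_smul,
            add_zero, mul_one, pow_zero, zero_mul]
          congr 1
          rw [qFactorial, qFactorial, Finset.prod_range_succ, mul_inv, ← mul_assoc, mul_assoc _ _⁻¹,
            inv_mul_cancel₀ (qInt_ne_zero hq b), mul_one]
        · rw [qDescFactorial_eq_zero q hb, qDescFactorial_eq_zero q (Nat.succ_lt_succ hb)]
          simp
      · have h2 : X q * X q ^ (b - (i + 1)) = X q ^ (b - i) := by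
          rw [← pow_succ']; congr 1; omega
        have h3 : qz q (-(i + m) * (b - i)) =
            qz q ((b : ℤ) - i) * qz q (-(((i + 1 : ℕ) : ℤ) + m) * ((b + 1 : ℕ) - (i + 1 : ℕ))) := by
          rw [← qz_add]; congr 1; push_cast; ring
        have h4 : qz q (-(i + 1 + m)) * qz q (-(((i + 1 : ℕ) : ℤ) + m) * (b - (i + 1 : ℕ))) =
            qz q (-(((i + 1 : ℕ) : ℤ) + m) * ((b + 1 : ℕ) - (i + 1 : ℕ))) := by
          rw [← qz_add]; congr 1; push_cast; ring
        have h5 : (qFactorial (q : K) i)⁻¹ =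
            (qFactorial (q : K) (i + 1))⁻¹ * qInt (q : K) (i + 1) := by
          rw [qFactorial, qFactorial, Finset.prod_range_succ, mul_inv, mul_assoc,
            inv_mul_cancel₀ (qInt_ne_zero hq i), mul_one]
        rw [h2, Nat.succ_sub_succ, ← add_smul, qDescFactorial_pascal q hb.le, h3, h5, ← h4]
        congr 1
        ring

/-- Moving ∂ past g^a produces the power of q recorded by `Qg`; the remaining exponent b - i of X
produces the one recorded by `QX`. -/
theorem braidedDerivation_normalOrder (hq : ∀ n : ℕ, 0 < n → q ^ n ≠ 1) (i : ℕ) (n : ℤ)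
    (f : CommPoly K) :
    (normX q i)⁻¹ • braidedDerivation (pairing q) (mono q (i, 1 - n)) (normalOrder q f) =
      normalOrder q (Qg q (n - 1 - i) (QX q (n - 1 - i)
        ((qFactorial (q : K) i)⁻¹ • (dqX q ^ i) f))) := by
  induction f using AddMonoidAlgebra.induction_linear with
  | zero => simp
  | add f g hf hg => simp only [map_add, smul_add, hf, hg]
  | single p k =>
    obtain ⟨b, a⟩ := p
    rw [dqX_pow_single, AddMonoidAlgebra.smul_single, QX, onMonomials_single,
      AddMonoidAlgebra.smul_single, Qg, onMonomials_single, AddMonoidAlgebra.smul_single,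
      normalOrder, onMonomials_single, onMonomials_single, map_smul, smul_comm]
    change k • (normX q i)⁻¹ • braidedDerivation (pairing q) (mono q (i, 1 - n))
      (gz q a * X q ^ b) = (_ * qz q _ * qz q _) • (gz q a * X q ^ (b - i))
    rw [braidedDerivation_gz_mul, smul_comm _ (qz q _), ← mul_smul_comm,
      braidedDerivation_X_pow hq, mul_smul_comm, smul_smul, smul_smul]
    rcases lt_or_ge b i with h | h
    · simp [qDescFactorial_eq_zero q h]
    · have h1 : qz q (-((i + (1 - n)) * a)) = qz q ((n - 1 - i) * a) := by congr 1; ring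
      have h2 : qz q (-(i + (1 - n)) * (b - i)) = qz q ((n - 1 - i) * (b - i : ℕ)) := by
        congr 1; push_cast [h]; ring
      rw [h1, h2, smul_eq_mul]
      congr 1
      ring

end Derivations

end QB

/-! ### The bases of Γ^n and L^n, and the final assembly. -/

namespace QB

theorem zero_lt_of_two_le {n : ℕ} (h : 2 ≤ n) : 0 < n := by lia

section Single
open BicovariantCalculus
variable {K : Type u} [Field K] {q : Kˣ} (hq : ∀ n : ℕ, 0 < n → q ^ n ≠ 1) {n : ℕ} (hn : 2 ≤ n)

/-- The only element of the index `{n}`. -/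
def singleElt : (CalcIndex.single n hn).1 := ⟨n, Finset.mem_singleton_self n⟩

theorem eq_singleElt (m : (CalcIndex.single n hn).1) : m = singleElt hn :=
  Subtype.ext (Finset.mem_singleton.1 m.2)

/-- The indices of the component `n`. -/
noncomputable def singleIdx : Fin n ≃ Idx (CalcIndex.single n hn) :=
  Equiv.ofBijective (fun i => ⟨singleElt hn, i⟩) ⟨fun i j h => by
    have := (Forms.idx_eq_iff.1 h).2
    exact Fin.ext this, fun ⟨m, i⟩ => by
      obtain rfl := eq_singleElt hn m
      exact ⟨i, rfl⟩⟩

/-- The coordinates of a form in `Γ^n`. -/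
noncomputable def singleCoords : (calculus hq (CalcIndex.single n hn)).Γ ≃ₗ[(QB K q)ᵐᵒᵖ]
    (Fin n → (QB K q)ᵐᵒᵖ) where
  toFun x i := op ((x : Forms q _) (singleIdx hn i))
  invFun y := fun p => unop (y ((singleIdx hn).symm p))
  map_add' _ _ := rfl
  map_smul' _ _ := rfl
  left_inv x := Forms.ext fun p => congrArg x ((singleIdx hn).apply_symm_apply p)
  right_inv y := funext fun i => congrArg y ((singleIdx hn).symm_apply_apply i)

/-- The basis `η_0, …, η_{n-1}` of `Γ^n`. -/
noncomputable def singleEta : Module.Basis (Fin n) (QB K q)ᵐᵒᵖ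
    (calculus hq (CalcIndex.single n hn)).Γ :=
  Module.Basis.ofEquivFun (singleCoords hq hn)

theorem singleEta_apply (i : Fin n) :
    singleEta hq hn i = calculusEta hq (CalcIndex.single n hn) (singleElt hn) i := by
  rw [singleEta, Module.Basis.coe_ofEquivFun, LinearEquiv.symm_apply_eq]
  funext j
  change _ = op (Forms.eta q (singleElt hn) i.1 (singleIdx hn j))
  rw [Forms.eta_apply]
  by_cases h : j = i
  · subst h
    rw [Pi.single_eq_same, if_pos ⟨rfl, rfl⟩, op_one]
  · rw [Pi.single_eq_of_ne h, if_neg fun h' => h (Fin.ext h'.2), op_zero]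

/-- The basis `φ_0, …, φ_{n-1}` of `L^n`. -/
noncomputable def singlePhi : Module.Basis (Fin n) K (tangent q (CalcIndex.single n hn)) :=
  (tangentBasis hq (CalcIndex.single n hn)).reindex (singleIdx hn).symm

theorem singlePhi_eq (i : Fin n) :
    singlePhi hq hn i = tangentBasis hq _ (singleIdx hn i) := by
  rw [singlePhi, Module.Basis.reindex_apply, Equiv.symm_symm]

theorem singlePhi_apply (i : Fin n) :
    (singlePhi hq hn i : QB K q) = (normX q i.1)⁻¹ • kmono q (i.1, 1 - (n : ℤ)) := by
  rw [singlePhi_eq, tangentBasis_apply]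
  rfl

theorem calculusEquiv_singleEta (i j : Fin n) :
    calculusEquiv hq _ (singleEta hq hn i) (singlePhi hq hn j) = if i = j then 1 else 0 := by
  rw [singlePhi_eq, calculusEquiv_tangentBasis, singleEta_apply]
  change Forms.eta q (singleElt hn) i.1 (singleIdx hn j) = _
  rw [Forms.eta_apply]
  by_cases h : i = j
  · subst h
    rw [if_pos ⟨rfl, rfl⟩, if_pos rfl]
  · rw [if_neg fun h' => h (Fin.ext h'.2.symm), if_neg h]

/-- For a one-element index the form Σ_n η_{n,0} defining d has the single summand η_0. -/
theorem smul_singleEta_zero (a : QB K q) :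
    a • singleEta hq hn ⟨0, zero_lt_of_two_le hn⟩ -
        op a • singleEta hq hn ⟨0, zero_lt_of_two_le hn⟩ =
      (calculus hq (CalcIndex.single n hn)).d a := by
  have h : Forms.eta q (singleElt hn) 0 = Forms.eta0 q (CalcIndex.single n hn) := by
    rw [Forms.eta0, Finset.sum_eq_single (singleElt hn)
      (fun m _ hm => absurd (eq_singleElt hn m) hm) (fun h => absurd (Finset.mem_univ _) h)]
  have h' : singleEta hq hn ⟨0, zero_lt_of_two_le hn⟩ =
      (Forms.eta0 q (CalcIndex.single n hn) : Forms q _) :=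
    (singleEta_apply hq hn _).trans h
  rw [h']
  rfl

theorem g_smul_singleEta (i : Fin n) : (g q : QB K q) • singleEta hq hn i =
    (q : K) ^ (n - 1 - i.1) • op (g q : QB K q) • singleEta hq hn i := by
  rw [singleEta_apply, ← gz_one, ← qz_natCast]
  refine (Forms.gz_one_smul_eta (singleElt hn) i.1).trans ?_
  have h : ((singleElt hn).1 : ℤ) - 1 - i.1 = (n - 1 - i.1 : ℕ) := by
    have := i.2
    change (n : ℤ) - 1 - i.1 = _
    omega
  rw [h]
  rfl

/-- The case distinction is absorbed by the convention that η_i is zero for i ≥ n. -/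
theorem X_smul_singleEta (i : Fin n) : X q • singleEta hq hn i =
    (q : K) ^ (n - 1 - i.1) • op (X q) • singleEta hq hn i +
      if h : i.1 + 1 < n then singleEta hq hn ⟨i.1 + 1, h⟩ else 0 := by
  have h : ((singleElt hn).1 : ℤ) - 1 - i.1 = (n - 1 - i.1 : ℕ) := by
    have := i.2
    change (n : ℤ) - 1 - i.1 = _
    omega
  have h1 : (if h : i.1 + 1 < n then singleEta hq hn ⟨i.1 + 1, h⟩ else 0) =
      calculusEta hq (CalcIndex.single n hn) (singleElt hn) (i.1 + 1) := by
    split_ifs with h1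
    · rw [singleEta_apply]
    · exact (Forms.eta_eq_zero (by change n ≤ _; omega)).symm
  rw [h1, singleEta_apply, ← qz_natCast, ← h]
  exact Forms.X_smul_eta (singleElt hn) i.1

theorem d_X_single : (calculus hq (CalcIndex.single n hn)).d (X q) =
    singleEta hq hn ⟨1, hn⟩ +
      ((q : K) ^ (n - 1) - 1) • op (X q) • singleEta hq hn ⟨0, zero_lt_of_two_le hn⟩ := by
  have h1 : 0 + 1 < n := hn
  rw [← smul_singleEta_zero, X_smul_singleEta, sub_smul, one_smul]
  simp only [Nat.sub_zero]
  rw [dif_pos h1]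
  abel

theorem d_g_single : (calculus hq (CalcIndex.single n hn)).d (g q : QB K q) =
    ((q : K) ^ (n - 1) - 1) • op (g q : QB K q) • singleEta hq hn ⟨0, zero_lt_of_two_le hn⟩ := by
  rw [← smul_singleEta_zero, g_smul_singleEta, sub_smul, one_smul]
  rfl

theorem braidedDerivation_singlePhi {i : Fin n} (hi : 1 ≤ i.1) (f : CommPoly K) :
    braidedDerivation (pairing q) (singlePhi hq hn i).1 (normalOrder q f) =
      normalOrder q (Qg q ((n : ℤ) - 1 - i.1) (QX q ((n : ℤ) - 1 - i.1)
        ((qFactorial (q : K) i.1)⁻¹ • (dqX q ^ i.1) f))) := by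
  rw [singlePhi_apply, ← braidedDerivation_normalOrder hq, braidedDerivation_smul]
  obtain ⟨i, h⟩ := i
  rcases i with _ | i
  · exact absurd hi (Nat.not_succ_le_zero 0)
  · rw [kmono_succ]

theorem braidedDerivation_singlePhi_zero (f : CommPoly K) :
    braidedDerivation (pairing q) (singlePhi hq hn ⟨0, zero_lt_of_two_le hn⟩).1 (normalOrder q f) =
      normalOrder q (Qg q ((n : ℤ) - 1) (QX q ((n : ℤ) - 1) f) - f) := by
  have h := braidedDerivation_normalOrder hq 0 n f
  simp only [normX_zero, inv_one, one_smul, Nat.cast_zero, sub_zero, pow_zero, qFactorial,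
    Finset.range_zero, Finset.prod_empty, Module.End.one_apply] at h
  rw [singlePhi_apply, normX_zero, inv_one, one_smul, kmono_zero, braidedDerivation_sub,
    braidedDerivation_one, map_sub, h]

end Single

end QB

theorem mainTheorem1 {K : Type u} [Field K] [CharZero K] (q : Kˣ)
    (hq : ∀ n : ℕ, 0 < n → q ^ n ≠ 1) :
    ∃ (Γ : CalcIndex → BicovariantCalculus.{u, u, u} K (QB K q))
      (L : CalcIndex → Submodule K (QB K q))
      (ev : ∀ I, (Γ I).Γ ≃ₗ[(QB K q)ᵐᵒᵖ] (L I →ₗ[K] QB K q)),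
      -- (a) classification of finite dimensional calculi
      (∀ I, FiniteDimensional K (Γ I).rightInvariants ∧
        Module.finrank K (Γ I).rightInvariants = ∑ n ∈ I.1, n) ∧
      (∀ C : BicovariantCalculus.{u, u, w} K (QB K q), FiniteDimensional K C.rightInvariants →
        ∃! I, C.Isomorphic (Γ I)) ∧
      -- (a) classification of finite dimensional quantum tangent spaces
      (∀ I, IsQuantumTangentSpace (QB.pairing q) (L I) ∧ FiniteDimensional K (L I) ∧
        Module.finrank K (L I) = ∑ n ∈ I.1, n) ∧
      (∀ T : Submodule K (QB K q), IsQuantumTangentSpace (QB.pairing q) T →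
        FiniteDimensional K T → ∃! I, T = L I) ∧
      -- (a) the calculus and the tangent space with the same index correspond to each other
      (∀ I, (Γ I).tangentSpace (QB.pairing q) = L I ∧
        ∀ (a : QB K q) (x : L I), ev I ((Γ I).d a) x = braidedDerivation (QB.pairing q) x.1 a) ∧
      -- (b) coirreducible calculi and irreducible tangent spaces
      (∀ I, (Γ I).IsCoirreducible ↔ ∃ n hn, I = CalcIndex.single n hn) ∧
      (∀ I, IsIrreducibleTangentSpace (QB.pairing q) (L I) ↔
        ∃ n hn, I = CalcIndex.single n hn) ∧
      -- (b) relations and braided derivations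
      (∀ (n : ℕ) (hn : 2 ≤ n),
        ∃ (η : Module.Basis (Fin n) (QB K q)ᵐᵒᵖ (Γ (CalcIndex.single n hn)).Γ)
          (φ : Module.Basis (Fin n) K (L (CalcIndex.single n hn))),
          (∀ i, η i ∈ (Γ (CalcIndex.single n hn)).rightInvariants) ∧
          (Γ (CalcIndex.single n hn)).d (QB.X q) = η ⟨1, by omega⟩ +
            ((q : K) ^ (n - 1) - 1) • op (QB.X q) • η ⟨0, by omega⟩ ∧
          (Γ (CalcIndex.single n hn)).d (QB.g q : QB K q) =
            ((q : K) ^ (n - 1) - 1) • op (QB.g q : QB K q) • η ⟨0, by omega⟩ ∧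
          (∀ a : QB K q, a • η ⟨0, by omega⟩ - op a • η ⟨0, by omega⟩ =
            (Γ (CalcIndex.single n hn)).d a) ∧
          (∀ i : Fin n, BicovariantCalculus.qComm ((q : K) ^ (n - 1 - i.1))
            (QB.g q : QB K q) (η i) = 0) ∧
          (∀ i : Fin n, BicovariantCalculus.qComm ((q : K) ^ (n - 1 - i.1)) (QB.X q) (η i) =
            if h : i.1 + 1 < n then η ⟨i.1 + 1, h⟩ else 0) ∧
          (∀ i j : Fin n, ev (CalcIndex.single n hn) (η i) (φ j) = if i = j then 1 else 0) ∧
          (∀ i : Fin n, 1 ≤ i.1 → ∀ f : QB.CommPoly K,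
            braidedDerivation (QB.pairing q) (φ i).1 (QB.normalOrder q f) =
              QB.normalOrder q (QB.Qg q ((n : ℤ) - 1 - i.1) (QB.QX q ((n : ℤ) - 1 - i.1)
                ((QB.qFactorial (q : K) i.1)⁻¹ • (QB.dqX q ^ i.1) f)))) ∧
          (∀ f : QB.CommPoly K,
            braidedDerivation (QB.pairing q) (φ ⟨0, by omega⟩).1 (QB.normalOrder q f) =
              QB.normalOrder q (QB.Qg q ((n : ℤ) - 1) (QB.QX q ((n : ℤ) - 1) f) - f))) ∧
      -- (c) decomposition into direct sums
      (∀ I, ∃ e : (Γ I).Γ ≃ₗ[QB K q] (∀ n : I.1, (Γ (CalcIndex.single n.1 (I.2 n.1 n.2))).Γ),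
        (∀ (a : QB K q) (x : (Γ I).Γ), e (op a • x) = op a • e x) ∧
        ∀ (a : QB K q) (n : I.1), e ((Γ I).d a) n =
          (Γ (CalcIndex.single n.1 (I.2 n.1 n.2))).d a) ∧
      (∀ I, iSupIndep (fun n : I.1 => L (CalcIndex.single n.1 (I.2 n.1 n.2))) ∧
        ⨆ n : I.1, L (CalcIndex.single n.1 (I.2 n.1 n.2)) = L I) := by
  open QB in
  refine ⟨calculus hq, tangent q, calculusEquiv hq, fun I => ⟨inferInstance,
    finrank_calculus_rightInvariants hq I⟩, fun C hC => existsUnique_isomorphic_calculus hq C,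
    fun I => ⟨isQuantumTangentSpace_tangent hq I, inferInstance, finrank_tangent hq I⟩,
    fun T hT hT' => existsUnique_eq_tangent hq hT,
    fun I => ⟨calculus_tangentSpace hq I, calculusEquiv_d hq I⟩, isCoirreducible_calculus_iff hq,
    isIrreducible_tangent_iff hq, fun n hn => ⟨singleEta hq hn, singlePhi hq hn, fun i => ?_,
      d_X_single hq hn, d_g_single hq hn, smul_singleEta_zero hq hn, fun i => ?_, fun i => ?_,
      calculusEquiv_singleEta hq hn, fun i hi => braidedDerivation_singlePhi hq hn hi,
      braidedDerivation_singlePhi_zero hq hn⟩, exists_calculus_decomposition hq,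
    fun I => ⟨iSupIndep_tangent_single hq I, iSup_tangent_single I⟩⟩
  · rw [singleEta_apply]
    exact calculusEta_mem hq _ _ _
  · exact sub_eq_zero.2 (g_smul_singleEta hq hn i)
  · exact sub_eq_of_eq_add' (X_smul_singleEta hq hn i)
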